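/- **Definitions.** Let $G=(V,E)$ be a finite graph with $n$ vertices. A linear layout of $G$ is an enumeration $\sigma=(v_1,\dots,v_n)$ of $V$. For $1\le i<n$, the $i$-th cut of $\sigma$ is the bipartite graph on $V$ formed by the edges of $G$ with one endpoint in $\{v_1,\dots,v_i\}$ and the other in $\{v_{i+1},\dots,v_n\}$. For a graph $H$, let $\mathrm{MIM}(H)$ be the largest number of edges of an induced matching of $H$, i.e. of a matching that is an induced subgraph of $H$. Let $mim(\sigma,G)$ be the maximum of $\mathrm{MIM}(H)$ over all cuts $H$ of $\sigma$ (and $0$ if $n=1$), and let the linear MIM-width $lmw(G)$ be the minimum of $mim(\sigma,G)$ over all linear layouts $\sigma$ of $G$. **Theorem.** A linear layout $\sigma$ of a tree $T$ with $mim(\sigma,T)=lmw(T)$ can be found in $O(n\log n)$ time, where $n$ is the number of vertices of $T$. Precisely: there is a single program for a word RAM with words of $O(\log n)$ bits and unit-cost memory access, addition, truncated subtraction, multiplication and comparison, and there is a function $t$ with $t(n)=O(n\log n)$, such that for every tree $T$ on the vertex set $\{0,\dots,n-1\}$, given by adjacency lists (in arbitrary order), the program halts after at most $t(n)$ steps,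 having written to an output array the vertices of $T$ in the order of a linear layout $\sigma$ of $T$ with $mim(\sigma,T)=lmw(T)$. -/

import Mathlib

open Filter Asymptotics

/-! ### Maximum induced matchings, linear layouts and LMIM-width -/

/-- The bipartite graph of the cut of the layout `σ` after its first `i` vertices: the edges of `G`
with one endpoint among the first `i` vertices of `σ` and the other endpoint among the remaining
ones.  A layout `σ : Fin n ≃ V` sends a position to the vertex at this position. -/
def cutGraph {V : Type*} {n : ℕ} (G : SimpleGraph V) (σ : Fin n ≃ V) (i : ℕ) : SimpleGraph V where
  Adj u v := G.Adj u v ∧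
    (((σ.symm u : ℕ) < i ∧ i ≤ (σ.symm v : ℕ)) ∨ ((σ.symm v : ℕ) < i ∧ i ≤ (σ.symm u : ℕ)))
  symm := ⟨fun _ _ h => ⟨h.1.symm, h.2.symm⟩⟩
  loopless := ⟨fun v h => G.loopless.irrefl v h.1⟩

/-- The largest number of edges of an induced matching of the (finite) graph `H`, that is, of a
matching that is an induced subgraph of `H`. -/
noncomputable def maxInducedMatching {V : Type*} (H : SimpleGraph V) : ℕ :=
  sSup {k : ℕ | ∃ M : H.Subgraph, M.IsMatching ∧ M.IsInduced ∧ M.edgeSet.ncard = k}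

/-- `mim(σ, G)`: the maximum, over the cuts of `σ`, of the maximum induced matching of the cut
(`0` if there is no cut, that is, for a single vertex). -/
noncomputable def layoutMim {V : Type*} {n : ℕ} (G : SimpleGraph V) (σ : Fin n ≃ V) : ℕ :=
  (Finset.Ico 1 n).sup fun i => maxInducedMatching (cutGraph G σ i)

/-- `lmw(G)`: the minimum of `mim(σ, G)` over all linear layouts `σ` of the finite graph `G`. -/
noncomputable def lmw {V : Type*} (G : SimpleGraph V) : ℕ :=
  sInf {k : ℕ | ∃ (n : ℕ) (σ : Fin n ≃ V), layoutMim G σ = k}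

/-! ### A word RAM with structured control flow and its step count -/

namespace WordRAM

/-- The memory: scalar registers, and arrays.  Registers and arrays are addressed by numerals of
the program, so that a program uses a constant number of them; the cells of an array are addressed
by computed values. -/
structure Store where
  reg : ℕ → ℕ
  arr : ℕ → ℕ → ℕ

def Store.setReg (s : Store) (x v : ℕ) : Store :=
  { s with reg := fun y => if y = x then v else s.reg y }

def Store.setArr (s : Store) (a i v : ℕ) : Store :=
  { s with arr := fun b j => if b = a ∧ j = i then v else s.arr b j }

/-- Arithmetic expressions. -/
inductive Expr where
  | const (k : ℕ)
  | reg (x : ℕ)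
  | read (a : ℕ) (i : Expr)
  | add (e f : Expr)
  | sub (e f : Expr)
  | mul (e f : Expr)

/-- The value of an expression; `sub` is truncated subtraction. -/
def Expr.eval (s : Store) : Expr → ℕ
  | .const k => k
  | .reg x => s.reg x
  | .read a i => s.arr a (i.eval s)
  | .add e f => e.eval s + f.eval s
  | .sub e f => e.eval s - f.eval s
  | .mul e f => e.eval s * f.eval s

/-- The number of steps for evaluating an expression: one per constant, memory access or
operation. -/
def Expr.cost : Expr → ℕ
  | .const _ => 1
  | .reg _ => 1
  | .read _ i => i.cost + 1
  | .add e f => e.cost + f.cost + 1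
  | .sub e f => e.cost + f.cost + 1
  | .mul e f => e.cost + f.cost + 1

/-- Tests. -/
inductive Test where
  | eq (e f : Expr)
  | lt (e f : Expr)
  | neg (b : Test)
  | conj (b c : Test)

def Test.holds (s : Store) : Test → Prop
  | .eq e f => e.eval s = f.eval s
  | .lt e f => e.eval s < f.eval s
  | .neg b => ¬ b.holds s
  | .conj b c => b.holds s ∧ c.holds s

def Test.cost : Test → ℕ
  | .eq e f => e.cost + f.cost + 1
  | .lt e f => e.cost + f.cost + 1
  | .neg b => b.cost + 1
  | .conj b c => b.cost + c.cost + 1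

/-- Programs. -/
inductive Prog where
  | skip
  | assign (x : ℕ) (e : Expr)
  | write (a : ℕ) (i e : Expr)
  | seq (p q : Prog)
  | ite (b : Test) (p q : Prog)
  | loop (b : Test) (p : Prog)

/-- `Exec w p s k s'`: on a machine with words of `w` bits, the program `p`, started with memory
`s`, halts after exactly `k` steps with memory `s'`.  Every value stored and every address written
to has to fit into a word; a run that violates this has no final memory.  (As an expression of the
program has constant size, each intermediate value then fits into a constant number of words.) -/
inductive Exec (w : ℕ) : Prog → Store → ℕ → Store → Prop where
  | skip (s : Store) : Exec w .skip s 1 s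
  | assign (s : Store) (x : ℕ) (e : Expr) (he : e.eval s < 2 ^ w) :
      Exec w (.assign x e) s (e.cost + 1) (s.setReg x (e.eval s))
  | write (s : Store) (a : ℕ) (i e : Expr) (hi : i.eval s < 2 ^ w) (he : e.eval s < 2 ^ w) :
      Exec w (.write a i e) s (i.cost + e.cost + 1) (s.setArr a (i.eval s) (e.eval s))
  | seq {p q : Prog} {s s' s'' : Store} {k l : ℕ} (hp : Exec w p s k s')
      (hq : Exec w q s' l s'') : Exec w (.seq p q) s (k + l) s''
  | ite_true {b : Test} {p q : Prog} {s s' : Store} {k : ℕ} (hb : b.holds s)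
      (hp : Exec w p s k s') : Exec w (.ite b p q) s (b.cost + 1 + k) s'
  | ite_false {b : Test} {p q : Prog} {s s' : Store} {k : ℕ} (hb : ¬ b.holds s)
      (hq : Exec w q s k s') : Exec w (.ite b p q) s (b.cost + 1 + k) s'
  | loop_done {b : Test} {p : Prog} {s : Store} (hb : ¬ b.holds s) :
      Exec w (.loop b p) s (b.cost + 1) s
  | loop_step {b : Test} {p : Prog} {s s' s'' : Store} {k l : ℕ} (hb : b.holds s)
      (hp : Exec w p s k s') (hl : Exec w (.loop b p) s' l s'') :
      Exec w (.loop b p) s (b.cost + 1 + k + l) s''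

end WordRAM

/-! ### Input format -/

/-- `adj` is an adjacency-list representation of the graph `G`: for each vertex, its neighbours
in an arbitrary order, each listed once. -/
def IsAdjLists {n : ℕ} (G : SimpleGraph (Fin n)) (adj : Fin n → List (Fin n)) : Prop :=
  ∀ v, (adj v).Nodup ∧ ∀ u, u ∈ adj v ↔ G.Adj v u

/-- The memory holding the input: register `0` holds the number `n` of vertices, array `1` holds
the concatenation of the lists `adj 0, …, adj (n - 1)`, and cell `i ≤ n` of array `0` holds the
position in array `1` at which the list of vertex `i` starts (for `i = n`: the total length).
Everything else is `0`. -/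
def inputStore {n : ℕ} (adj : Fin n → List (Fin n)) : WordRAM.Store where
  reg x := if x = 0 then n else 0
  arr a i :=
    if a = 0 then (if i ≤ n then ((List.ofFn adj).take i).flatten.length else 0)
    else if a = 1 then ((List.ofFn adj).flatten.map Fin.val).getD i 0
    else 0

/-- Array `2` of the memory holds the vertices in the order of the layout `σ`. -/
def HoldsLayout {n : ℕ} (s : WordRAM.Store) (σ : Fin n ≃ Fin n) : Prop :=
  ∀ i : Fin n, s.arr 2 i = (σ i : ℕ)

/-!
A layout that follows a path of a tree lists, for each vertex `x` of the path in turn, `x` itself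
and then, for each neighbour `v` of `x` off the path, layouts of the components hanging off `v`
followed by `v`.  If all these components have width less than `k`, then the layout has width at
most `k`: at each cut, the edges outside of one component pairwise conflict, as they share `x` or
meet in a neighbour of `x` (`HubAt.card_le`, `Seg`, `UpPath.thin_append`).

Conversely, if three connected arms meet in a vertex and each contains a set of width `k` that the
other two arms do not touch, then every layout has a cut with an induced matching of size `k + 1`:
of the three cuts that the sets provide, the middle one separates vertices of the other two arms,
and so is crossed by an edge of their union (`Cert.exists_crossIM`).  Such a certificate for width
`k` has at least `2 ^ k` vertices, so that only the levels `k < K` with `K = log₂ n + 1` matter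
(`Cert.exists_finset`).

In a rooted tree, the two sides are computed together, bottom-up.  Each vertex gets a label for each
level (`Node`, `Node.of`).  It tells whether a path layout of this level ends at the vertex, passes
through it, or turns around below it; in the last case, the subtree around the path is cut off, and
what remains is described by the labels of lower levels.  If the labels of the children conflict at
level `k`, there are three arms, and the width is at least `k + 1` (`IsLabelled.cert_scan`).
Otherwise the lists that the children pass on fit together to path layouts
(`IsLabelled.laid_step`).  At the root this gives a layout of width `k` and a certificate for `k`
(`IsLabelled.optimal`).

The program numbers the vertices by breadth-first search.  Each edge of a tree is a bridge, so a
neighbour that is not the parent has not been found before (`parent_of_adj`), and parents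
have smaller numbers than their children.  Processing a vertex at one level takes a constant number
of steps, since lists are stored as trees of concatenations that are never modified (`Rep`), and a
concatenation takes one new cell.  So the bottom-up pass takes `O(n K)` steps, and needs
`n + 1 + 8 K n` cells at most, with addresses of `O(log n)` bits.  Finally the list at the root is
traversed with a stack (`outputProg_spec`).
-/

namespace LinMim

/-! ### Lists of small cut width -/

/-- The pairs of `M` form an induced matching of the bipartite graph that the relation `r` spans
between the lists `l₁` and `l₂`. -/
def IsIM {V : Type*} (r : V → V → Prop) (l₁ l₂ : List V) (M : Finset (V × V)) : Prop :=
  (∀ e ∈ M, e.1 ∈ l₁ ∧ e.2 ∈ l₂ ∧ r e.1 e.2) ∧ ∀ e ∈ M, ∀ f ∈ M, e ≠ f → ¬ r e.1 f.2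

/-- Every cut of the partial layout `l` has induced matchings of size at most `k` only. -/
def Thin {V : Type*} (r : V → V → Prop) (k : ℕ) (l : List V) : Prop :=
  ∀ l₁ l₂, l = l₁ ++ l₂ → ∀ M, IsIM r l₁ l₂ M → M.card ≤ k

/-- At the cut `(l₁, l₂)`, all edges outside of some block `(H₁, H₂)` of width less than `k` contain
the left vertex `x`, or one right neighbour `v` of `x`. -/
def HubAt {V : Type*} (r : V → V → Prop) (k : ℕ) (x : V) (l₁ l₂ : List V) : Prop :=
  1 ≤ k ∧ ∃ v H₁ H₂, Thin r (k - 1) (H₁ ++ H₂) ∧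
    ∀ a ∈ l₁, ∀ b ∈ l₂, r a b → (a ∈ H₁ ∧ b ∈ H₂) ∨ a = x ∨ (b = v ∧ r x v)

section
variable {V : Type*} {r : V → V → Prop} {k : ℕ} {x : V}

theorem Thin.mono {l : List V} (h : Thin r k l) {k' : ℕ} (hk : k ≤ k') : Thin r k' l :=
  fun l₁ l₂ hl M hM => (h l₁ l₂ hl M hM).trans hk

theorem IsIM.filter {l₁ l₂ : List V} {M : Finset (V × V)} (h : IsIM r l₁ l₂ M)
    (q : V × V → Prop) [DecidablePred q] {H₁ H₂ : List V}
    (hq : ∀ e ∈ M, q e → e.1 ∈ H₁ ∧ e.2 ∈ H₂) : IsIM r H₁ H₂ (M.filter q) := by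
  refine ⟨fun e he => ?_, fun e he f hf => h.2 e (Finset.mem_filter.1 he).1 f (Finset.mem_filter.1 hf).1⟩
  rw [Finset.mem_filter] at he
  exact ⟨(hq e he.1 he.2).1, (hq e he.1 he.2).2, (h.1 e he.1).2.2⟩

theorem IsIM.subset {l₁ l₂ : List V} {M : Finset (V × V)} (h : IsIM r l₁ l₂ M) {H₁ H₂ : List V}
    (hq : ∀ e ∈ M, e.1 ∈ H₁ ∧ e.2 ∈ H₂) : IsIM r H₁ H₂ M :=
  ⟨fun e he => ⟨(hq e he).1, (hq e he).2, (h.1 e he).2.2⟩, h.2⟩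

theorem IsIM.card_le_of_nil {l₁ l₂ : List V} {M : Finset (V × V)} (h : IsIM r l₁ l₂ M)
    (hn : l₁ = [] ∨ l₂ = []) : M.card ≤ k := by
  have : M = ∅ := by
    rw [Finset.eq_empty_iff_forall_notMem]
    rintro e he
    obtain ⟨h1, h2, -⟩ := h.1 e he
    rcases hn with rfl | rfl
    · simp at h1
    · simp at h2
  simp [this]

/-- The edges outside of the block pairwise conflict, so they add at most one to a matching. -/
theorem HubAt.card_le {l₁ l₂ : List V} (h : HubAt r k x l₁ l₂) {M : Finset (V × V)}
    (hM : IsIM r l₁ l₂ M) : M.card ≤ k := by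
  classical
  obtain ⟨hk, v, H₁, H₂, hT, hc⟩ := h
  have h1 : (M.filter fun e => e.1 ∈ H₁ ∧ e.2 ∈ H₂).card ≤ k - 1 :=
    hT _ _ rfl _ (hM.filter _ fun e _ he => he)
  have h2 : (M.filter fun e => ¬ (e.1 ∈ H₁ ∧ e.2 ∈ H₂)).card ≤ 1 := by
    rw [Finset.card_le_one]
    intro e he f hf
    rw [Finset.mem_filter] at he hf
    have key : ∀ e ∈ M, ¬ (e.1 ∈ H₁ ∧ e.2 ∈ H₂) → e.1 = x ∨ (e.2 = v ∧ r x v) := by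
      intro e he hn
      obtain ⟨a, b, c⟩ := hM.1 e he
      exact (hc _ a _ b c).resolve_left hn
    by_contra hne
    have hef := hM.2 e he.1 f hf.1 hne
    have hfe := hM.2 f hf.1 e he.1 (Ne.symm hne)
    have he3 := (hM.1 e he.1).2.2
    have hf3 := (hM.1 f hf.1).2.2
    rcases key e he.1 he.2 with h | ⟨h, h'⟩ <;> rcases key f hf.1 hf.2 with g | ⟨g, g'⟩
    · rw [h, ← g] at hef; exact hef hf3
    · rw [h, g] at hef; exact hef g'
    · rw [g, h] at hfe; exact hfe h'
    · rw [g, ← h] at hef; exact hef he3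
  have := Finset.card_filter_add_card_filter_not (s := M) (fun e => e.1 ∈ H₁ ∧ e.2 ∈ H₂)
  omega

theorem thin_of_hub {l : List V}
    (h : ∀ l₁ l₂, l = l₁ ++ l₂ → l₁ ≠ [] → l₂ ≠ [] → ∃ x, HubAt r k x l₁ l₂) : Thin r k l := by
  intro l₁ l₂ hl M hM
  by_cases hn : l₁ = [] ∨ l₂ = []
  · exact hM.card_le_of_nil hn
  · push Not at hn
    obtain ⟨x, hx⟩ := h l₁ l₂ hl hn.1 hn.2
    exact hx.card_le hM

theorem thin_nil : Thin r k [] := by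
  refine thin_of_hub fun l₁ l₂ hl h => ?_
  simp_all

/-- `HubAt` depends only on the edges across the cut. -/
theorem HubAt.congr {l₁ l₂ m₁ m₂ : List V} (h : HubAt r k x l₁ l₂)
    (hm : ∀ a ∈ m₁, ∀ b ∈ m₂, r a b → a = x ∨ (a ∈ l₁ ∧ b ∈ l₂)) : HubAt r k x m₁ m₂ := by
  obtain ⟨hk, v, H₁, H₂, hT, hc⟩ := h
  refine ⟨hk, v, H₁, H₂, hT, fun a ha b hb hr => ?_⟩
  rcases hm a ha b hb hr with h | h
  · exact Or.inr (Or.inl h)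
  · exact hc a h.1 b h.2 hr

/-- Layouts without edges between them can be concatenated. -/
theorem Thin.append {l l' : List V} (h : Thin r k l) (h' : Thin r k l')
    (hr : ∀ a ∈ l, ∀ b ∈ l', ¬ r a b) : Thin r k (l ++ l') := by
  intro l₁ l₂ hl M hM
  rcases List.append_eq_append_iff.1 hl with ⟨m, rfl, rfl⟩ | ⟨m, rfl, rfl⟩
  · refine h' m l₂ rfl M (hM.subset fun e he => ?_)
    obtain ⟨h1, h2, h3⟩ := hM.1 e he
    refine ⟨(List.mem_append.1 h1).resolve_left fun h4 => ?_, h2⟩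
    exact hr _ h4 _ (List.mem_append_right _ h2) h3
  · refine h l₁ m rfl M (hM.subset fun e he => ?_)
    obtain ⟨h1, h2, h3⟩ := hM.1 e he
    refine ⟨h1, (List.mem_append.1 h2).resolve_right fun h4 => ?_⟩
    exact hr _ (List.mem_append_left _ h1) _ h4 h3

/-- `s` is a segment of a path layout: the path vertex `x`, and then blocks of side vertices. -/
def Seg (r : V → V → Prop) (k : ℕ) (x : V) (s : List V) : Prop :=
  (∃ s', s = x :: s') ∧ ∀ s₁ s₂, s = s₁ ++ s₂ → s₁ ≠ [] → s₂ ≠ [] → HubAt r k x s₁ s₂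

/-- `l` lays out the segments of a path that ends with the path vertex `x`. -/
def UpPath (r : V → V → Prop) (k : ℕ) (x : V) (l : List V) : Prop :=
  x ∈ l ∧ ∀ l₁ l₂, l = l₁ ++ l₂ → l₁ ≠ [] →
    (x ∈ l₁ ∧ (l₂ ≠ [] → HubAt r k x l₁ l₂)) ∨ (x ∈ l₂ ∧ ∃ z, HubAt r k z l₁ l₂)

/-- `l` lays out the segments of a path that starts with the path vertex `x`. -/
def DownPath (r : V → V → Prop) (k : ℕ) (x : V) (l : List V) : Prop :=
  (∃ l', l = x :: l') ∧ ∀ l₁ l₂, l = l₁ ++ l₂ → l₁ ≠ [] → l₂ ≠ [] → ∃ z, HubAt r k z l₁ l₂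

theorem Seg.mem_left {s s₁ s₂ : List V} (h : Seg r k x s) (hs : s = s₁ ++ s₂) (h1 : s₁ ≠ []) :
    x ∈ s₁ := by
  obtain ⟨⟨s', rfl⟩, -⟩ := h
  cases s₁ with
  | nil => exact absurd rfl h1
  | cons a t => simp at hs; simp [hs.1]

theorem DownPath.mem_left {s s₁ s₂ : List V} (h : DownPath r k x s) (hs : s = s₁ ++ s₂)
    (h1 : s₁ ≠ []) : x ∈ s₁ := by
  obtain ⟨⟨s', rfl⟩, -⟩ := h
  cases s₁ with
  | nil => exact absurd rfl h1
  | cons a t => simp at hs; simp [hs.1]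

theorem Seg.upPath {s : List V} (h : Seg r k x s) : UpPath r k x s := by
  refine ⟨by obtain ⟨⟨s', rfl⟩, -⟩ := h; simp, fun l₁ l₂ hl h1 => Or.inl ⟨h.mem_left hl h1, ?_⟩⟩
  exact h.2 l₁ l₂ hl h1

theorem Seg.downPath {s : List V} (h : Seg r k x s) : DownPath r k x s :=
  ⟨h.1, fun l₁ l₂ hl h1 h2 => ⟨x, h.2 l₁ l₂ hl h1 h2⟩⟩

theorem seg_singleton : Seg r k x [x] := by
  refine ⟨⟨[], rfl⟩, fun s₁ s₂ hs h1 h2 => ?_⟩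
  have := congrArg List.length hs
  have a := List.length_pos_iff.2 h1
  have b := List.length_pos_iff.2 h2
  simp at this
  omega

/-- A block consisting of a neighbour `v` of the path vertex, preceded by a layout of components
that hang off `v`, can be added to a segment. -/
theorem Seg.append_block {s H : List V} {v : V} (h : Seg r k x s) (hk : 1 ≤ k)
    (hH : Thin r (k - 1) H) (hxv : r x v) (h1 : ∀ a ∈ s, ∀ b ∈ H, ¬ r a b)
    (h2 : ∀ a ∈ s, r a v → a = x) : Seg r k x (s ++ (H ++ [v])) := by
  obtain ⟨⟨s', rfl⟩, hs⟩ := id h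
  refine ⟨⟨s' ++ (H ++ [v]), rfl⟩, fun s₁ s₂ hl hn1 hn2 => ?_⟩
  rcases List.append_eq_append_iff.1 hl with ⟨m, rfl, hm⟩ | ⟨m, hm, rfl⟩
  · -- the cut lies inside of the new block
    rcases List.append_eq_append_iff.1 hm with ⟨m', rfl, hm'⟩ | ⟨m', rfl, rfl⟩
    · have : m' = [] := by
        rcases m' with _ | ⟨a, m'⟩
        · rfl
        · simp at hm'; exact absurd hm'.2.2 hn2
      subst this
      simp at hm'
      subst hm'
      refine ⟨hk, v, [], [], thin_nil, fun a ha b hb hr => ?_⟩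
      simp only [List.mem_singleton] at hb
      exact Or.inr (Or.inr ⟨hb, hxv⟩)
    · refine ⟨hk, v, m, m', hH, fun a ha b hb hr => ?_⟩
      rcases List.mem_append.1 hb with hb | hb
      · rcases List.mem_append.1 ha with ha | ha
        · exact absurd hr (h1 a ha b (List.mem_append_right _ hb))
        · exact Or.inl ⟨ha, hb⟩
      · simp only [List.mem_singleton] at hb
        exact Or.inr (Or.inr ⟨hb, hxv⟩)
  · have hb0 : ∀ a ∈ s₁, ∀ b ∈ H ++ [v], r a b → a = x := by
      intro a ha b hb hr
      have ha' : a ∈ x :: s' := by rw [hm]; exact List.mem_append_left _ ha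
      rcases List.mem_append.1 hb with hb | hb
      · exact absurd hr (h1 a ha' b hb)
      · simp only [List.mem_singleton] at hb
        subst hb
        exact h2 a ha' hr
    by_cases hm0 : m = []
    · subst hm0
      refine ⟨hk, v, [], [], thin_nil, fun a ha b hb hr => Or.inr (Or.inl ?_)⟩
      exact hb0 a ha b (by simpa using hb) hr
    · refine (hs s₁ m hm hn1 hm0).congr fun a ha b hb hr => ?_
      rcases List.mem_append.1 hb with hb | hb
      · exact Or.inr ⟨ha, hb⟩
      · exact Or.inl (hb0 a ha b hb hr)

theorem Seg.append_downPath {s l : List V} {y : V} (hs : Seg r k x s) (hl : DownPath r k y l)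
    (hk : 1 ≤ k) (hd : l.Nodup) (hr : ∀ a ∈ s, ∀ b ∈ l, r a b → a = x ∧ b = y) :
    DownPath r k x (s ++ l) := by
  obtain ⟨⟨s', rfl⟩, hs'⟩ := id hs
  refine ⟨⟨s' ++ l, rfl⟩, fun l₁ l₂ h h1 h2 => ?_⟩
  rcases List.append_eq_append_iff.1 h with ⟨m, rfl, rfl⟩ | ⟨m, hm, rfl⟩
  · by_cases hm : m = []
    · subst hm
      refine ⟨x, hk, x, [], [], thin_nil, fun a ha b hb hab => Or.inr (Or.inl ?_)⟩
      exact (hr a (by simpa using ha) b (by simpa using hb) hab).1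
    · obtain ⟨z, hz⟩ := hl.2 m l₂ rfl hm h2
      refine ⟨z, hz.congr fun a ha b hb hab => Or.inr ⟨?_, hb⟩⟩
      refine (List.mem_append.1 ha).resolve_left fun ha' => ?_
      have hby := (hr a ha' b (List.mem_append_right _ hb) hab).2
      subst hby
      exact List.disjoint_of_nodup_append hd (hl.mem_left rfl hm) hb
  · by_cases hm0 : m = []
    · subst hm0
      refine ⟨x, hk, x, [], [], thin_nil, fun a ha b hb hab => Or.inr (Or.inl ?_)⟩
      exact (hr a (by rw [hm]; simpa using ha) b (by simpa using hb) hab).1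
    · refine ⟨x, (hs' l₁ m hm h1 hm0).congr fun a ha b hb hab => ?_⟩
      rcases List.mem_append.1 hb with hb | hb
      · exact Or.inr ⟨ha, hb⟩
      · exact Or.inl (hr a (by rw [hm]; exact List.mem_append_left _ ha) b hb hab).1

theorem UpPath.append_seg {s l : List V} {y : V} (hl : UpPath r k y l) (hs : Seg r k x s)
    (hk : 1 ≤ k) (hd : s.Nodup) (hd' : l.Nodup) (hr : ∀ a ∈ l, ∀ b ∈ s, r a b → a = y ∧ b = x) :
    UpPath r k x (l ++ s) := by
  obtain ⟨⟨s', rfl⟩, hs'⟩ := id hs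
  refine ⟨by simp, fun l₁ l₂ h h1 => ?_⟩
  rcases List.append_eq_append_iff.1 h with ⟨m, rfl, hm⟩ | ⟨m, rfl, rfl⟩
  · by_cases hm0 : m = []
    · subst hm0
      refine Or.inr ⟨by simp at hm; simp [← hm], y, hk, y, [], [], thin_nil, fun a ha b hb hab => Or.inr (Or.inl ?_)⟩
      exact (hr a (by simpa using ha) b (by simp at hm; simpa [hm] using hb) hab).1
    · have hx := hs.mem_left hm hm0
      refine Or.inl ⟨by simp [hx], fun h2 => (hs' m l₂ hm hm0 h2).congr fun a ha b hb hab => ?_⟩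
      refine Or.inr ⟨(List.mem_append.1 ha).resolve_left fun ha' => ?_, hb⟩
      have hb' := (hr a ha' b (by rw [hm]; exact List.mem_append_right _ hb) hab).2
      subst hb'
      rw [hm] at hd
      exact List.disjoint_of_nodup_append hd hx hb
  · refine Or.inr ⟨by simp, ?_⟩
    rcases hl.2 l₁ m rfl h1 with ⟨hy, hz⟩ | ⟨hy, z, hz⟩
    · by_cases hm0 : m = []
      · subst hm0
        refine ⟨y, hk, y, [], [], thin_nil, fun a ha b hb hab => Or.inr (Or.inl ?_)⟩
        exact (hr a (by simpa using ha) b (by simpa using hb) hab).1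
      · refine ⟨y, (hz hm0).congr fun a ha b hb hab => ?_⟩
        rcases List.mem_append.1 hb with hb | hb
        · exact Or.inr ⟨ha, hb⟩
        · exact Or.inl (hr a (List.mem_append_left _ ha) b hb hab).1
    · refine ⟨z, hz.congr fun a ha b hb hab => ?_⟩
      rcases List.mem_append.1 hb with hb | hb
      · exact Or.inr ⟨ha, hb⟩
      · have := (hr a (List.mem_append_left _ ha) b hb hab).1
        subst this
        exact absurd hy (List.disjoint_of_nodup_append hd' ha)

/-- Two halves of a path layout fit together. -/
theorem UpPath.thin_append {l l' : List V} {y : V} (hl : UpPath r k x l) (hl' : DownPath r k y l')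
    (hk : 1 ≤ k) (hd : l.Nodup) (hd' : l'.Nodup)
    (hr : ∀ a ∈ l, ∀ b ∈ l', r a b → a = x ∧ b = y) : Thin r k (l ++ l') := by
  refine thin_of_hub fun l₁ l₂ h h1 h2 => ?_
  rcases List.append_eq_append_iff.1 h with ⟨m, rfl, rfl⟩ | ⟨m, rfl, rfl⟩
  · by_cases hm : m = []
    · subst hm
      refine ⟨x, hk, x, [], [], thin_nil, fun a ha b hb hab => Or.inr (Or.inl ?_)⟩
      exact (hr a (by simpa using ha) b (by simpa using hb) hab).1
    · obtain ⟨z, hz⟩ := hl'.2 m l₂ rfl hm h2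
      refine ⟨z, hz.congr fun a ha b hb hab => Or.inr ⟨?_, hb⟩⟩
      refine (List.mem_append.1 ha).resolve_left fun ha' => ?_
      have hby := (hr a ha' b (List.mem_append_right _ hb) hab).2
      subst hby
      exact List.disjoint_of_nodup_append hd' (hl'.mem_left rfl hm) hb
  · rcases hl.2 l₁ m rfl h1 with ⟨hy, hz⟩ | ⟨hy, z, hz⟩
    · by_cases hm0 : m = []
      · subst hm0
        refine ⟨x, hk, x, [], [], thin_nil, fun a ha b hb hab => Or.inr (Or.inl ?_)⟩
        exact (hr a (by simpa using ha) b (by simpa using hb) hab).1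
      · refine ⟨x, (hz hm0).congr fun a ha b hb hab => ?_⟩
        rcases List.mem_append.1 hb with hb | hb
        · exact Or.inr ⟨ha, hb⟩
        · exact Or.inl (hr a (List.mem_append_left _ ha) b hb hab).1
    · refine ⟨z, hz.congr fun a ha b hb hab => ?_⟩
      rcases List.mem_append.1 hb with hb | hb
      · exact Or.inr ⟨ha, hb⟩
      · have := (hr a (List.mem_append_left _ ha) b hb hab).1
        subst this
        exact absurd hy (List.disjoint_of_nodup_append hd ha)

theorem DownPath.thin {l : List V} (hl : DownPath r k x l) : Thin r k l :=
  thin_of_hub hl.2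

end

/-! ### Lower bound certificates -/

/-- Every partition of `A` into two nonempty parts is crossed by an edge: `A` is connected. -/
def Linked (r : ℕ → ℕ → Prop) (A : Set ℕ) : Prop :=
  ∀ f : ℕ → Prop, (∃ a ∈ A, f a) → (∃ b ∈ A, ¬ f b) → ∃ c ∈ A, ∃ d ∈ A, r c d ∧ f c ∧ ¬ f d

/-- A certificate that every linear layout has a cut with an induced matching of size `k` within
`S`: three connected arms `A i` meet at a vertex `x`, and each contains a set `B i` with a
certificate for `k - 1` that is not touched by the other two arms. -/
def Cert (r : ℕ → ℕ → Prop) : ℕ → Set ℕ → Prop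
  | 0, S => S.Nonempty
  | 1, S => ∃ a ∈ S, ∃ b ∈ S, r a b
  | k + 2, S => ∃ (x : ℕ) (A B : Fin 3 → Set ℕ),
      (∀ i, Cert r (k + 1) (B i) ∧ B i ⊆ A i ∧ A i ⊆ S ∧ x ∈ A i ∧ Linked r (A i)) ∧
      ∀ i j, i ≠ j → ∀ a ∈ A i, ∀ b ∈ B j, a ≠ b ∧ ¬ r a b

theorem Cert.mono {r : ℕ → ℕ → Prop} {k : ℕ} {S T : Set ℕ} (h : Cert r k S) (hST : S ⊆ T) :
    Cert r k T := by
  match k, h with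
  | 0, h => exact Set.Nonempty.mono hST h
  | 1, h =>
    obtain ⟨a, ha, b, hb, hr⟩ := h
    exact ⟨a, hST ha, b, hST hb, hr⟩
  | k + 2, h =>
    obtain ⟨x, A, B, h1, h2⟩ := h
    exact ⟨x, A, B, fun i => ⟨(h1 i).1, (h1 i).2.1, (h1 i).2.2.1.trans hST, (h1 i).2.2.2⟩, h2⟩

theorem Cert.exists_finset {r : ℕ → ℕ → Prop} (hirr : ∀ a, ¬ r a a) {k : ℕ} {S : Set ℕ}
    (h : Cert r k S) : ∃ F : Finset ℕ, ↑F ⊆ S ∧ 2 ^ k ≤ F.card := by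
  induction k generalizing S with
  | zero =>
    obtain ⟨a, ha⟩ := h
    exact ⟨{a}, by simpa using ha, by simp⟩
  | succ k ih =>
    cases k with
    | zero =>
      obtain ⟨a, ha, b, hb, hr⟩ := h
      refine ⟨{a, b}, ?_, ?_⟩
      · intro z hz
        simp only [Finset.coe_insert, Finset.coe_singleton, Set.mem_insert_iff,
          Set.mem_singleton_iff] at hz
        rcases hz with rfl | rfl <;> assumption
      · rw [Finset.card_pair]
        · norm_num
        · rintro rfl; exact hirr _ hr
    | succ k =>
      obtain ⟨x, A, B, h1, h2⟩ := h
      obtain ⟨F, hF, hFc⟩ := ih (h1 0).1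
      obtain ⟨F', hF', hFc'⟩ := ih (h1 1).1
      refine ⟨F ∪ F', ?_, ?_⟩
      · intro z hz
        rcases Finset.mem_union.1 (Finset.mem_coe.1 hz) with hz | hz
        · exact (h1 0).2.2.1 ((h1 0).2.1 (hF hz))
        · exact (h1 1).2.2.1 ((h1 1).2.1 (hF' hz))
      · rw [Finset.card_union_of_disjoint, pow_succ]
        · omega
        · rw [Finset.disjoint_left]
          intro z hz hz'
          exact (h2 0 1 (by decide) z ((h1 0).2.1 (hF hz)) z (hF' hz')).1 rfl

/-- `M` is an induced matching within `S` across the cut at position `i`. -/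
def CrossIM (r : ℕ → ℕ → Prop) (pos : ℕ → ℕ) (i : ℕ) (S : Set ℕ) (M : Finset (ℕ × ℕ)) : Prop :=
  (∀ e ∈ M, e.1 ∈ S ∧ e.2 ∈ S ∧ pos e.1 < i ∧ i ≤ pos e.2 ∧ r e.1 e.2) ∧
    ∀ e ∈ M, ∀ f ∈ M, e ≠ f → ¬ r e.1 f.2

theorem exists_middle (c : Fin 3 → ℕ) :
    ∃ i j k : Fin 3, i ≠ j ∧ j ≠ k ∧ i ≠ k ∧ c i ≤ c j ∧ c j ≤ c k := by
  rcases le_total (c 0) (c 1) with h1 | h1 <;> rcases le_total (c 1) (c 2) with h2 | h2 <;>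
    rcases le_total (c 0) (c 2) with h3 | h3
  · exact ⟨0, 1, 2, by decide, by decide, by decide, h1, h2⟩
  · exact ⟨0, 1, 2, by decide, by decide, by decide, h1, h2⟩
  · exact ⟨0, 2, 1, by decide, by decide, by decide, h3, h2⟩
  · exact ⟨2, 0, 1, by decide, by decide, by decide, h3, h1⟩
  · exact ⟨1, 0, 2, by decide, by decide, by decide, h1, h3⟩
  · exact ⟨1, 2, 0, by decide, by decide, by decide, h2, h3⟩
  · exact ⟨2, 1, 0, by decide, by decide, by decide, h2, h1⟩
  · exact ⟨2, 1, 0, by decide, by decide, by decide, h2, h1⟩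

/-- Of the three cuts that the arms provide, consider the middle one: the other two arms are joined
through `x`, so that the cut separates two vertices of them, and one of their edges crosses it. -/
theorem Cert.exists_crossIM {r : ℕ → ℕ → Prop} (hsymm : ∀ a b, r a b → r b a)
    (hirr : ∀ a, ¬ r a a) {k : ℕ} {S : Set ℕ} (h : Cert r k S) (pos : ℕ → ℕ)
    (hpos : Set.InjOn pos S) : ∃ i M, CrossIM r pos i S M ∧ M.card = k := by
  induction k generalizing S with
  | zero => exact ⟨0, ∅, ⟨by simp, by simp⟩, rfl⟩
  | succ k ih =>
    cases k with
    | zero =>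
      obtain ⟨a, ha, b, hb, hr⟩ := h
      have key : ∀ a ∈ S, ∀ b ∈ S, r a b → pos a < pos b →
          ∃ i M, CrossIM r pos i S M ∧ M.card = 1 := by
        intro a ha b hb hr hlt
        refine ⟨pos b, {(a, b)}, ⟨?_, ?_⟩, by simp⟩
        · intro e he
          rw [Finset.mem_singleton] at he
          subst he
          exact ⟨ha, hb, hlt, le_rfl, hr⟩
        · intro e he f hf hne
          rw [Finset.mem_singleton] at he hf
          exact absurd (he.trans hf.symm) hne
      rcases lt_trichotomy (pos a) (pos b) with hlt | heq | hlt
      · exact key a ha b hb hr hlt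
      · have := hpos ha hb heq
        subst this
        exact absurd hr (hirr _)
      · exact key b hb a ha (hsymm _ _ hr) hlt
    | succ k =>
      obtain ⟨x, A, B, h1, h2⟩ := h
      have hBS : ∀ i, B i ⊆ S := fun i => (h1 i).2.1.trans (h1 i).2.2.1
      choose c M hM hc using fun i => ih (h1 i).1 (hpos.mono (hBS i))
      obtain ⟨i, j, l, hij, hjl, hil, hcij, hcjl⟩ := exists_middle c
      have hne : ∀ i, (M i).Nonempty := fun i => by
        rw [← Finset.card_pos, hc]; exact Nat.succ_pos _
      obtain ⟨e, he⟩ := hne i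
      obtain ⟨f, hf⟩ := hne l
      have heL := (hM i).1 e he
      have hfR := (hM l).1 f hf
      have hcross : ∃ m, m ≠ j ∧ ∃ a ∈ A m, ∃ b ∈ A m, r a b ∧ pos a < c j ∧ ¬ pos b < c j := by
        by_cases hx : pos x < c j
        · exact ⟨l, hjl.symm, (h1 l).2.2.2.2 (fun z => pos z < c j) ⟨x, (h1 l).2.2.2.1, hx⟩
            ⟨f.2, (h1 l).2.1 hfR.2.1, not_lt.2 (hcjl.trans hfR.2.2.2.1)⟩⟩
        · exact ⟨i, hij, (h1 i).2.2.2.2 (fun z => pos z < c j)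
            ⟨e.1, (h1 i).2.1 heL.1, heL.2.2.1.trans_le hcij⟩ ⟨x, (h1 i).2.2.2.1, hx⟩⟩
      obtain ⟨m, hmj, a, ha, b, hb, hab, hal, hbr⟩ := hcross
      have hfar : ∀ e ∈ M j, ¬ r a e.2 ∧ ¬ r e.1 b ∧ e.1 ≠ a := by
        intro e he
        obtain ⟨he1, he2, -⟩ := (hM j).1 e he
        exact ⟨(h2 m j hmj a ha _ he2).2, fun h => (h2 m j hmj b hb _ he1).2 (hsymm _ _ h),
          fun h => (h2 m j hmj a ha _ he1).1 h.symm⟩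
      refine ⟨c j, insert (a, b) (M j), ⟨?_, ?_⟩, ?_⟩
      · intro e he
        rcases Finset.mem_insert.1 he with rfl | he
        · exact ⟨(h1 m).2.2.1 ha, (h1 m).2.2.1 hb, hal, not_lt.1 hbr, hab⟩
        · obtain ⟨he1, he2, he3⟩ := (hM j).1 e he
          exact ⟨hBS j he1, hBS j he2, he3⟩
      · intro e he f hf hne
        rcases Finset.mem_insert.1 he with rfl | he <;> rcases Finset.mem_insert.1 hf with rfl | hf
        · exact absurd rfl hne
        · exact (hfar f hf).1
        · exact (hfar e he).2.1
        · exact (hM j).2 e he f hf hne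
      · rw [Finset.card_insert_of_notMem, hc]
        intro h
        exact (hfar _ h).2.2 rfl

/-! ### Trees given by parents -/

/-- The adjacency relation of the tree in which `p a` is the parent of the vertex `a > 0`. -/
def Adj (p : ℕ → ℕ) (a b : ℕ) : Prop := (0 < a ∧ p a = b) ∨ (0 < b ∧ p b = a)

/-- `z` is a descendant of `x` (or `x` itself). -/
inductive Desc (p : ℕ → ℕ) (x : ℕ) : ℕ → Prop
  | refl : Desc p x x
  | step {z : ℕ} : 0 < z → Desc p x (p z) → Desc p x z

/-- `z < n` is a descendant of `x` that remains when the subtrees of the vertices with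
property `m` are cut off. -/
inductive Vis (n : ℕ) (p : ℕ → ℕ) (m : ℕ → Prop) (x : ℕ) : ℕ → Prop
  | refl : ¬ m x → Vis n p m x x
  | step {z : ℕ} : 0 < z → z < n → ¬ m z → Vis n p m x (p z) → Vis n p m x z

/-- Like `Vis`, but the vertex `x` itself is never cut off. -/
def VisB (n : ℕ) (p : ℕ → ℕ) (m : ℕ → Prop) (x z : ℕ) : Prop :=
  z = x ∨ ∃ u, (0 < u ∧ u < n ∧ p u = x) ∧ Vis n p m u z

section
variable {n : ℕ} {p : ℕ → ℕ} {m m' : ℕ → Prop} {x y z u v w a b : ℕ}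

theorem Adj.symm (h : Adj p a b) : Adj p b a := Or.symm h

theorem adj_irrefl (hp : ∀ u, 0 < u → p u < u) (a : ℕ) : ¬ Adj p a a := by
  rintro (⟨h, h'⟩ | ⟨h, h'⟩) <;> have := hp a h <;> omega

theorem Desc.le (hp : ∀ u, 0 < u → p u < u) (h : Desc p x z) : x ≤ z := by
  induction h with
  | refl => exact le_rfl
  | step h0 _ ih => exact ih.trans (hp _ h0).le

theorem Desc.trans (h : Desc p x y) (h' : Desc p y z) : Desc p x z := by
  induction h' with
  | refl => exact h
  | step h0 _ ih => exact .step h0 ih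

theorem Desc.of_parent (h0 : 0 < u) (h : Desc p u z) : Desc p (p u) z :=
  (Desc.step h0 .refl).trans h

theorem Desc.eq_or (h : Desc p x z) : z = x ∨ (0 < z ∧ Desc p x (p z)) := by
  cases h with
  | refl => exact Or.inl rfl
  | step h0 h => exact Or.inr ⟨h0, h⟩

theorem Desc.total (h : Desc p x z) (h' : Desc p y z) : Desc p x y ∨ Desc p y x := by
  induction h with
  | refl => exact Or.inr h'
  | step h0 h ih =>
    rcases h'.eq_or with h1 | h1
    · subst h1; exact Or.inl (.step h0 h)
    · exact ih h1.2

theorem Desc.sibling_eq (hp : ∀ u, 0 < u → p u < u) (hu : 0 < u) (hv : 0 < v) (huv : p u = p v)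
    (h : Desc p u z) (h' : Desc p v z) : u = v := by
  have key : ∀ u v, 0 < u → 0 < v → p u = p v → Desc p u v → u = v := by
    intro u v hu hv huv h
    rcases h.eq_or with h | ⟨-, h⟩
    · exact h.symm
    · have := h.le hp
      have := hp u hu
      omega
  rcases h.total h' with h | h
  · exact key u v hu hv huv h
  · exact (key v u hv hu huv.symm h).symm

/-- The only edge that leaves a subtree is the one from its root to the parent of its root. -/
theorem Adj.leave (h : Adj p a b) (ha : Desc p x a) (hb : ¬ Desc p x b) : a = x ∧ 0 < x ∧ p x = b := by
  rcases h with ⟨h0, rfl⟩ | ⟨h0, rfl⟩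
  · rcases ha.eq_or with rfl | h
    · exact ⟨rfl, h0, rfl⟩
    · exact absurd h.2 hb
  · exact absurd (.step h0 ha) hb

theorem Vis.desc (h : Vis n p m x z) : Desc p x z := by
  induction h with
  | refl => exact .refl
  | step h0 _ _ _ ih => exact .step h0 ih

theorem Vis.lt (h : Vis n p m x z) (hx : x < n) : z < n := by
  cases h with
  | refl => exact hx
  | step _ h _ _ => exact h

theorem Vis.not_left (h : Vis n p m x z) : ¬ m x := by
  induction h with
  | refl h => exact h
  | step _ _ _ _ ih => exact ih

theorem Vis.not_right (h : Vis n p m x z) : ¬ m z := by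
  cases h with
  | refl h => exact h
  | step _ _ h _ => exact h

theorem Vis.mono (h : Vis n p m x z) (hm : ∀ w, m' w → m w) : Vis n p m' x z := by
  induction h with
  | refl h => exact .refl fun h' => h (hm _ h')
  | step h0 h1 h2 _ ih => exact .step h0 h1 (fun h' => h2 (hm _ h')) ih

theorem Vis.trans (h : Vis n p m x y) (h' : Vis n p m y z) : Vis n p m x z := by
  induction h' with
  | refl _ => exact h
  | step h0 h1 h2 _ ih => exact .step h0 h1 h2 ih

theorem Vis.split (hp : ∀ u, 0 < u → p u < u) (h : Vis n p m x z) (hw : Desc p x w)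
    (hz : Desc p w z) : Vis n p m x w ∧ Vis n p m w z := by
  induction h with
  | refl h =>
    have : w = x := le_antisymm (hz.le hp) (hw.le hp)
    subst this
    exact ⟨.refl h, .refl h⟩
  | step h0 h1 h2 h3 ih =>
    rcases hz.eq_or with h | h
    · subst h; exact ⟨.step h0 h1 h2 h3, .refl h2⟩
    · exact ⟨(ih h.2).1, .step h0 h1 h2 (ih h.2).2⟩

theorem vis_iff : Vis n p m x z ↔ ¬ m x ∧ VisB n p m x z := by
  constructor
  · intro h
    refine ⟨h.not_left, ?_⟩
    induction h with
    | refl _ => exact Or.inl rfl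
    | @step z h0 h1 h2 h3 ih =>
      rcases ih with h | ⟨u, hu, h⟩
      · exact Or.inr ⟨z, ⟨h0, h1, h⟩, .refl h2⟩
      · exact Or.inr ⟨u, hu, .step h0 h1 h2 h⟩
  · rintro ⟨hx, rfl | ⟨u, ⟨h0, h1, rfl⟩, h⟩⟩
    · exact .refl hx
    · exact (Vis.step h0 h1 h.not_left (.refl hx)).trans h

theorem VisB.desc (h : VisB n p m x z) : Desc p x z := by
  rcases h with rfl | ⟨u, ⟨h0, h1, rfl⟩, h⟩
  · exact .refl
  · exact h.desc.of_parent h0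

theorem VisB.mono (h : VisB n p m x z) (hm : ∀ w, m' w → m w) : VisB n p m' x z := by
  rcases h with rfl | ⟨u, hu, h⟩
  · exact Or.inl rfl
  · exact Or.inr ⟨u, hu, h.mono hm⟩

/-- A set of descendants of `x` that is closed under taking parents up to `x` is connected. -/
theorem linked_of_parent_mem (hp : ∀ u, 0 < u → p u < u) {A : Set ℕ}
    (hA : ∀ z ∈ A, z ≠ x → 0 < z ∧ p z ∈ A) : Linked (Adj p) A := by
  intro f hf hf'
  by_contra hcon
  push Not at hcon
  have key : ∀ z ∈ A, (f z ↔ f x) := by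
    intro z
    induction z using Nat.strong_induction_on with
    | _ z ih =>
      intro hz
      by_cases hzx : z = x
      · rw [hzx]
      obtain ⟨h0, hpz⟩ := hA z hz hzx
      rw [← ih _ (hp z h0) hpz]
      exact ⟨fun h => hcon z hz _ hpz (Or.inl ⟨h0, rfl⟩) h,
        fun h => hcon _ hpz z hz (Or.inr ⟨h0, rfl⟩) h⟩
  obtain ⟨a, ha, hfa⟩ := hf
  obtain ⟨b, hb, hfb⟩ := hf'
  exact hfb ((key b hb).2 ((key a ha).1 hfa))

end

/-! ### Labels and partial layouts -/

/-- The state of a level of a vertex after one more child with label `t` at this level.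
States: `0` no child has a label, `1` all labels are `1`, `2` (`3`) there are one (two) labels `2`
and else only labels `1`, `4` (`5`) there is just one label, and it is `4` (`5`), `6` conflict. -/
def join (s t : ℕ) : ℕ :=
  if t = 0 then s else if s = 0 then t else if t = 1 ∧ s ≤ 3 then s
  else if t = 2 ∧ s ≤ 2 then s + 1 else 6

/-- What is known of the subtree of a vertex `x` once it has been processed.  The label `lab k` at
level `k` is
`0` if level `k` is void,
`1` if `k = base` is the width, but the children of `x` have smaller width,
`2` if `k = base` is the width also of a child, and there is a layout of width `k` that follows a
path running downwards from `x`,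
`4` if `k = base` is the width, and the path has to pass through two children of `x`,
`5` if the topmost vertex of the path is a child of a vertex `w` of the subtree.  The subtree of `w`
is then cut off, and the lower levels describe what remains; nothing remains if `w = x`, and then
`k = base`.
In each case, "the width" is that of the part that has not been cut off at a higher level.  The
label at the level `base` is also called `kind`, and the levels below `base` are void.
The lists `fst k` and `snd k` are the parts of the layout for level `k` before and after the place
for the layouts of lower levels, `cl k` is the layout for all levels below `k`, and `side k` is the
layout for `x` as a side vertex of a path of level `k`. -/
structure Node where
  base : ℕ
  kind : ℕ
  lab : ℕ → ℕ
  fst : ℕ → List ℕ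
  snd : ℕ → List ℕ
  cl : ℕ → List ℕ
  side : ℕ → List ℕ

/-- What the processed children of a vertex pass on to it, for each level: the state `st`, the
concatenated layouts `kids` of the children for all lower levels, the concatenated layouts `sides`
of the children as side vertices, except for those through which the path continues, and the lists
`fst` of the first and `snd` of the last child with a label of at least `2`. -/
structure Acc where
  st : ℕ → ℕ
  kids : ℕ → List ℕ
  sides : ℕ → List ℕ
  fst : ℕ → List ℕ
  snd : ℕ → List ℕ

/-- The values before any child has been processed. -/
def Acc.empty : Acc := ⟨fun _ => 0, fun _ => [], fun _ => [], fun _ => [], fun _ => []⟩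

/-- The values after one more child `d`. -/
def Acc.push (a : Acc) (d : Node) : Acc where
  st k := join (a.st k) (d.lab k)
  kids k := a.kids k ++ d.cl k
  sides k := if d.lab k = 2 then a.sides k else a.sides k ++ d.side k
  fst k := if 2 ≤ d.lab k ∧ a.fst k = [] then d.fst k else a.fst k
  snd k := if 2 ≤ d.lab k then d.snd k else a.snd k

/-- The base and its label, after inspection of the levels below `k`.  A conflict at level `k` raises
the base to `k + 1`.  So does label `5` of a child at level `k` if the rest of the subtree needs
level `k`, too. -/
def scan (st : ℕ → ℕ) : ℕ → ℕ × ℕ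
  | 0 => (0, 1)
  | k + 1 =>
    if st k = 0 then scan st k
    else if k = 0 ∨ st k = 6 ∨ (st k = 5 ∧ (scan st k).1 = k) then (k + 1, 1)
    else if st k = 5 then scan st k
    else (k, if st k = 2 then 2 else st k + 1)

/-- The label at level `k`, given the base, its label, and the states. -/
def labOf (base kind : ℕ) (st : ℕ → ℕ) (k : ℕ) : ℕ :=
  if k < base then 0 else if k = base then kind else st k

/-- The list `Node.fst` at level `k`.  If `x` is the parent of the topmost vertex of the path, then all
that hangs off `x` comes next to the place for the layouts of lower levels. -/
def fstOf (base kind x : ℕ) (a : Acc) (k : ℕ) : List ℕ :=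
  if k < base then [] else if k = base then
    (if kind = 5 then a.fst k ++ a.kids k else a.fst k ++ (x :: a.sides k))
  else a.fst k

/-- The list `Node.snd` at level `k`.  The segment of `x` is already in the first list if the path
passes through two children. -/
def sndOf (base kind x : ℕ) (a : Acc) (k : ℕ) : List ℕ :=
  if k < base then [] else if k = base then
    (if kind = 5 then x :: a.snd k else if kind = 4 then a.snd k else (x :: a.sides k) ++ a.snd k)
  else a.snd k

/-- The layout for all levels below the given one, in which the layout for lower levels is put
between the lists of each level. -/
def clOf (lab : ℕ → ℕ) (fst snd : ℕ → List ℕ) : ℕ → List ℕ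
  | 0 => []
  | k + 1 => if lab k = 1 ∨ lab k = 2 then snd k else fst k ++ clOf lab fst snd k ++ snd k

/-- The list `Node.side` at level `k`, which is empty if `x` has been cut off at a higher level. -/
def sideOf (base kind x : ℕ) (a : Acc) (k : ℕ) : List ℕ :=
  if kind = 5 ∧ k < base then [] else a.kids (k + 1) ++ [x]

/-- Processing the vertex `x`, for which the children have passed on `a`, with `K` levels. -/
def Node.of (x K : ℕ) (a : Acc) : Node where
  base := (scan a.st K).1
  kind := (scan a.st K).2
  lab := labOf (scan a.st K).1 (scan a.st K).2 a.st
  fst := fstOf (scan a.st K).1 (scan a.st K).2 x a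
  snd := sndOf (scan a.st K).1 (scan a.st K).2 x a
  cl := clOf (labOf (scan a.st K).1 (scan a.st K).2 a.st)
    (fstOf (scan a.st K).1 (scan a.st K).2 x a) (sndOf (scan a.st K).1 (scan a.st K).2 x a)
  side := sideOf (scan a.st K).1 (scan a.st K).2 x a

/-- Collecting what the children in the list `c` pass on. -/
def collect (N : ℕ → Node) (c : List ℕ) : Acc := c.foldl (fun a u => a.push (N u)) .empty

theorem collect_append (N : ℕ → Node) (c : List ℕ) (u : ℕ) :
    collect N (c ++ [u]) = (collect N c).push (N u) := by simp [collect]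

theorem collect_kids (N : ℕ → Node) (c : List ℕ) (k : ℕ) :
    (collect N c).kids k = c.flatMap fun u => (N u).cl k := by
  induction c using List.reverseRecOn with
  | nil => rfl
  | append_singleton c u ih => rw [collect_append]; simp [Acc.push, ih]

theorem collect_sides (N : ℕ → Node) (c : List ℕ) (k : ℕ) :
    (collect N c).sides k = c.flatMap fun u => if (N u).lab k = 2 then [] else (N u).side k := by
  induction c using List.reverseRecOn with
  | nil => rfl
  | append_singleton c u ih =>
    rw [collect_append]
    simp only [Acc.push, ih, List.flatMap_append, List.flatMap_cons, List.flatMap_nil,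
      List.append_nil]
    split_ifs <;> simp

/-- What the state of level `k` says about the labels of the children, and which lists have been
selected. -/
def Classified (N : ℕ → Node) (c : List ℕ) (k : ℕ) (a : Acc) : Prop :=
  (a.st k = 0 ∧ (∀ u ∈ c, (N u).lab k = 0) ∧ a.fst k = [] ∧ a.snd k = []) ∨
  (a.st k = 1 ∧ (∀ u ∈ c, (N u).lab k ≤ 1) ∧ (∃ u ∈ c, (N u).lab k = 1) ∧
    a.fst k = [] ∧ a.snd k = []) ∨
  (a.st k = 2 ∧ ∃ v ∈ c, (N v).lab k = 2 ∧ (∀ u ∈ c, u ≠ v → (N u).lab k ≤ 1) ∧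
    a.fst k = (N v).fst k ∧ a.snd k = (N v).snd k) ∨
  (a.st k = 3 ∧ ∃ v ∈ c, ∃ w ∈ c, v ≠ w ∧ (N v).lab k = 2 ∧ (N w).lab k = 2 ∧
    (∀ u ∈ c, u ≠ v → u ≠ w → (N u).lab k ≤ 1) ∧
    a.fst k = (N v).fst k ∧ a.snd k = (N w).snd k) ∨
  ((a.st k = 4 ∨ a.st k = 5) ∧ ∃ v ∈ c, (N v).lab k = a.st k ∧
    (∀ u ∈ c, u ≠ v → (N u).lab k = 0) ∧ a.fst k = (N v).fst k ∧ a.snd k = (N v).snd k) ∨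
  (a.st k = 6 ∧
    ((∃ u ∈ c, ∃ v ∈ c, ∃ w ∈ c, u ≠ v ∧ u ≠ w ∧ v ≠ w ∧ (N u).lab k = 2 ∧ (N v).lab k = 2 ∧
      (N w).lab k = 2) ∨
    ∃ u ∈ c, ∃ v ∈ c, u ≠ v ∧ ((N u).lab k = 4 ∨ (N u).lab k = 5) ∧ (N v).lab k ≠ 0))

theorem classified_append {N : ℕ → Node} {c : List ℕ} {k x : ℕ} {a : Acc}
    (h : Classified N c k a) (hx : x ∉ c)
    (hl : (N x).lab k = 0 ∨ (N x).lab k = 1 ∨ (N x).lab k = 2 ∨ (N x).lab k = 4 ∨ (N x).lab k = 5)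
    (hne : ∀ u ∈ c, 2 ≤ (N u).lab k → (N u).fst k ≠ []) :
    Classified N (c ++ [x]) k (a.push (N x)) := by
  have hxc : ∀ u ∈ c, u ≠ x := fun u hu h => hx (h ▸ hu)
  unfold Classified
  simp only [Acc.push, List.mem_append, List.mem_singleton]
  rcases h with ⟨h1, h2, h3, h4⟩ | ⟨h1, h2, ⟨z, hz, hz1⟩, h3, h4⟩ | ⟨h1, v, hv, hv2, h2, h3, h4⟩ |
    ⟨h1, v, hv, w, hw, hvw, hv2, hw2, h2, h3, h4⟩ | ⟨h1, v, hv, hv2, h2, h3, h4⟩ | ⟨h1, h2⟩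
  · -- no label so far
    rcases hl with hl | hl | hl | hl | hl <;> simp only [h1, h3, h4, hl, join]
    · left
      refine ⟨by simp, ?_, by simp, by simp⟩
      rintro u (hu | rfl)
      · exact h2 u hu
      · exact hl
    · right; left
      refine ⟨by simp, ?_, ⟨x, Or.inr rfl, hl⟩, by simp, by simp⟩
      rintro u (hu | rfl)
      · rw [h2 u hu]; omega
      · omega
    · right; right; left
      refine ⟨by simp, x, Or.inr rfl, hl, ?_, by simp, by simp⟩
      rintro u (hu | rfl) hne
      · rw [h2 u hu]; omega
      · exact absurd rfl hne
    · right; right; right; right; left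
      refine ⟨by simp, x, Or.inr rfl, by simpa using hl, ?_, by simp, by simp⟩
      rintro u (hu | rfl) hne
      · rw [h2 u hu]
      · exact absurd rfl hne
    · right; right; right; right; left
      refine ⟨by simp, x, Or.inr rfl, by simpa using hl, ?_, by simp, by simp⟩
      rintro u (hu | rfl) hne
      · rw [h2 u hu]
      · exact absurd rfl hne
  · rcases hl with hl | hl | hl | hl | hl <;> simp only [h1, h3, h4, hl, join]
    · right; left
      refine ⟨by simp, ?_, ⟨z, Or.inl hz, hz1⟩, by simp, by simp⟩
      rintro u (hu | rfl)
      · exact h2 u hu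
      · omega
    · right; left
      refine ⟨by simp, ?_, ⟨z, Or.inl hz, hz1⟩, by simp, by simp⟩
      rintro u (hu | rfl)
      · exact h2 u hu
      · omega
    · right; right; left
      refine ⟨by simp, x, Or.inr rfl, hl, ?_, by simp, by simp⟩
      rintro u (hu | rfl) hne
      · exact h2 u hu
      · exact absurd rfl hne
    · right; right; right; right; right
      exact ⟨by simp, Or.inr ⟨x, Or.inr rfl, z, Or.inl hz, (hxc z hz).symm, Or.inl hl, by omega⟩⟩
    · right; right; right; right; right
      exact ⟨by simp, Or.inr ⟨x, Or.inr rfl, z, Or.inl hz, (hxc z hz).symm, Or.inr hl, by omega⟩⟩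
  · have hn := hne v hv (by omega)
    rcases hl with hl | hl | hl | hl | hl <;> simp only [h1, h3, h4, hl, join]
    · right; right; left
      refine ⟨by simp, v, Or.inl hv, hv2, ?_, by simp, by simp⟩
      rintro u (hu | rfl) hne
      · exact h2 u hu hne
      · omega
    · right; right; left
      refine ⟨by simp, v, Or.inl hv, hv2, ?_, by simp, by simp⟩
      rintro u (hu | rfl) hne
      · exact h2 u hu hne
      · omega
    · right; right; right; left
      refine ⟨by simp, v, Or.inl hv, x, Or.inr rfl, hxc v hv, hv2, hl, ?_, by simp [hn], by simp⟩
      rintro u (hu | rfl) hne hne'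
      · exact h2 u hu hne
      · exact absurd rfl hne'
    · right; right; right; right; right
      exact ⟨by simp, Or.inr ⟨x, Or.inr rfl, v, Or.inl hv, (hxc v hv).symm, Or.inl hl, by omega⟩⟩
    · right; right; right; right; right
      exact ⟨by simp, Or.inr ⟨x, Or.inr rfl, v, Or.inl hv, (hxc v hv).symm, Or.inr hl, by omega⟩⟩
  · have hn := hne v hv (by omega)
    rcases hl with hl | hl | hl | hl | hl <;> simp only [h1, h3, h4, hl, join]
    · right; right; right; left
      refine ⟨by simp, v, Or.inl hv, w, Or.inl hw, hvw, hv2, hw2, ?_, by simp, by simp⟩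
      rintro u (hu | rfl) hne hne'
      · exact h2 u hu hne hne'
      · omega
    · right; right; right; left
      refine ⟨by simp, v, Or.inl hv, w, Or.inl hw, hvw, hv2, hw2, ?_, by simp, by simp⟩
      rintro u (hu | rfl) hne hne'
      · exact h2 u hu hne hne'
      · omega
    · right; right; right; right; right
      exact ⟨by simp, Or.inl ⟨v, Or.inl hv, w, Or.inl hw, x, Or.inr rfl, hvw, hxc v hv, hxc w hw,
        hv2, hw2, hl⟩⟩
    · right; right; right; right; right
      exact ⟨by simp, Or.inr ⟨x, Or.inr rfl, v, Or.inl hv, (hxc v hv).symm, Or.inl hl, by omega⟩⟩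
    · right; right; right; right; right
      exact ⟨by simp, Or.inr ⟨x, Or.inr rfl, v, Or.inl hv, (hxc v hv).symm, Or.inr hl, by omega⟩⟩
  · have hv4 : (N v).lab k = 4 ∨ (N v).lab k = 5 := by omega
    have hn := hne v hv (by omega)
    by_cases hx0 : (N x).lab k = 0
    · right; right; right; right; left
      have : join (a.st k) ((N x).lab k) = a.st k := by simp [join, hx0]
      rw [this]
      refine ⟨h1, v, Or.inl hv, hv2, ?_, by simp [hx0, h3], by simp [hx0, h4]⟩
      rintro u (hu | rfl) hne
      · exact h2 u hu hne
      · exact hx0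
    · right; right; right; right; right
      refine ⟨?_, Or.inr ⟨v, Or.inl hv, x, Or.inr rfl, hxc v hv, hv4, hx0⟩⟩
      rcases h1 with h1 | h1 <;> rcases hl with hl | hl | hl | hl | hl <;> simp [join, h1, hl] <;>
        omega
  · right; right; right; right; right
    constructor
    · rcases hl with hl | hl | hl | hl | hl <;> simp [join, h1, hl]
    · rcases h2 with ⟨u, hu, v, hv, w, hw, h⟩ | ⟨u, hu, v, hv, h⟩
      · exact Or.inl ⟨u, Or.inl hu, v, Or.inl hv, w, Or.inl hw, h⟩
      · exact Or.inr ⟨u, Or.inl hu, v, Or.inl hv, h⟩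

theorem classified_collect {N : ℕ → Node} {c : List ℕ} {k : ℕ} (hc : c.Nodup)
    (hl : ∀ x ∈ c, (N x).lab k = 0 ∨ (N x).lab k = 1 ∨ (N x).lab k = 2 ∨ (N x).lab k = 4 ∨
      (N x).lab k = 5)
    (hne : ∀ u ∈ c, 2 ≤ (N u).lab k → (N u).fst k ≠ []) :
    Classified N c k (collect N c) := by
  induction c using List.reverseRecOn with
  | nil => exact Or.inl ⟨rfl, by simp, rfl, rfl⟩
  | append_singleton c u ih =>
    rw [collect_append]
    have hd := List.nodup_append.1 hc
    refine classified_append (ih hd.1 (fun x hx => hl x (by simp [hx]))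
      fun x hx => hne x (by simp [hx])) (fun h => hd.2.2 u h u (by simp) rfl) (hl u (by simp))
      fun x hx => hne x (by simp [hx])

theorem scan_base_le (st : ℕ → ℕ) (K : ℕ) : (scan st K).1 ≤ K := by
  induction K with
  | zero => simp [scan]
  | succ K ih => simp only [scan]; split_ifs <;> (try simp only) <;> omega

theorem scan_above {st : ℕ → ℕ} {K k : ℕ} (hk : k < K) (hb : (scan st K).1 < k) :
    st k = 0 ∨ st k = 5 := by
  induction K with
  | zero => omega
  | succ K ih =>
    have := scan_base_le st K
    simp only [scan] at hb
    split_ifs at hb with h1 h2 h3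
    · by_cases hkK : k = K
      · subst hkK; exact Or.inl h1
      · exact ih (by omega) hb
    · omega
    · by_cases hkK : k = K
      · subst hkK; exact Or.inr h3
      · exact ih (by omega) hb
    all_goals omega

/-- What the label of the base says about the state of the base level. -/
theorem scan_spec {st : ℕ → ℕ} (hst : ∀ k, st k ≤ 6) (K : ℕ) {b t : ℕ} (h : scan st K = (b, t)) :
    (t = 1 ∧ (b < K → st b = 0) ∧ (scan st b).1 = b) ∨
    (0 < b ∧ b < K ∧ ((t = 2 ∧ (st b = 1 ∨ st b = 2)) ∨ (t = 4 ∧ st b = 3) ∨ (t = 5 ∧ st b = 4))) := by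
  induction K generalizing b t with
  | zero =>
    simp only [scan, Prod.mk.injEq] at h
    obtain ⟨rfl, rfl⟩ := h
    exact Or.inl ⟨rfl, by omega, rfl⟩
  | succ K ih =>
    have hle := scan_base_le st K
    have hsame : scan st K = (b, t) → (st K = 0 ∨ (st K = 5 ∧ (scan st K).1 ≠ K)) →
        (t = 1 ∧ (b < K + 1 → st b = 0) ∧ (scan st b).1 = b) ∨
        (0 < b ∧ b < K + 1 ∧
          ((t = 2 ∧ (st b = 1 ∨ st b = 2)) ∨ (t = 4 ∧ st b = 3) ∨ (t = 5 ∧ st b = 4))) := by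
      intro hs hK
      rw [hs] at hK hle
      simp only at hK hle
      rcases ih hs with ⟨h1, h2, h3⟩ | ⟨h1, h2, h3⟩
      · refine Or.inl ⟨h1, fun _ => ?_, h3⟩
        by_cases hbK : b = K
        · rcases hK with hK | hK
          · rw [hbK]; exact hK
          · exact absurd hbK hK.2
        · exact h2 (by omega)
      · exact Or.inr ⟨h1, by omega, h3⟩
    by_cases h1 : st K = 0
    · exact hsame (by rw [← h, scan, if_pos h1]) (Or.inl h1)
    by_cases h2 : K = 0 ∨ st K = 6 ∨ (st K = 5 ∧ (scan st K).1 = K)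
    · have hs : scan st (K + 1) = (K + 1, 1) := by rw [scan, if_neg h1, if_pos h2]
      rw [hs, Prod.mk.injEq] at h
      obtain ⟨rfl, rfl⟩ := h
      exact Or.inl ⟨rfl, by omega, by rw [hs]⟩
    by_cases h3 : st K = 5
    · exact hsame (by rw [← h, scan, if_neg h1, if_neg h2, if_pos h3])
        (Or.inr ⟨h3, fun h => h2 (by tauto)⟩)
    · rw [scan, if_neg h1, if_neg h2, if_neg h3, Prod.mk.injEq] at h
      obtain ⟨rfl, rfl⟩ := h
      have := hst K
      refine Or.inr ⟨by omega, by omega, ?_⟩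
      push Not at h2
      split_ifs with h4
      · exact Or.inl ⟨rfl, Or.inr h4⟩
      · have : st K = 1 ∨ st K = 3 ∨ st K = 4 := by omega
        rcases this with h | h | h <;> simp [h]

/-- A scan is at its own level only after a conflict one level below. -/
theorem scan_conflict {st : ℕ → ℕ} {k : ℕ} (h : (scan st (k + 1)).1 = k + 1) :
    st k ≠ 0 ∧ (k = 0 ∨ st k = 6 ∨ (st k = 5 ∧ (scan st k).1 = k)) := by
  have := scan_base_le st k
  simp only [scan] at h
  split_ifs at h with h1 h2 h3 <;> first | exact ⟨h1, h2⟩ | omega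

/-! ### Labels are lower bounds -/

/-- All vertices below `n` carry the labels that processing computes from those of their children,
where `ch x` lists the children of `x` and `K` exceeds the possible widths. -/
structure IsLabelled (n K : ℕ) (p : ℕ → ℕ) (ch : ℕ → List ℕ) (N : ℕ → Node) : Prop where
  parent_lt : ∀ u, 0 < u → p u < u
  mem_ch : ∀ x u, u ∈ ch x ↔ 0 < u ∧ u < n ∧ p u = x
  nodup : ∀ x, (ch x).Nodup
  eq : ∀ x < n, N x = Node.of x K (collect N (ch x))
  lt_pow : n < 2 ^ K

/-- The vertex `w` is marked: its subtree is cut off at level `j` or a higher level. -/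
def Mk (N : ℕ → Node) (j w : ℕ) : Prop := (N w).kind = 5 ∧ j ≤ (N w).base

/-- What the label of a vertex `u` at level `k` means for the part of the subtree of `u` that is not
cut off at a level above `k`. -/
structure Sound (n : ℕ) (p : ℕ → ℕ) (ch : ℕ → List ℕ) (N : ℕ → Node) (u k : ℕ) : Prop where
  lab : (N u).lab k = 0 ∨ (N u).lab k = 1 ∨ (N u).lab k = 2 ∨ (N u).lab k = 4 ∨ (N u).lab k = 5
  fst_ne : 2 ≤ (N u).lab k → (N u).fst k ≠ []
  not_mk : (N u).lab k ≠ 0 → ¬ Mk N (k + 1) u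
  cert : (N u).lab k ≠ 0 → Cert (Adj p) k {z | Vis n p (Mk N (k + 1)) u z}
  two : (N u).lab k = 2 → ∃ z ∈ ch u, (N z).lab k ≠ 0
  four : (N u).lab k = 4 → ∃ v ∈ ch u, ∃ w ∈ ch u, v ≠ w ∧ (N v).lab k = 2 ∧ (N w).lab k = 2
  five : (N u).lab k = 5 → ∃ w, Vis n p (Mk N (k + 1)) u w ∧ (N w).kind = 5 ∧ (N w).base = k ∧
    ∃ y ∈ ch w, (N y).lab k = 4

section
variable {n K : ℕ} {p : ℕ → ℕ} {ch : ℕ → List ℕ} {N : ℕ → Node} {m : ℕ → Prop} {x y u v w z : ℕ}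

theorem Mk.mono {j j' : ℕ} (hj : j ≤ j') (h : Mk N j' w) : Mk N j w := ⟨h.1, hj.trans h.2⟩

theorem VisB.parent (h : VisB n p m x z) (hz : z ≠ x) :
    0 < z ∧ VisB n p m x (p z) := by
  rcases h with rfl | ⟨u, ⟨h0, h1, h2⟩, h⟩
  · exact absurd rfl hz
  · cases h with
    | refl hm => exact ⟨h0, Or.inl h2⟩
    | step h3 h4 h5 h6 => exact ⟨h3, Or.inr ⟨u, ⟨h0, h1, h2⟩, h6⟩⟩

theorem VisB.trans (h : VisB n p m x y) (h' : VisB n p m y z) : VisB n p m x z := by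
  rcases h with rfl | ⟨u, hu, h⟩
  · exact h'
  · exact Or.inr ⟨u, hu, h.trans (vis_iff.2 ⟨h.not_right, h'⟩)⟩

theorem VisB.lt (h : VisB n p m x z) (hx : x < n) : z < n := by
  rcases h with rfl | ⟨u, hu, h⟩
  · exact hx
  · exact h.lt hu.2.1

theorem VisB.not_of_desc (hp : ∀ u, 0 < u → p u < u) (h : VisB n p m x z) (hw : Desc p w z)
    (hxw : Desc p x w) (hne : w ≠ x) : ¬ m w := by
  rcases h with rfl | ⟨u, ⟨h0, h1, rfl⟩, h⟩
  · exact absurd (le_antisymm (hw.le hp) (hxw.le hp)) hne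
  · rcases h.desc.total hw with h2 | h2
    · exact (h.split hp h2 hw).1.not_right
    · rcases h2.eq_or with h3 | h3
      · rw [← h3]; exact h.not_left
      · exact absurd (le_antisymm (h3.2.le hp) (hxw.le hp)) hne

theorem Vis.visB_of_child (h : Vis n p m u z) (hu : 0 < u ∧ u < n ∧ p u = x) : VisB n p m x z :=
  Or.inr ⟨u, hu, h⟩

/-- Three arms, as in the definition of a certificate. -/
theorem cert_of_arms {r : ℕ → ℕ → Prop} {k : ℕ} (hk : 1 ≤ k) {S A₁ A₂ A₃ B₁ B₂ B₃ : Set ℕ}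
    (c₁ : Cert r k B₁) (c₂ : Cert r k B₂) (c₃ : Cert r k B₃)
    (b₁ : B₁ ⊆ A₁) (b₂ : B₂ ⊆ A₂) (b₃ : B₃ ⊆ A₃) (a₁ : A₁ ⊆ S) (a₂ : A₂ ⊆ S) (a₃ : A₃ ⊆ S)
    (x₁ : x ∈ A₁) (x₂ : x ∈ A₂) (x₃ : x ∈ A₃) (l₁ : Linked r A₁) (l₂ : Linked r A₂)
    (l₃ : Linked r A₃)
    (f₁₂ : ∀ a ∈ A₁, ∀ b ∈ B₂, a ≠ b ∧ ¬ r a b) (f₁₃ : ∀ a ∈ A₁, ∀ b ∈ B₃, a ≠ b ∧ ¬ r a b)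
    (f₂₁ : ∀ a ∈ A₂, ∀ b ∈ B₁, a ≠ b ∧ ¬ r a b) (f₂₃ : ∀ a ∈ A₂, ∀ b ∈ B₃, a ≠ b ∧ ¬ r a b)
    (f₃₁ : ∀ a ∈ A₃, ∀ b ∈ B₁, a ≠ b ∧ ¬ r a b) (f₃₂ : ∀ a ∈ A₃, ∀ b ∈ B₂, a ≠ b ∧ ¬ r a b) :
    Cert r (k + 1) S := by
  obtain ⟨k, rfl⟩ : ∃ j, k = j + 1 := ⟨k - 1, by omega⟩
  refine ⟨x, ![A₁, A₂, A₃], ![B₁, B₂, B₃], fun i => ?_, fun i j hij => ?_⟩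
  · fin_cases i
    · exact ⟨c₁, b₁, a₁, x₁, l₁⟩
    · exact ⟨c₂, b₂, a₂, x₂, l₂⟩
    · exact ⟨c₃, b₃, a₃, x₃, l₃⟩
  · fin_cases i <;> fin_cases j <;> first | exact absurd rfl hij | assumption

/-- Below a child `u` of a vertex of the arm, the vertices under a child `z` of `u` are far from the
vertices outside of the subtree of `u`. -/
theorem far_of_not_desc {a b : ℕ} (hz : p z = u) (h0 : 0 < z)
    (ha : ¬ Desc p u a) (hb : Desc p z b) : a ≠ b ∧ ¬ Adj p a b := by
  subst hz
  refine ⟨fun h => ha (h ▸ hb.of_parent h0), fun h => ?_⟩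
  have := h.symm.leave hb (fun h' => ha (h'.of_parent h0))
  exact ha (this.2.2 ▸ .refl)

theorem linked_vis_diff (hp : ∀ u, 0 < u → p u < u) (q : ℕ → Prop) (hq : ∀ z, 0 < z → q z → q (p z)) :
    Linked (Adj p) {z | VisB n p m x z ∧ q z} := by
  refine linked_of_parent_mem (x := x) hp fun z hz hzx => ?_
  obtain ⟨h0, h1⟩ := hz.1.parent hzx
  exact ⟨h0, h1, hq z h0 hz.2⟩

theorem not_desc_parent (h0 : 0 < z) (h : ¬ Desc p u z) : ¬ Desc p u (p z) :=
  fun h' => h (.step h0 h')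

/-- A vertex with three children that each have a child of width at least `k`. -/
theorem cert_three_children (hp : ∀ u, 0 < u → p u < u) {k : ℕ} (hk : 1 ≤ k)
    {u₁ u₂ u₃ z₁ z₂ z₃ : ℕ}
    (hu₁ : 0 < u₁ ∧ u₁ < n ∧ p u₁ = x) (hu₂ : 0 < u₂ ∧ u₂ < n ∧ p u₂ = x)
    (hu₃ : 0 < u₃ ∧ u₃ < n ∧ p u₃ = x)
    (hz₁ : 0 < z₁ ∧ z₁ < n ∧ p z₁ = u₁) (hz₂ : 0 < z₂ ∧ z₂ < n ∧ p z₂ = u₂)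
    (hz₃ : 0 < z₃ ∧ z₃ < n ∧ p z₃ = u₃)
    (h₁₂ : u₁ ≠ u₂) (h₁₃ : u₁ ≠ u₃) (h₂₃ : u₂ ≠ u₃) (m₁ : ¬ m u₁) (m₂ : ¬ m u₂) (m₃ : ¬ m u₃)
    (c₁ : Cert (Adj p) k {z | Vis n p m z₁ z}) (c₂ : Cert (Adj p) k {z | Vis n p m z₂ z})
    (c₃ : Cert (Adj p) k {z | Vis n p m z₃ z}) :
    Cert (Adj p) (k + 1) {z | VisB n p m x z} := by
  have hx : ∀ u, 0 < u ∧ u < n ∧ p u = x → ¬ Desc p u x := by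
    intro u hu h
    have := h.le hp
    have := hp u hu.1
    omega
  have hsub : ∀ u v z : ℕ, (0 < u ∧ u < n ∧ p u = x) → (0 < v ∧ v < n ∧ p v = x) → u ≠ v →
      Desc p u z → ¬ Desc p v z := fun u v z hu hv hne h h' =>
    hne (h.sibling_eq hp hu.1 hv.1 (hu.2.2.trans hv.2.2.symm) h')
  have hvis : ∀ u w z, (0 < u ∧ u < n ∧ p u = x) → ¬ m u → (0 < w ∧ w < n ∧ p w = u) →
      Vis n p m w z → VisB n p m x z ∧ Desc p u z := by
    intro u w z hu hm hw hz
    have : Vis n p m u z := vis_iff.2 ⟨hm, hz.visB_of_child hw⟩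
    exact ⟨this.visB_of_child hu, this.desc⟩
  have hlink : ∀ u v, Linked (Adj p) {z | VisB n p m x z ∧ ¬ Desc p u z ∧ ¬ Desc p v z} :=
    fun u v => linked_vis_diff hp _ fun z h0 h => ⟨not_desc_parent h0 h.1, not_desc_parent h0 h.2⟩
  refine cert_of_arms (x := x) hk c₁ c₂ c₃
    (A₁ := {z | VisB n p m x z ∧ ¬ Desc p u₂ z ∧ ¬ Desc p u₃ z})
    (A₂ := {z | VisB n p m x z ∧ ¬ Desc p u₁ z ∧ ¬ Desc p u₃ z})
    (A₃ := {z | VisB n p m x z ∧ ¬ Desc p u₁ z ∧ ¬ Desc p u₂ z})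
    ?_ ?_ ?_ (fun z hz => hz.1) (fun z hz => hz.1) (fun z hz => hz.1)
    ⟨Or.inl rfl, hx _ hu₂, hx _ hu₃⟩ ⟨Or.inl rfl, hx _ hu₁, hx _ hu₃⟩
    ⟨Or.inl rfl, hx _ hu₁, hx _ hu₂⟩ (hlink _ _) (hlink _ _) (hlink _ _)
    (fun a ha b hb => far_of_not_desc hz₂.2.2 hz₂.1 ha.2.1 hb.desc)
    (fun a ha b hb => far_of_not_desc hz₃.2.2 hz₃.1 ha.2.2 hb.desc)
    (fun a ha b hb => far_of_not_desc hz₁.2.2 hz₁.1 ha.2.1 hb.desc)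
    (fun a ha b hb => far_of_not_desc hz₃.2.2 hz₃.1 ha.2.2 hb.desc)
    (fun a ha b hb => far_of_not_desc hz₁.2.2 hz₁.1 ha.2.1 hb.desc)
    (fun a ha b hb => far_of_not_desc hz₂.2.2 hz₂.1 ha.2.2 hb.desc)
  · intro z hz
    have := hvis _ _ z hu₁ m₁ hz₁ hz
    exact ⟨this.1, hsub _ _ z hu₁ hu₂ h₁₂ this.2, hsub _ _ z hu₁ hu₃ h₁₃ this.2⟩
  · intro z hz
    have := hvis _ _ z hu₂ m₂ hz₂ hz
    exact ⟨this.1, hsub _ _ z hu₂ hu₁ h₁₂.symm this.2, hsub _ _ z hu₂ hu₃ h₂₃ this.2⟩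
  · intro z hz
    have := hvis _ _ z hu₃ m₃ hz₃ hz
    exact ⟨this.1, hsub _ _ z hu₃ hu₁ h₁₃.symm this.2, hsub _ _ z hu₃ hu₂ h₂₃.symm this.2⟩

/-- A vertex `y` with two children that each have a child of width at least `k`, and a third set of
width at least `k` outside of the subtree of `y`. -/
theorem cert_two_children_and_above (hp : ∀ u, 0 < u → p u < u) {k : ℕ} (hk : 1 ≤ k)
    {u₁ u₂ z₁ z₂ : ℕ}
    (hu₁ : 0 < u₁ ∧ u₁ < n ∧ p u₁ = y) (hu₂ : 0 < u₂ ∧ u₂ < n ∧ p u₂ = y)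
    (hz₁ : 0 < z₁ ∧ z₁ < n ∧ p z₁ = u₁) (hz₂ : 0 < z₂ ∧ z₂ < n ∧ p z₂ = u₂)
    (h₁₂ : u₁ ≠ u₂) (m₁ : ¬ m u₁) (m₂ : ¬ m u₂)
    (c₁ : Cert (Adj p) k {z | Vis n p m z₁ z}) (c₂ : Cert (Adj p) k {z | Vis n p m z₂ z})
    (hy : VisB n p m x y) {S : Set ℕ} (hS : Cert (Adj p) k S)
    (hSx : ∀ s ∈ S, VisB n p m x s ∧ ¬ Desc p y s ∧ s ≠ p y) :
    Cert (Adj p) (k + 1) {z | VisB n p m x z} := by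
  have hyn : ∀ u, 0 < u ∧ u < n ∧ p u = y → ¬ Desc p u y := by
    intro u hu h
    have := h.le hp
    have := hp u hu.1
    omega
  have hsub : ∀ u v z : ℕ, (0 < u ∧ u < n ∧ p u = y) → (0 < v ∧ v < n ∧ p v = y) → u ≠ v →
      Desc p u z → ¬ Desc p v z := fun u v z hu hv hne h h' =>
    hne (h.sibling_eq hp hu.1 hv.1 (hu.2.2.trans hv.2.2.symm) h')
  have hvis : ∀ u w z, (0 < u ∧ u < n ∧ p u = y) → ¬ m u → (0 < w ∧ w < n ∧ p w = u) →
      Vis n p m w z → VisB n p m y z ∧ Desc p u z := by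
    intro u w z hu hm hw hz
    have : Vis n p m u z := vis_iff.2 ⟨hm, hz.visB_of_child hw⟩
    exact ⟨this.visB_of_child hu, this.desc⟩
  have hup : ∀ a b, Desc p y a → ¬ Desc p y b → b ≠ p y → a ≠ b ∧ ¬ Adj p a b := by
    intro a b ha hb hne
    exact ⟨fun h => hb (h ▸ ha), fun h => hne (h.leave ha hb).2.2.symm⟩
  have hlink : ∀ u, Linked (Adj p) {z | VisB n p m y z ∧ ¬ Desc p u z} :=
    fun u => linked_vis_diff hp _ fun z h0 h => not_desc_parent h0 h
  refine cert_of_arms (x := y) hk c₁ c₂ hS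
    (A₁ := {z | VisB n p m y z ∧ ¬ Desc p u₂ z}) (A₂ := {z | VisB n p m y z ∧ ¬ Desc p u₁ z})
    (A₃ := {z | VisB n p m x z ∧ ¬ Desc p u₁ z ∧ ¬ Desc p u₂ z})
    ?_ ?_ ?_ (fun z hz => hy.trans hz.1) (fun z hz => hy.trans hz.1) (fun z hz => hz.1)
    ⟨Or.inl rfl, hyn _ hu₂⟩ ⟨Or.inl rfl, hyn _ hu₁⟩ ⟨hy, hyn _ hu₁, hyn _ hu₂⟩
    (hlink _) (hlink _) ?_
    (fun a ha b hb => far_of_not_desc hz₂.2.2 hz₂.1 ha.2 hb.desc)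
    (fun a ha b hb => hup a b ha.1.desc (hSx b hb).2.1 (hSx b hb).2.2)
    (fun a ha b hb => far_of_not_desc hz₁.2.2 hz₁.1 ha.2 hb.desc)
    (fun a ha b hb => hup a b ha.1.desc (hSx b hb).2.1 (hSx b hb).2.2)
    (fun a ha b hb => far_of_not_desc hz₁.2.2 hz₁.1 ha.2.1 hb.desc)
    (fun a ha b hb => far_of_not_desc hz₂.2.2 hz₂.1 ha.2.2 hb.desc)
  · intro z hz
    have := hvis _ _ z hu₁ m₁ hz₁ hz
    exact ⟨this.1, hsub _ _ z hu₁ hu₂ h₁₂ this.2⟩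
  · intro z hz
    have := hvis _ _ z hu₂ m₂ hz₂ hz
    exact ⟨this.1, hsub _ _ z hu₂ hu₁ h₁₂.symm this.2⟩
  · intro z hz
    have := hSx z hz
    exact ⟨this.1, fun h => this.2.1 (hu₁.2.2 ▸ h.of_parent hu₁.1),
      fun h => this.2.1 (hu₂.2.2 ▸ h.of_parent hu₂.1)⟩
  · exact linked_vis_diff hp _ fun z h0 h => ⟨not_desc_parent h0 h.1, not_desc_parent h0 h.2⟩

theorem IsLabelled.level_lt (h : IsLabelled n K p ch N) {k : ℕ} {S : Set ℕ}
    (hS : Cert (Adj p) k S) (hSn : ∀ z ∈ S, z < n) : k < K := by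
  obtain ⟨F, hF, hc⟩ := hS.exists_finset (adj_irrefl h.parent_lt)
  have h1 : F.card ≤ n := by
    have : F ⊆ Finset.range n := fun z hz => Finset.mem_range.2 (hSn z (hF hz))
    simpa using Finset.card_le_card this
  exact (Nat.pow_lt_pow_iff_right (by norm_num : 1 < 2)).1 ((hc.trans h1).trans_lt h.lt_pow)

theorem IsLabelled.sound_level_lt (h : IsLabelled n K p ch N) {k : ℕ} (hu : u < n)
    (hs : Sound n p ch N u k) (hk : (N u).lab k ≠ 0) : k < K :=
  h.level_lt (hs.cert hk) fun _ hz => Vis.lt hz hu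

theorem IsLabelled.classified (h : IsLabelled n K p ch N) {k : ℕ}
    (hs : ∀ u ∈ ch x, Sound n p ch N u k) : Classified N (ch x) k (collect N (ch x)) :=
  classified_collect (h.nodup x) (fun u hu => (hs u hu).lab) fun u hu => (hs u hu).fst_ne

theorem Classified.st_le {c : List ℕ} {k : ℕ} {a : Acc} (h : Classified N c k a) : a.st k ≤ 6 := by
  rcases h with h | h | h | h | h | h <;> omega

theorem Classified.exists_child {c : List ℕ} {k : ℕ} {a : Acc} (h : Classified N c k a)
    (h0 : a.st k ≠ 0) : ∃ u ∈ c, (N u).lab k ≠ 0 := by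
  rcases h with ⟨h, -⟩ | ⟨h, -, ⟨z, hz, hz'⟩, -⟩ | ⟨h, v, hv, hv', -⟩ | ⟨h, v, hv, w, hw, -, hv', -⟩ |
    ⟨h, v, hv, hv', -⟩ | ⟨h, ⟨u, hu, v, hv, w, hw, -, -, -, hv', -⟩ | ⟨u, hu, v, hv, -, -, hv'⟩⟩
  · exact absurd h h0
  · exact ⟨z, hz, by omega⟩
  · exact ⟨v, hv, by omega⟩
  · exact ⟨v, hv, by omega⟩
  · exact ⟨v, hv, by omega⟩
  · exact ⟨u, hu, by omega⟩
  · exact ⟨v, hv, hv'⟩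

/-- The heart of the lower bound: a scan that arrives at the base `k` has found a conflict one level
below, and hence three arms, which certify width `k`. -/
theorem IsLabelled.cert_scan (h : IsLabelled n K p ch N)
    (hs : ∀ u < n, x < u → ∀ k, Sound n p ch N u k) (k : ℕ)
    (hk : (scan (collect N (ch x)).st k).1 = k) :
    Cert (Adj p) k {z | VisB n p (Mk N k) x z} := by
  have hp := h.parent_lt
  have hch : ∀ a u, u ∈ ch a → 0 < u ∧ u < n ∧ p u = a := fun a u hu => (h.mem_ch a u).1 hu
  have hgt : ∀ a u, u ∈ ch a → a < u := fun a u hu => by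
    have := hch a u hu
    have := hp u this.1
    omega
  induction k with
  | zero => exact ⟨x, Or.inl rfl⟩
  | succ k ih =>
    obtain ⟨h0, hc⟩ := scan_conflict hk
    have hcl := h.classified (x := x) (k := k) fun u hu => hs u (hch x u hu).2.1 (hgt x u hu) k
    obtain ⟨z, hz, hzl⟩ := hcl.exists_child h0
    by_cases hk0 : k = 0
    · subst hk0
      have hm := (hs z (hch x z hz).2.1 (hgt x z hz) 0).not_mk hzl
      exact ⟨x, Or.inl rfl, z, Or.inr ⟨z, hch x z hz, .refl hm⟩, Or.inr ⟨(hch x z hz).1, (hch x z hz).2.2⟩⟩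
    replace hc := hc.resolve_left hk0
    have hk1 : 1 ≤ k := by omega
    -- the situation at a vertex `y` with label `4`
    have hfour : ∀ y, x < y → y < n → (N y).lab k = 4 → VisB n p (Mk N (k + 1)) x y → ∀ S : Set ℕ,
        Cert (Adj p) k S → (∀ s ∈ S, VisB n p (Mk N (k + 1)) x s ∧ ¬ Desc p y s ∧ s ≠ p y) →
        Cert (Adj p) (k + 1) {z | VisB n p (Mk N (k + 1)) x z} := by
      intro y hxy hyn hy hvis S hS hSx
      obtain ⟨u₁, hu₁, u₂, hu₂, hne, hl₁, hl₂⟩ := (hs y hyn hxy k).four hy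
      have hs₁ := hs u₁ (hch _ _ hu₁).2.1 (hxy.trans (hgt _ _ hu₁)) k
      have hs₂ := hs u₂ (hch _ _ hu₂).2.1 (hxy.trans (hgt _ _ hu₂)) k
      obtain ⟨z₁, hz₁, hzl₁⟩ := hs₁.two hl₁
      obtain ⟨z₂, hz₂, hzl₂⟩ := hs₂.two hl₂
      exact cert_two_children_and_above hp hk1 (hch _ _ hu₁) (hch _ _ hu₂) (hch _ _ hz₁)
        (hch _ _ hz₂) hne (hs₁.not_mk (by omega)) (hs₂.not_mk (by omega))
        ((hs z₁ (hch _ _ hz₁).2.1 ((hxy.trans (hgt _ _ hu₁)).trans (hgt _ _ hz₁)) k).cert hzl₁)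
        ((hs z₂ (hch _ _ hz₂).2.1 ((hxy.trans (hgt _ _ hu₂)).trans (hgt _ _ hz₂)) k).cert hzl₂)
        hvis hS hSx
    -- the situation at a child `u` with label `5`
    have hfive : ∀ u ∈ ch x, (N u).lab k = 5 → ∃ w y, Vis n p (Mk N (k + 1)) u w ∧
        Mk N k w ∧ y ∈ ch w ∧ x < y ∧ y < n ∧ (N y).lab k = 4 ∧ VisB n p (Mk N (k + 1)) x y := by
      intro u hu hl
      obtain ⟨w, hw, hwk, hwb, y, hy, hyl⟩ := (hs u (hch x u hu).2.1 (hgt x u hu) k).five hl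
      have hxy : x < y := (hgt x u hu).trans_le ((hw.desc.le hp).trans (hgt w y hy).le)
      have hym := (hs y (hch w y hy).2.1 hxy k).not_mk (by omega)
      have hwy : Vis n p (Mk N (k + 1)) w y :=
        vis_iff.2 ⟨hw.not_right, (Vis.refl hym).visB_of_child (hch w y hy)⟩
      exact ⟨w, y, hw, ⟨hwk, hwb.ge⟩, hy, hxy, (hch w y hy).2.1, hyl,
        (hw.trans hwy).visB_of_child (hch x u hu)⟩
    have hst := hcl.st_le
    rcases hc with hc | ⟨hc, hsc⟩
    · rcases hcl with ⟨g, -⟩ | ⟨g, -⟩ | ⟨g, -⟩ | ⟨g, -⟩ | ⟨g, -⟩ | ⟨g, hcl⟩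
      iterate 5 omega
      -- either three children have label `2`, or a label `4` or `5` meets another nonzero label
      rcases hcl with ⟨u, hu, v, hv, w, hw, huv, huw, hvw, hlu, hlv, hlw⟩ | ⟨u, hu, v, hv, huv, hlu, hlv⟩
      · have hsu := hs u (hch _ _ hu).2.1 (hgt _ _ hu) k
        have hsv := hs v (hch _ _ hv).2.1 (hgt _ _ hv) k
        have hsw := hs w (hch _ _ hw).2.1 (hgt _ _ hw) k
        obtain ⟨z₁, hz₁, hzl₁⟩ := hsu.two hlu
        obtain ⟨z₂, hz₂, hzl₂⟩ := hsv.two hlv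
        obtain ⟨z₃, hz₃, hzl₃⟩ := hsw.two hlw
        exact cert_three_children hp hk1 (hch _ _ hu) (hch _ _ hv) (hch _ _ hw) (hch _ _ hz₁)
          (hch _ _ hz₂) (hch _ _ hz₃) huv huw hvw (hsu.not_mk (by omega)) (hsv.not_mk (by omega))
          (hsw.not_mk (by omega))
          ((hs z₁ (hch _ _ hz₁).2.1 ((hgt _ _ hu).trans (hgt _ _ hz₁)) k).cert hzl₁)
          ((hs z₂ (hch _ _ hz₂).2.1 ((hgt _ _ hv).trans (hgt _ _ hz₂)) k).cert hzl₂)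
          ((hs z₃ (hch _ _ hz₃).2.1 ((hgt _ _ hw).trans (hgt _ _ hz₃)) k).cert hzl₃)
      · have hsv := hs v (hch _ _ hv).2.1 (hgt _ _ hv) k
        have hdis : ∀ s, Desc p u s → ¬ Desc p v s := fun s h1 h2 =>
          huv (h1.sibling_eq hp (hch _ _ hu).1 (hch _ _ hv).1
            ((hch _ _ hu).2.2.trans (hch _ _ hv).2.2.symm) h2)
        rcases hlu with hlu | hlu
        · have hsu := hs u (hch _ _ hu).2.1 (hgt _ _ hu) k
          refine hfour u (hgt _ _ hu) (hch _ _ hu).2.1 hlu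
            ((Vis.refl (hsu.not_mk (by omega))).visB_of_child (hch _ _ hu)) _ (hsv.cert hlv) ?_
          intro s hsm
          refine ⟨Vis.visB_of_child hsm (hch _ _ hv), fun h => hdis s h (Vis.desc hsm), ?_⟩
          have h1 := (Vis.desc hsm).le hp
          have h2 := hgt _ _ hv
          have h3 := (hch _ _ hu).2.2
          omega
        · obtain ⟨w, y, hw, -, hy, hxy, hyn, hyl, hyv⟩ := hfive u hu hlu
          refine hfour y hxy hyn hyl hyv _ (hsv.cert hlv) fun s hsm => ?_
          have hyp := hch w y hy
          have hds : ¬ Desc p u s := fun h => hdis s h (Vis.desc hsm)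
          refine ⟨Vis.visB_of_child hsm (hch _ _ hv), fun h => hds ?_, fun h => hds ?_⟩
          · exact hw.desc.trans (hyp.2.2 ▸ h.of_parent hyp.1)
          · rw [h, hyp.2.2]; exact hw.desc
    -- label `5` of a child, and the third arm lies in the rest of the subtree of `x`
    · rcases hcl with ⟨g, -⟩ | ⟨g, -⟩ | ⟨g, -⟩ | ⟨g, -⟩ | ⟨g, u, hu, hlu, -⟩ | ⟨g, -⟩
      iterate 4 omega
      · obtain ⟨w, y, hw, hwm, hy, hxy, hyn, hyl, hyv⟩ := hfive u hu (hlu.trans hc)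
        refine hfour y hxy hyn hyl hyv _ (ih hsc) fun s hsm => ?_
        have hyp := hch w y hy
        have hds : ¬ Desc p w s := fun h' => by
          refine VisB.not_of_desc hp hsm h' ((hch x u hu).2.2 ▸ hw.desc.of_parent (hch x u hu).1) ?_ hwm
          have := hw.desc.le hp
          have := hgt x u hu
          omega
        refine ⟨VisB.mono hsm fun w hw => hw.mono (Nat.le_succ k), fun h => hds ?_, fun h => hds ?_⟩
        · exact hyp.2.2 ▸ h.of_parent hyp.1
        · rw [h, hyp.2.2]; exact .refl
      · omega

end

section
variable {n K : ℕ} {p : ℕ → ℕ} {ch : ℕ → List ℕ} {N : ℕ → Node} {m : ℕ → Prop} {x y u v w z k : ℕ}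

theorem IsLabelled.lab_eq (h : IsLabelled n K p ch N) (hx : x < n) (k : ℕ) :
    (N x).lab k = labOf (N x).base (N x).kind (collect N (ch x)).st k := by rw [h.eq x hx]; rfl

theorem IsLabelled.fst_eq (h : IsLabelled n K p ch N) (hx : x < n) (k : ℕ) :
    (N x).fst k = fstOf (N x).base (N x).kind x (collect N (ch x)) k := by rw [h.eq x hx]; rfl

theorem IsLabelled.snd_eq (h : IsLabelled n K p ch N) (hx : x < n) (k : ℕ) :
    (N x).snd k = sndOf (N x).base (N x).kind x (collect N (ch x)) k := by rw [h.eq x hx]; rfl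

theorem IsLabelled.cl_zero (h : IsLabelled n K p ch N) (hx : x < n) : (N x).cl 0 = [] := by
  rw [h.eq x hx]; rfl

theorem IsLabelled.cl_succ (h : IsLabelled n K p ch N) (hx : x < n) (k : ℕ) :
    (N x).cl (k + 1) = if (N x).lab k = 1 ∨ (N x).lab k = 2 then (N x).snd k
      else (N x).fst k ++ (N x).cl k ++ (N x).snd k := by rw [h.eq x hx]; rfl

theorem IsLabelled.side_eq (h : IsLabelled n K p ch N) (hx : x < n) (k : ℕ) :
    (N x).side k = sideOf (N x).base (N x).kind x (collect N (ch x)) k := by rw [h.eq x hx]; rfl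

theorem IsLabelled.base_kind (h : IsLabelled n K p ch N) (hx : x < n) :
    scan (collect N (ch x)).st K = ((N x).base, (N x).kind) := by
  rw [h.eq x hx]; rfl

theorem IsLabelled.child_lt (h : IsLabelled n K p ch N) (hu : u ∈ ch x) : x < u ∧ u < n := by
  obtain ⟨h0, h1, h2⟩ := (h.mem_ch x u).1 hu
  have := h.parent_lt u h0
  omega

/-- Facts on the labels of a single vertex. -/
structure Local (n K : ℕ) (ch : ℕ → List ℕ) (N : ℕ → Node) (x : ℕ) : Prop where
  base_lt : (N x).base < K
  cls : ∀ k, Classified N (ch x) k (collect N (ch x))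
  spec : ((N x).kind = 1 ∧ (collect N (ch x)).st (N x).base = 0) ∨ (0 < (N x).base ∧
    (((N x).kind = 2 ∧
      ((collect N (ch x)).st (N x).base = 1 ∨ (collect N (ch x)).st (N x).base = 2)) ∨
    ((N x).kind = 4 ∧ (collect N (ch x)).st (N x).base = 3) ∨
    ((N x).kind = 5 ∧ (collect N (ch x)).st (N x).base = 4)))
  above : ∀ k, (N x).base < k → (collect N (ch x)).st k = 0 ∨ (collect N (ch x)).st k = 5

theorem Vis.of_child (h : Vis n p m u z) (hu : 0 < u ∧ u < n ∧ p u = x) (hm : ¬ m x) :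
    Vis n p m x z := vis_iff.2 ⟨hm, h.visB_of_child hu⟩

theorem IsLabelled.sound_step (h : IsLabelled n K p ch N) (hx : x < n)
    (hs : ∀ u < n, x < u → ∀ k, Sound n p ch N u k) :
    (∀ k, Sound n p ch N x k) ∧ Local n K ch N x := by
  have hcs : ∀ u ∈ ch x, ∀ k, Sound n p ch N u k := fun u hu k =>
    hs u (h.child_lt hu).2 (h.child_lt hu).1 k
  have hcls : ∀ k, Classified N (ch x) k (collect N (ch x)) := fun k =>
    h.classified fun u hu => hcs u hu k
  have hbk := h.base_kind hx
  have hlab := h.lab_eq hx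
  have hfst := h.fst_eq hx
  generalize hA : collect N (ch x) = A at *
  have hhigh : ∀ k, K ≤ k → A.st k = 0 := by
    intro k hk
    by_contra h0
    obtain ⟨u, hu, hl⟩ := (hcls k).exists_child h0
    have := h.sound_level_lt (h.child_lt hu).2 (hcs u hu k) hl
    omega
  have hcert : ∀ k, (scan A.st k).1 = k → Cert (Adj p) k {z | VisB n p (Mk N k) x z} := fun k hk =>
    h.cert_scan hs k (by rw [hA]; exact hk)
  have hbK : (N x).base < K := by
    refine lt_of_le_of_ne (by have := scan_base_le A.st K; rwa [hbk] at this) fun hb => ?_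
    have := h.level_lt (hcert K (by rw [hbk, hb])) fun z hz => VisB.lt hz hx
    omega
  have hspec := scan_spec (fun k => (hcls k).st_le) K hbk
  have habove : ∀ k, (N x).base < k → A.st k = 0 ∨ A.st k = 5 := by
    intro k hk
    by_cases hkK : k < K
    · exact scan_above hkK (by rw [hbk]; exact hk)
    · exact Or.inl (hhigh k (by omega))
  refine ⟨fun k => ?_, hbK, by rw [hA]; exact hcls, ?_, by rw [hA]; exact habove⟩
  swap
  · rw [hA]
    rcases hspec with ⟨h1, h2, -⟩ | ⟨h1, -, h2⟩
    · exact Or.inl ⟨h1, h2 hbK⟩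
    · exact Or.inr ⟨h1, h2⟩
  -- a child with a label passes its certificate on
  have hpass : (N x).base ≤ k → A.st k ≠ 0 →
      Cert (Adj p) k {z | Vis n p (Mk N (k + 1)) x z} := by
    intro hb h0
    obtain ⟨u, hu, hl⟩ := (hcls k).exists_child h0
    refine ((hcs u hu k).cert hl).mono fun z hz => ?_
    exact Vis.of_child hz ((h.mem_ch x u).1 hu) fun hm => by have := hm.2; omega
  have hnm : (N x).base ≤ k → ¬ Mk N (k + 1) x := fun hb hm => by have := hm.2; omega
  rcases lt_trichotomy k (N x).base with hkb | hkb | hkb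
  · have h0 : (N x).lab k = 0 := by rw [hlab, labOf, if_pos hkb]
    constructor <;> simp [h0]
  · have hl : (N x).lab k = (N x).kind := by rw [hlab, labOf, if_neg (by omega), if_pos hkb]
    have hf := hfst k
    rw [fstOf, if_neg (by omega), if_pos hkb] at hf
    rw [← hkb] at hspec
    have hnm' := hnm hkb.ge
    rcases hspec with ⟨h1, h2, h3⟩ | ⟨h1, h2, ⟨h3, h4⟩ | ⟨h3, h4⟩ | ⟨h3, h4⟩⟩
    · refine ⟨by simp [hl, h1], by simp [hl, h1], fun _ => hnm', fun _ => ?_, by simp [hl, h1],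
        by simp [hl, h1], by simp [hl, h1]⟩
      refine (hcert k h3).mono fun z hz => vis_iff.2 ⟨hnm', ?_⟩
      exact VisB.mono hz fun w hw => hw.mono (Nat.le_succ k)
    · have h0 : A.st k ≠ 0 := by omega
      refine ⟨by simp [hl, h3], by simp [hf, h3], fun _ => hnm', fun _ => hpass hkb.ge h0,
        fun _ => (hcls k).exists_child h0, by simp [hl, h3], by simp [hl, h3]⟩
    · have h0 : A.st k ≠ 0 := by omega
      refine ⟨by simp [hl, h3], by simp [hf, h3], fun _ => hnm', fun _ => hpass hkb.ge h0,
        by simp [hl, h3], fun _ => ?_, by simp [hl, h3]⟩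
      rcases hcls k with ⟨g, -⟩ | ⟨g, -⟩ | ⟨g, -⟩ | ⟨g, v, hv, w, hw, hvw, hlv, hlw, -⟩ | ⟨g, -⟩ | ⟨g, -⟩
      iterate 3 omega
      · exact ⟨v, hv, w, hw, hvw, hlv, hlw⟩
      · omega
      · omega
    · have h0 : A.st k ≠ 0 := by omega
      rcases hcls k with ⟨g, -⟩ | ⟨g, -⟩ | ⟨g, -⟩ | ⟨g, -⟩ | ⟨g, v, hv, hlv, hou, hfv, hsv⟩ | ⟨g, -⟩
      iterate 4 omega
      · refine ⟨by simp [hl, h3], fun _ => ?_, fun _ => hnm', fun _ => hpass hkb.ge h0,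
          by simp [hl, h3], by simp [hl, h3], fun _ => ?_⟩
        · rw [hf, if_pos h3, hfv]
          have := (hcs v hv k).fst_ne (by omega)
          simp [this]
        · exact ⟨x, .refl hnm', h3, hkb.symm, v, hv, hlv.trans h4⟩
      · omega
  · have hl : (N x).lab k = A.st k := by rw [hlab, labOf, if_neg (by omega), if_neg (by omega)]
    have hf : (N x).fst k = A.fst k := by rw [hfst, fstOf, if_neg (by omega), if_neg (by omega)]
    rcases habove k hkb with h0 | h0
    · constructor <;> simp [hl, h0]
    · have h0' : A.st k ≠ 0 := by omega
      rcases hcls k with ⟨g, -⟩ | ⟨g, -⟩ | ⟨g, -⟩ | ⟨g, -⟩ | ⟨g, v, hv, hlv, hou, hfv, hsv⟩ | ⟨g, -⟩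
      iterate 4 omega
      · refine ⟨by simp [hl, h0], fun _ => ?_, fun _ => hnm hkb.le, fun _ => hpass hkb.le h0',
          by simp [hl, h0], by simp [hl, h0], fun _ => ?_⟩
        · rw [hf, hfv]
          exact (hcs v hv k).fst_ne (by omega)
        · obtain ⟨w, hw, hw'⟩ := (hcs v hv k).five (by omega)
          exact ⟨w, hw.of_child ((h.mem_ch x v).1 hv) (hnm hkb.le), hw'⟩
      · omega

theorem IsLabelled.sound_and_local (h : IsLabelled n K p ch N) :
    ∀ x < n, (∀ k, Sound n p ch N x k) ∧ Local n K ch N x := by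
  suffices H : ∀ d x, x < n → n - x = d → (∀ k, Sound n p ch N x k) ∧ Local n K ch N x from
    fun x hx => H _ x hx rfl
  intro d
  induction d using Nat.strong_induction_on with
  | _ d ih =>
    intro x hx hd
    exact h.sound_step hx fun u hu hxu => (ih (n - u) (by omega) u hu rfl).1

theorem IsLabelled.sound (h : IsLabelled n K p ch N) (hx : x < n) (k : ℕ) : Sound n p ch N x k :=
  (h.sound_and_local x hx).1 k

theorem IsLabelled.local (h : IsLabelled n K p ch N) (hx : x < n) : Local n K ch N x :=
  (h.sound_and_local x hx).2

end

/-! ### The partial layouts have small width -/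

/-- What the partial layouts of a vertex `x` have to satisfy: they consist of the right vertices,
and they have small width.  For the labels `4` and `5` there is a hole between the two lists, and the
width has to stay small if layouts of smaller width are filled in, for label `4` together with the
parent of `x` as a side vertex. -/
structure Laid (n : ℕ) (p : ℕ → ℕ) (N : ℕ → Node) (x : ℕ) : Prop where
  cl : ∀ j, (N x).base < j ∨ Mk N j x → ((N x).cl j).Nodup ∧
    (∀ z, z ∈ (N x).cl j ↔ Vis n p (Mk N j) x z) ∧ Thin (Adj p) (j - 1) ((N x).cl j)
  path : ∀ k, (N x).lab k = 1 ∨ (N x).lab k = 2 → ((N x).fst k).Nodup ∧ ((N x).snd k).Nodup ∧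
    (∀ z, z ∈ (N x).fst k ↔ Vis n p (Mk N (k + 1)) x z) ∧
    (∀ z, z ∈ (N x).snd k ↔ Vis n p (Mk N (k + 1)) x z) ∧
    UpPath (Adj p) k x ((N x).fst k) ∧ DownPath (Adj p) k x ((N x).snd k)
  four : ∀ k, (N x).lab k = 4 → ((N x).fst k ++ (N x).snd k).Nodup ∧
    (∀ z, z ∈ (N x).fst k ++ (N x).snd k ↔ Vis n p (Mk N (k + 1)) x z) ∧
    Thin (Adj p) k ((N x).fst k ++ (N x).snd k) ∧
    (0 < x → ∀ H, Thin (Adj p) (k - 1) H → (H ++ [p x]).Nodup →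
      (∀ h ∈ H, ¬ Desc p x h ∧ ¬ Adj p x h) →
      Thin (Adj p) k ((N x).fst k ++ (H ++ [p x]) ++ (N x).snd k))
  five : ∀ k, (N x).lab k = 5 → ∃ w, Vis n p (Mk N (k + 1)) x w ∧ Mk N k w ∧
    ((N x).fst k ++ (N x).snd k).Nodup ∧
    (∀ z, z ∈ (N x).fst k ++ (N x).snd k ↔ Vis n p (Mk N (k + 1)) w z) ∧
    (∀ z, Vis n p (Mk N (k + 1)) x z ↔ Vis n p (Mk N k) x z ∨ Vis n p (Mk N (k + 1)) w z) ∧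
    ∀ H, Thin (Adj p) (k - 1) H → H.Nodup → (∀ h ∈ H, ¬ Desc p w h) →
      Thin (Adj p) k ((N x).fst k ++ H ++ (N x).snd k)

section
variable {n K : ℕ} {p : ℕ → ℕ} {ch : ℕ → List ℕ} {N : ℕ → Node} {m : ℕ → Prop} {x y u v w z k : ℕ}

theorem Local.kind_ne (hl : Local n K ch N x) : (N x).kind ≠ 0 := by
  rcases hl.spec with h | ⟨-, h | h | h⟩ <;> omega

theorem Classified.lab_eq_zero {c : List ℕ} {a : Acc} (h : Classified N c k a) (h0 : a.st k = 0)
    (hu : u ∈ c) : (N u).lab k = 0 := by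
  rcases h with ⟨-, h, -⟩ | h | h | h | h | h
  · exact h u hu
  all_goals omega

theorem Classified.lists_eq_nil {c : List ℕ} {a : Acc} (h : Classified N c k a)
    (h0 : a.st k = 0 ∨ a.st k = 1) : a.fst k = [] ∧ a.snd k = [] := by
  rcases h with ⟨-, -, h⟩ | ⟨-, -, -, h⟩ | h | h | h | h
  · exact h
  · exact h
  all_goals omega

theorem Classified.exists_single {c : List ℕ} {a : Acc} (h : Classified N c k a)
    (h0 : a.st k = 4 ∨ a.st k = 5) : ∃ v ∈ c, (N v).lab k = a.st k ∧
      (∀ u ∈ c, u ≠ v → (N u).lab k = 0) ∧ a.fst k = (N v).fst k ∧ a.snd k = (N v).snd k := by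
  rcases h with h | h | h | h | ⟨-, h⟩ | h
  iterate 4 omega
  · exact h
  · omega

theorem Local.lab_child_above (hl : Local n K ch N x) (hk : (N x).base < k) (hu : u ∈ ch x) :
    (N u).lab k = 0 ∨ (N u).lab k = 5 := by
  rcases hl.above k hk with h | h
  · exact Or.inl ((hl.cls k).lab_eq_zero h hu)
  · obtain ⟨v, hv, hv', ho, -⟩ := (hl.cls k).exists_single (Or.inr h)
    by_cases huv : u = v
    · subst huv; right; omega
    · exact Or.inl (ho u hu huv)

theorem IsLabelled.lab_base (h : IsLabelled n K p ch N) (hx : x < n) :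
    (N x).lab (N x).base = (N x).kind := by simp [h.lab_eq hx, labOf]

theorem IsLabelled.lab_below (h : IsLabelled n K p ch N) (hx : x < n) (hk : k < (N x).base) :
    (N x).lab k = 0 := by simp [h.lab_eq hx, labOf, hk]

theorem IsLabelled.lab_above (h : IsLabelled n K p ch N) (hx : x < n) (hk : (N x).base < k) :
    (N x).lab k = (collect N (ch x)).st k := by
  rw [h.lab_eq hx, labOf, if_neg (by omega), if_neg (by omega)]

/-- The labels `1`, `2` and `4` occur at the base only. -/
theorem IsLabelled.eq_base (h : IsLabelled n K p ch N) (hx : x < n) (h0 : (N x).lab k ≠ 0)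
    (h5 : (N x).lab k ≠ 5) : (N x).base = k := by
  rcases lt_trichotomy k (N x).base with hk | hk | hk
  · exact absurd (h.lab_below hx hk) h0
  · exact hk.symm
  · rw [h.lab_above hx hk] at h0 h5
    rcases (h.local hx).above k hk with g | g <;> omega

theorem IsLabelled.lists_eq_nil (h : IsLabelled n K p ch N) (hx : x < n) (h0 : (N x).lab k = 0) :
    (N x).fst k = [] ∧ (N x).snd k = [] := by
  rw [h.fst_eq hx, h.snd_eq hx, fstOf, sndOf]
  rcases lt_trichotomy k (N x).base with hk | hk | hk
  · simp [hk]
  · rw [hk, h.lab_base hx] at h0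
    exact absurd h0 (h.local hx).kind_ne
  · rw [h.lab_above hx hk] at h0
    have := ((h.local hx).cls k).lists_eq_nil (Or.inl h0)
    rw [if_neg (by omega), if_neg (by omega), if_neg (by omega), if_neg (by omega)]
    exact this

theorem IsLabelled.cl_succ_of_lab (h : IsLabelled n K p ch N) (hx : x < n)
    (h0 : (N x).lab k = 0) : (N x).cl (k + 1) = (N x).cl k := by
  rw [h.cl_succ hx, if_neg (by omega), (h.lists_eq_nil hx h0).1, (h.lists_eq_nil hx h0).2]
  simp

theorem IsLabelled.cl_eq_nil (h : IsLabelled n K p ch N) (hx : x < n) {j : ℕ}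
    (hj : j ≤ (N x).base) : (N x).cl j = [] := by
  induction j with
  | zero => exact h.cl_zero hx
  | succ j ih => rw [h.cl_succ_of_lab hx (h.lab_below hx hj), ih (by omega)]

/-- A child without a label at level `k` does not reach this level. -/
theorem IsLabelled.quiet_of (h : IsLabelled n K p ch N) (hx : x < n) (hu : u ∈ ch x)
    (h0 : (N u).lab k = 0) (hk : (N x).base ≤ k) : (N u).base < k ∨ Mk N (k + 1) u := by
  have hun := (h.child_lt hu).2
  rcases lt_trichotomy k (N u).base with hb | hb | hb
  · by_cases h5 : (N u).kind = 5
    · exact Or.inr ⟨h5, hb⟩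
    · have := (h.local hx).lab_child_above (hk.trans_lt hb) hu
      rw [h.lab_base hun] at this
      have := (h.local hun).kind_ne
      omega
  · rw [hb, h.lab_base hun] at h0
    exact absurd h0 (h.local hun).kind_ne
  · exact Or.inl hb

theorem Laid.cl_of_quiet (hL : Laid n p N u) (h : IsLabelled n K p ch N) (hu : u < n)
    (h0 : (N u).lab k = 0) (hq : (N u).base < k ∨ Mk N (k + 1) u) :
    (N u).cl (k + 1) = (N u).cl k ∧ ((N u).cl k).Nodup ∧
    (∀ z, z ∈ (N u).cl k ↔ Vis n p (Mk N (k + 1)) u z) ∧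
    (∀ z, Vis n p (Mk N k) u z ↔ Vis n p (Mk N (k + 1)) u z) ∧
    Thin (Adj p) (k - 1) ((N u).cl k) := by
  have h1 := h.cl_succ_of_lab hu h0
  obtain ⟨a, b, c⟩ := hL.cl k (hq.imp id fun hm => hm.mono (Nat.le_succ k))
  obtain ⟨a', b', -⟩ := hL.cl (k + 1) (hq.imp (fun hb => by omega) id)
  rw [h1] at b'
  exact ⟨h1, a, b', fun z => by rw [← b, b'], c⟩

/-- Concatenation of layouts within the subtrees of siblings. -/
theorem flatMap_siblings (hp : ∀ u, 0 < u → p u < u) {c : List ℕ} {f : ℕ → List ℕ} {j : ℕ}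
    (hc : c.Nodup) (hcx : ∀ u ∈ c, 0 < u ∧ p u = x)
    (hf : ∀ u ∈ c, (f u).Nodup ∧ (∀ z ∈ f u, Desc p u z) ∧ Thin (Adj p) j (f u)) :
    (c.flatMap f).Nodup ∧ Thin (Adj p) j (c.flatMap f) := by
  induction c with
  | nil => exact ⟨List.nodup_nil, thin_nil⟩
  | cons v c ih =>
    rw [List.nodup_cons] at hc
    obtain ⟨h1, h2⟩ := ih hc.2 (fun u hu => hcx u (by simp [hu])) fun u hu => hf u (by simp [hu])
    obtain ⟨f1, f2, f3⟩ := hf v (by simp)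
    have hv := hcx v (by simp)
    have hout : ∀ b ∈ c.flatMap f, ¬ Desc p v b ∧ b ≠ x := by
      intro b hb
      obtain ⟨u, hu, hbu⟩ := List.mem_flatMap.1 hb
      have hu' := hcx u (by simp [hu])
      have hd := (hf u (by simp [hu])).2.1 b hbu
      refine ⟨fun hdv => hc.1 ?_, ?_⟩
      · rw [hdv.sibling_eq hp hv.1 hu'.1 (hv.2.trans hu'.2.symm) hd]; exact hu
      · have := hd.le hp
        have := hp u hu'.1
        omega
    rw [List.flatMap_cons]
    refine ⟨List.nodup_append.2 ⟨f1, h1, fun a ha b hb hab => (hout b hb).1 (hab ▸ f2 a ha)⟩,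
      f3.append h2 fun a ha b hb hab => ?_⟩
    have := hab.leave (f2 a ha) (hout b hb).1
    exact (hout b hb).2 (this.2.2.symm.trans hv.2)

theorem nodup_append_append_iff {l₁ l₂ l₃ : List ℕ} :
    (l₁ ++ l₂ ++ l₃).Nodup ↔ (l₂ ++ (l₁ ++ l₃)).Nodup := by
  refine List.Perm.nodup_iff ?_
  rw [← List.append_assoc]
  exact List.perm_append_comm.append_right _

/-- The layout of a child `v` as a side vertex of a path that runs through its parent. -/
theorem IsLabelled.side_block (h : IsLabelled n K p ch N) (hx : x < n)
    (hL : ∀ u < n, x < u → Laid n p N u) (hk : (N x).base = k) (hv : v ∈ ch x)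
    (hlv : (N v).lab k = 0 ∨ ((N v).lab k = 1 ∧ 1 ≤ k)) :
    ((N v).side k).Nodup ∧ (∀ z, z ∈ (N v).side k ↔ Vis n p (Mk N (k + 1)) v z) ∧
    ((N v).side k = [] ∨ (1 ≤ k ∧ ∃ H, (N v).side k = H ++ [v] ∧ Thin (Adj p) (k - 1) H ∧
      ∀ a ∈ H, Desc p v a ∧ a ≠ v)) := by
  obtain ⟨hxv, hvn⟩ := h.child_lt hv
  have hloc := h.local hvn
  have hp := h.parent_lt
  rw [h.side_eq hvn, sideOf]
  by_cases hm : Mk N (k + 1) v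
  · rw [if_pos ⟨hm.1, hm.2⟩]
    exact ⟨List.nodup_nil, fun z => ⟨fun hz => by simp at hz, fun hz => absurd hm hz.not_left⟩,
      Or.inl rfl⟩
  · rw [if_neg fun hc => hm ⟨hc.1, hc.2⟩]
    have hbv : (N v).base ≤ k := by
      by_contra hb
      push Not at hb
      have h1 := (h.local hx).lab_child_above (hk.trans_lt hb) hv
      rw [h.lab_base hvn] at h1
      rcases h1 with h1 | h1
      · exact hloc.kind_ne h1
      · exact hm ⟨h1, hb⟩
    have hst : (collect N (ch v)).st k = 0 := by
      rcases hbv.lt_or_eq with hb | hb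
      · have := hloc.above k hb
        rw [← h.lab_above hvn hb] at this ⊢
        omega
      · have h1 := h.lab_base hvn
        rw [hb] at h1
        have := hloc.kind_ne
        rcases hloc.spec with ⟨-, g⟩ | ⟨-, g⟩
        · rwa [hb] at g
        · omega
    have hk1 : 1 ≤ k := by
      rcases hlv with h0 | h0
      · by_contra hk0
        have hb : (N v).base = k := by omega
        rw [← hb, h.lab_base hvn] at h0
        exact hloc.kind_ne h0
      · exact h0.2
    have hq : ∀ u ∈ ch v, _ := fun u hu =>
      (hL u (h.child_lt hu).2 (hxv.trans (h.child_lt hu).1)).cl_of_quiet h (h.child_lt hu).2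
        ((hloc.cls k).lab_eq_zero hst hu) (h.quiet_of hvn hu ((hloc.cls k).lab_eq_zero hst hu) hbv)
    have hfm := flatMap_siblings (x := v) (f := fun u => (N u).cl (k + 1)) (j := k - 1) hp
      (h.nodup v) (fun u hu => ⟨((h.mem_ch v u).1 hu).1, ((h.mem_ch v u).1 hu).2.2⟩) fun u hu => by
        simp only [(hq u hu).1]
        exact ⟨(hq u hu).2.1, fun z hz => (((hq u hu).2.2.1 z).1 hz).desc, (hq u hu).2.2.2.2⟩
    have hmem : ∀ a ∈ (ch v).flatMap (fun u => (N u).cl (k + 1)), ∃ u ∈ ch v,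
        Vis n p (Mk N (k + 1)) u a := by
      intro a ha
      obtain ⟨u, hu, hau⟩ := List.mem_flatMap.1 ha
      rw [(hq u hu).1] at hau
      exact ⟨u, hu, ((hq u hu).2.2.1 a).1 hau⟩
    have hne : ∀ a ∈ (ch v).flatMap (fun u => (N u).cl (k + 1)), Desc p v a ∧ a ≠ v := by
      intro a ha
      obtain ⟨u, hu, hau⟩ := hmem a ha
      have h1 := hau.desc.le hp
      have h2 := (h.child_lt hu).1
      have h3 := (h.mem_ch v u).1 hu
      exact ⟨h3.2.2 ▸ hau.desc.of_parent h3.1, by omega⟩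
    rw [collect_kids]
    refine ⟨?_, fun z => ?_, Or.inr ⟨hk1, _, rfl, hfm.2, hne⟩⟩
    · refine List.nodup_append.2 ⟨hfm.1, by simp, fun a ha b hb => ?_⟩
      rw [List.mem_singleton] at hb
      exact hb ▸ (hne a ha).2
    · rw [List.mem_append, List.mem_singleton, vis_iff, VisB]
      constructor
      · rintro (hz | rfl)
        · obtain ⟨u, hu, hz⟩ := hmem z hz
          exact ⟨hm, Or.inr ⟨u, (h.mem_ch v u).1 hu, hz⟩⟩
        · exact ⟨hm, Or.inl rfl⟩
      · rintro ⟨-, rfl | ⟨u, hu, hz⟩⟩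
        · exact Or.inr rfl
        · have hu' := (h.mem_ch v u).2 hu
          refine Or.inl (List.mem_flatMap.2 ⟨u, hu', ?_⟩)
          rw [(hq u hu').1]
          exact ((hq u hu').2.2.1 z).2 hz

/-- The segment of a path of level `k` at `x`. -/
theorem IsLabelled.segment (h : IsLabelled n K p ch N) (hx : x < n)
    (hL : ∀ u < n, x < u → Laid n p N u) (hk : (N x).base = k)
    (hch : ∀ v ∈ ch x, (N v).lab k = 2 ∨ (N v).lab k = 0 ∨ ((N v).lab k = 1 ∧ 1 ≤ k)) :
    (x :: (collect N (ch x)).sides k).Nodup ∧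
    (∀ z, z ∈ x :: (collect N (ch x)).sides k ↔
      z = x ∨ ∃ v ∈ ch x, (N v).lab k ≠ 2 ∧ Vis n p (Mk N (k + 1)) v z) ∧
    Seg (Adj p) k x (x :: (collect N (ch x)).sides k) := by
  have hp := h.parent_lt
  suffices H : ∀ c : List ℕ, c.Nodup → (∀ v ∈ c, v ∈ ch x) →
      (x :: (collect N c).sides k).Nodup ∧
      (∀ z, z ∈ x :: (collect N c).sides k ↔
        z = x ∨ ∃ v ∈ c, (N v).lab k ≠ 2 ∧ Vis n p (Mk N (k + 1)) v z) ∧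
      Seg (Adj p) k x (x :: (collect N c).sides k) from H _ (h.nodup x) fun v hv => hv
  intro c
  simp only [collect_sides]
  induction c using List.reverseRecOn with
  | nil => exact fun _ _ => ⟨by simp, by simp, seg_singleton⟩
  | append_singleton c v ih =>
    intro hc hcx
    obtain ⟨hc1, -, hc2⟩ := List.nodup_append.1 hc
    have hvc : v ∉ c := fun hv => hc2 v hv v (by simp) rfl
    obtain ⟨i1, i2, i3⟩ := ih hc1 fun v hv => hcx v (by simp [hv])
    have hv : v ∈ ch x := hcx v (by simp)
    have hv' := (h.mem_ch x v).1 hv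
    simp only [List.flatMap_append, List.flatMap_cons, List.flatMap_nil, List.append_nil]
    by_cases h2 : (N v).lab k = 2
    · rw [if_pos h2, List.append_nil]
      refine ⟨i1, fun z => (i2 z).trans ?_, i3⟩
      refine or_congr Iff.rfl ⟨fun ⟨u, hu, h⟩ => ⟨u, by simp [hu], h⟩, fun ⟨u, hu, h⟩ => ?_⟩
      rcases List.mem_append.1 hu with hu | hu
      · exact ⟨u, hu, h⟩
      · rw [List.mem_singleton] at hu
        subst hu
        exact absurd h2 h.1
    · rw [if_neg h2]
      obtain ⟨s1, s2, s3⟩ := h.side_block hx hL hk hv ((hch v hv).resolve_left h2)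
      rw [← List.cons_append]
      have hout : ∀ a ∈ x :: (c.flatMap fun u => if (N u).lab k = 2 then [] else (N u).side k),
          ¬ Desc p v a := by
        intro a ha hd
        rcases (i2 a).1 ha with rfl | ⟨u, hu, -, hau⟩
        · have := hd.le hp
          have := hp v hv'.1
          omega
        · have hu' := (h.mem_ch x u).1 (hcx u (by simp [hu]))
          exact hvc ((hd.sibling_eq hp hv'.1 hu'.1 (hv'.2.2.trans hu'.2.2.symm) hau.desc) ▸ hu)
      refine ⟨List.nodup_append.2 ⟨i1, s1, fun a ha b hb hab => ?_⟩, fun z => ?_, ?_⟩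
      · exact hout a ha (hab ▸ ((s2 b).1 hb).desc)
      · rw [List.mem_append, i2, s2, or_assoc]
        refine or_congr Iff.rfl ⟨?_, ?_⟩
        · rintro (⟨u, hu, h⟩ | h)
          · exact ⟨u, by simp [hu], h⟩
          · exact ⟨v, by simp, h2, h⟩
        · rintro ⟨u, hu, h⟩
          rcases List.mem_append.1 hu with hu | hu
          · exact Or.inl ⟨u, hu, h⟩
          · rw [List.mem_singleton] at hu
            subst hu
            exact Or.inr h.2
      · rcases s3 with s3 | ⟨hk1, H, s3, s4, s5⟩
        · rw [s3, List.append_nil]; exact i3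
        · rw [s3]
          refine i3.append_block hk1 s4 (Or.inr ⟨hv'.1, hv'.2.2⟩) (fun a ha b hb hab => ?_)
            fun a ha hab => ?_
          · exact (s5 b hb).2 (hab.symm.leave (s5 b hb).1 (hout a ha)).1
          · exact (hab.symm.leave .refl (hout a ha)).2.2.symm.trans hv'.2.2

end

section
variable {n K : ℕ} {p : ℕ → ℕ} {ch : ℕ → List ℕ} {N : ℕ → Node} {m : ℕ → Prop} {x y u v w z k : ℕ}

theorem Local.base_pos (hl : Local n K ch N x) (h : (N x).kind ≠ 1) : 1 ≤ (N x).base := by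
  rcases hl.spec with g | g <;> omega

/-- The labels of the children at the base level of `x`, unless `x` is the parent of the topmost
vertex of a path. -/
theorem IsLabelled.children_labels (h : IsLabelled n K p ch N) (hx : x < n)
    (h5 : (N x).kind ≠ 5) (hv : v ∈ ch x) : (N v).lab (N x).base = 2 ∨ (N v).lab (N x).base = 0 ∨
      ((N v).lab (N x).base = 1 ∧ 1 ≤ (N x).base) := by
  have hl := h.local hx
  have hpos := hl.base_pos
  generalize hk : (N x).base = k at *
  have hs := hl.spec
  rw [hk] at hs
  rcases hl.cls k with ⟨g, g1, -⟩ | ⟨g, g1, -⟩ | ⟨g, a, -, g1, g2, -⟩ |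
    ⟨g, a, -, b, -, -, g1, g2, g3, -⟩ | ⟨g, -⟩ | ⟨g, -⟩
  · exact Or.inr (Or.inl (g1 v hv))
  · have := g1 v hv; omega
  · by_cases hva : v = a
    · subst hva; exact Or.inl g1
    · have := g2 v hv hva; omega
  · by_cases hva : v = a
    · subst hva; exact Or.inl g1
    · by_cases hvb : v = b
      · subst hvb; exact Or.inl g2
      · have := g3 v hv hva hvb; omega
  · omega
  · omega

theorem IsLabelled.vis_iff_children (h : IsLabelled n K p ch N) :
    Vis n p m x z ↔ ¬ m x ∧ (z = x ∨ ∃ u ∈ ch x, Vis n p m u z) := by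
  simp only [vis_iff (x := x), VisB, h.mem_ch]

/-- With label `1` or `2`, the path starts at `x` and continues in the child with label `2`, if any. -/
theorem IsLabelled.laid_path (h : IsLabelled n K p ch N) (hx : x < n)
    (hL : ∀ u < n, x < u → Laid n p N u) (hl : (N x).lab k = 1 ∨ (N x).lab k = 2) :
    ((N x).fst k).Nodup ∧ ((N x).snd k).Nodup ∧
    (∀ z, z ∈ (N x).fst k ↔ Vis n p (Mk N (k + 1)) x z) ∧
    (∀ z, z ∈ (N x).snd k ↔ Vis n p (Mk N (k + 1)) x z) ∧
    UpPath (Adj p) k x ((N x).fst k) ∧ DownPath (Adj p) k x ((N x).snd k) := by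
  have hp := h.parent_lt
  have hk := h.eq_base hx (k := k) (by omega) (by omega)
  have hkind : (N x).kind = 1 ∨ (N x).kind = 2 := by rw [← hk, h.lab_base hx] at hl; exact hl
  have hloc := h.local hx
  have hch := fun v (hv : v ∈ ch x) => h.children_labels hx (v := v) (by omega) hv
  rw [hk] at hch
  obtain ⟨s1, s2, s3⟩ := h.segment hx hL hk hch
  have hnm : ¬ Mk N (k + 1) x := fun hm => by have := hm.2; omega
  have hf := h.fst_eq hx k
  have hs := h.snd_eq hx k
  rw [fstOf, if_neg (by omega), if_pos hk.symm, if_neg (by omega)] at hf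
  rw [sndOf, if_neg (by omega), if_pos hk.symm, if_neg (by omega), if_neg (by omega)] at hs
  have hspec := hloc.spec
  rw [hk] at hspec
  have hone : ((collect N (ch x)).st k = 0 ∨ (collect N (ch x)).st k = 1) →
      (∀ v ∈ ch x, (N v).lab k ≠ 2) → ((N x).fst k).Nodup ∧ ((N x).snd k).Nodup ∧
      (∀ z, z ∈ (N x).fst k ↔ Vis n p (Mk N (k + 1)) x z) ∧
      (∀ z, z ∈ (N x).snd k ↔ Vis n p (Mk N (k + 1)) x z) ∧
      UpPath (Adj p) k x ((N x).fst k) ∧ DownPath (Adj p) k x ((N x).snd k) := by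
    intro hst hno
    obtain ⟨n1, n2⟩ := (hloc.cls k).lists_eq_nil hst
    rw [n1, List.nil_append] at hf
    rw [n2, List.append_nil] at hs
    have hmem : ∀ z, z ∈ x :: (collect N (ch x)).sides k ↔ Vis n p (Mk N (k + 1)) x z := by
      intro z
      rw [s2, h.vis_iff_children]
      refine ⟨fun hz => ⟨hnm, hz.imp id fun ⟨v, hv, h⟩ => ⟨v, hv, h.2⟩⟩, fun hz => ?_⟩
      exact hz.2.imp id fun ⟨v, hv, h⟩ => ⟨v, hv, hno v hv, h⟩
    rw [hf, hs]
    exact ⟨s1, s1, hmem, hmem, s3.upPath, s3.downPath⟩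
  rcases hloc.cls k with ⟨g, g1, -⟩ | ⟨g, g1, -⟩ | ⟨g, v, hv, hv2, g1, gf, gs⟩ | ⟨g, -⟩ | ⟨g, -⟩ | ⟨g, -⟩
  · exact hone (Or.inl g) fun v hv => by rw [g1 v hv]; omega
  · exact hone (Or.inr g) fun v hv => by have := g1 v hv; omega
  · have hk1 : 1 ≤ k := by omega
    have hv' := (h.mem_ch x v).1 hv
    obtain ⟨p1, p2, p3, p4, p5, p6⟩ := (hL v hv'.2.1 (h.child_lt hv).1).path k (Or.inr hv2)
    rw [gf] at hf
    rw [gs] at hs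
    have hxv : ¬ Desc p v x := fun hd => by
      have := hd.le hp
      have := (h.child_lt hv).1
      omega
    have hout : ∀ a ∈ x :: (collect N (ch x)).sides k, ¬ Desc p v a := by
      intro a ha hd
      rcases (s2 a).1 ha with rfl | ⟨u, hu, hu2, hau⟩
      · exact hxv hd
      · have hu' := (h.mem_ch x u).1 hu
        have := hd.sibling_eq hp hv'.1 hu'.1 (hv'.2.2.trans hu'.2.2.symm) hau.desc
        exact hu2 (this ▸ hv2)
    have hmem : ∀ z, (Vis n p (Mk N (k + 1)) v z ∨ z ∈ x :: (collect N (ch x)).sides k) ↔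
        Vis n p (Mk N (k + 1)) x z := by
      intro z
      rw [s2, h.vis_iff_children (x := x)]
      constructor
      · rintro (hz | hz | ⟨u, hu, -, hz⟩)
        · exact ⟨hnm, Or.inr ⟨v, hv, hz⟩⟩
        · exact ⟨hnm, Or.inl hz⟩
        · exact ⟨hnm, Or.inr ⟨u, hu, hz⟩⟩
      · rintro ⟨-, hz | ⟨u, hu, hz⟩⟩
        · exact Or.inr (Or.inl hz)
        · by_cases huv : u = v
          · subst huv; exact Or.inl hz
          · exact Or.inr (Or.inr ⟨u, hu, by have := g1 u hu huv; omega, hz⟩)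
    have hadj : ∀ a, Vis n p (Mk N (k + 1)) v a → ∀ b ∈ x :: (collect N (ch x)).sides k,
        Adj p a b → a = v ∧ b = x := by
      intro a ha b hb hab
      have := hab.leave ha.desc (hout b hb)
      exact ⟨this.1, this.2.2.symm.trans hv'.2.2⟩
    rw [hf, hs]
    refine ⟨List.nodup_append.2 ⟨p1, s1, fun a ha b hb hab => ?_⟩,
      List.nodup_append.2 ⟨s1, p2, fun a ha b hb hab => ?_⟩, fun z => ?_, fun z => ?_,
      p5.append_seg s3 hk1 s1 p1 fun a ha => hadj a ((p3 a).1 ha),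
      s3.append_downPath p6 hk1 p2 fun a ha b hb hab => ?_⟩
    · exact hout b hb (hab ▸ ((p3 a).1 ha).desc)
    · exact hout a ha (hab ▸ ((p4 b).1 hb).desc)
    · rw [List.mem_append, p3, hmem]
    · rw [List.mem_append, p4, or_comm, hmem]
    · exact (hadj b ((p4 b).1 hb) a ha hab.symm).symm
  all_goals omega

/-- With label `4`, the path comes up from one child with label `2`, passes through `x`, and goes down
to the other one. -/
theorem IsLabelled.laid_four (h : IsLabelled n K p ch N) (hx : x < n)
    (hL : ∀ u < n, x < u → Laid n p N u) (hl : (N x).lab k = 4) :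
    ((N x).fst k ++ (N x).snd k).Nodup ∧
    (∀ z, z ∈ (N x).fst k ++ (N x).snd k ↔ Vis n p (Mk N (k + 1)) x z) ∧
    Thin (Adj p) k ((N x).fst k ++ (N x).snd k) ∧
    (0 < x → ∀ H, Thin (Adj p) (k - 1) H → (H ++ [p x]).Nodup →
      (∀ h ∈ H, ¬ Desc p x h ∧ ¬ Adj p x h) →
      Thin (Adj p) k ((N x).fst k ++ (H ++ [p x]) ++ (N x).snd k)) := by
  have hp := h.parent_lt
  have hk := h.eq_base hx (k := k) (by omega) (by omega)
  have hkind : (N x).kind = 4 := by rw [← hk, h.lab_base hx] at hl; exact hl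
  have hloc := h.local hx
  have hch := fun v (hv : v ∈ ch x) => h.children_labels hx (v := v) (by omega) hv
  rw [hk] at hch
  obtain ⟨s1, s2, s3⟩ := h.segment hx hL hk hch
  have hnm : ¬ Mk N (k + 1) x := fun hm => by have := hm.2; omega
  have hf := h.fst_eq hx k
  have hs := h.snd_eq hx k
  rw [fstOf, if_neg (by omega), if_pos hk.symm, if_neg (by omega)] at hf
  rw [sndOf, if_neg (by omega), if_pos hk.symm, if_neg (by omega), if_pos hkind] at hs
  have hspec := hloc.spec
  rw [hk] at hspec
  have hk1 : 1 ≤ k := by omega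
  generalize x :: (collect N (ch x)).sides k = s at *
  rcases hloc.cls k with ⟨g, -⟩ | ⟨g, -⟩ | ⟨g, -⟩ |
    ⟨g, v, hv, w, hw, hvw, hv2, hw2, g1, gf, gs⟩ | ⟨g, -⟩ | ⟨g, -⟩
  iterate 3 omega
  · have hv' := (h.mem_ch x v).1 hv
    have hw' := (h.mem_ch x w).1 hw
    obtain ⟨p1, -, p3, -, p5, -⟩ := (hL v hv'.2.1 (h.child_lt hv).1).path k (Or.inr hv2)
    obtain ⟨-, q2, -, q4, -, q6⟩ := (hL w hw'.2.1 (h.child_lt hw).1).path k (Or.inr hw2)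
    rw [gf] at hf
    rw [gs] at hs
    have hxd : ∀ u ∈ ch x, ¬ Desc p u x := fun u hu hd => by
      have := hd.le hp
      have := (h.child_lt hu).1
      omega
    have hsib : ∀ u u' a, u ∈ ch x → u' ∈ ch x → u ≠ u' → Desc p u a → ¬ Desc p u' a := by
      intro u u' a hu hu' hne h1 h2
      have hu := (h.mem_ch x u).1 hu
      have hu' := (h.mem_ch x u').1 hu'
      exact hne (h1.sibling_eq hp hu.1 hu'.1 (hu.2.2.trans hu'.2.2.symm) h2)
    have hout : ∀ u ∈ ch x, (N u).lab k = 2 → ∀ a ∈ s, ¬ Desc p u a := by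
      intro u hu hu2 a ha hd
      rcases (s2 a).1 ha with rfl | ⟨u', hu', hu2', hau⟩
      · exact hxd u hu hd
      · exact hsib u u' a hu hu' (fun he => hu2' (he ▸ hu2)) hd hau.desc
    have hsx : ∀ a ∈ s, Desc p x a := by
      intro a ha
      rcases (s2 a).1 ha with rfl | ⟨u, hu, -, hau⟩
      · exact .refl
      · have hu' := (h.mem_ch x u).1 hu
        exact hu'.2.2 ▸ hau.desc.of_parent hu'.1
    have hleave : ∀ u ∈ ch x, ∀ a b, Vis n p (Mk N (k + 1)) u a → ¬ Desc p u b → Adj p a b →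
        a = u ∧ b = x := by
      intro u hu a b ha hb hab
      have := hab.leave ha.desc hb
      exact ⟨this.1, this.2.2.symm.trans ((h.mem_ch x u).1 hu).2.2⟩
    rw [hf, hs]
    -- any segment at `x` fits between the two halves of the path
    have key : ∀ t : List ℕ, Seg (Adj p) k x t → t.Nodup →
        (∀ a ∈ t, ¬ Desc p v a ∧ ¬ Desc p w a) →
        Thin (Adj p) k ((N v).fst k ++ t ++ (N w).snd k) := by
      intro t ht htd htn
      refine (p5.append_seg ht hk1 htd p1 fun a ha b hb hab =>
        hleave v hv a b ((p3 a).1 ha) (htn b hb).1 hab).thin_append q6 hk1 ?_ q2 ?_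
      · refine List.nodup_append.2 ⟨p1, htd, fun a ha b hb hab => ?_⟩
        exact (htn b hb).1 (hab ▸ ((p3 a).1 ha).desc)
      · intro a ha b hb hab
        have hna : ¬ Desc p w a := by
          rcases List.mem_append.1 ha with ha | ha
          · exact hsib v w a hv hw hvw ((p3 a).1 ha).desc
          · exact (htn a ha).2
        exact (hleave w hw b a ((q4 b).1 hb) hna hab.symm).symm
    refine ⟨?_, fun z => ?_, ?_, fun h0 H hH hHd hHx => ?_⟩
    · refine List.nodup_append.2 ⟨List.nodup_append.2 ⟨p1, s1, fun a ha b hb hab => ?_⟩, q2,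
        fun a ha b hb hab => ?_⟩
      · exact hout v hv hv2 b hb (hab ▸ ((p3 a).1 ha).desc)
      · subst hab
        rcases List.mem_append.1 ha with ha | ha
        · exact hsib v w a hv hw hvw ((p3 a).1 ha).desc ((q4 a).1 hb).desc
        · exact hout w hw hw2 a ha ((q4 a).1 hb).desc
    · rw [List.mem_append, List.mem_append, p3, q4, s2, h.vis_iff_children (x := x)]
      constructor
      · rintro ((hz | hz | ⟨u, hu, -, hz⟩) | hz)
        · exact ⟨hnm, Or.inr ⟨v, hv, hz⟩⟩
        · exact ⟨hnm, Or.inl hz⟩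
        · exact ⟨hnm, Or.inr ⟨u, hu, hz⟩⟩
        · exact ⟨hnm, Or.inr ⟨w, hw, hz⟩⟩
      · rintro ⟨-, hz | ⟨u, hu, hz⟩⟩
        · exact Or.inl (Or.inr (Or.inl hz))
        · by_cases huv : u = v
          · subst huv; exact Or.inl (Or.inl hz)
          · by_cases huw : u = w
            · subst huw; exact Or.inr hz
            · exact Or.inl (Or.inr (Or.inr ⟨u, hu, by have := g1 u hu huv huw; omega, hz⟩))
    · exact key s s3 s1 fun a ha => ⟨hout v hv hv2 a ha, hout w hw hw2 a ha⟩
    · have hpx : ¬ Desc p x (p x) := fun hd => by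
        have := hd.le hp
        have := hp x h0
        omega
      have hxof : ∀ u ∈ ch x, ∀ a, ¬ Desc p x a → ¬ Desc p u a := fun u hu a ha hd =>
        ha (((h.mem_ch x u).1 hu).2.2 ▸ hd.of_parent ((h.mem_ch x u).1 hu).1)
      have hn : ∀ a ∈ H ++ [p x], ¬ Desc p x a := by
        intro a ha
        rcases List.mem_append.1 ha with ha | ha
        · exact (hHx a ha).1
        · rw [List.mem_singleton] at ha
          exact ha ▸ hpx
      have := key (s ++ (H ++ [p x]))
        (s3.append_block hk1 hH (Or.inl ⟨h0, rfl⟩) (fun a ha b hb hab => ?_) fun a ha hab => ?_)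
        ?_ ?_
      · simpa only [List.append_assoc] using this
      · have := hab.leave (hsx a ha) (hHx b hb).1
        exact (hHx b hb).2 (this.1 ▸ hab)
      · exact (hab.leave (hsx a ha) hpx).1
      · exact List.nodup_append.2 ⟨s1, hHd, fun a ha b hb hab => hn b hb (hab ▸ hsx a ha)⟩
      · intro a ha
        rcases List.mem_append.1 ha with ha | ha
        · exact ⟨hout v hv hv2 a ha, hout w hw hw2 a ha⟩
        · exact ⟨hxof v hv a (hn a ha), hxof w hw a (hn a ha)⟩
  all_goals omega

/-- The case that `x` is the parent of the topmost vertex `v` of a path of level `k`: then `x` is a side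
vertex in the segment of `v`, where it is preceded by the layouts of its other children and of the
part of the tree above `x`. -/
theorem IsLabelled.laid_five_base (h : IsLabelled n K p ch N) (hx : x < n)
    (hL : ∀ u < n, x < u → Laid n p N u) (hl : (N x).lab k = 5) (hk : (N x).base = k) :
    ((N x).fst k ++ (N x).snd k).Nodup ∧
    (∀ z, z ∈ (N x).fst k ++ (N x).snd k ↔ Vis n p (Mk N (k + 1)) x z) ∧
    ∀ H, Thin (Adj p) (k - 1) H → H.Nodup → (∀ h ∈ H, ¬ Desc p x h) →
      Thin (Adj p) k ((N x).fst k ++ H ++ (N x).snd k) := by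
  have hp := h.parent_lt
  have hkind : (N x).kind = 5 := by rw [← hk, h.lab_base hx] at hl; exact hl
  have hloc := h.local hx
  have hnm : ¬ Mk N (k + 1) x := fun hm => by have := hm.2; omega
  have hf := h.fst_eq hx k
  have hs := h.snd_eq hx k
  rw [fstOf, if_neg (by omega), if_pos hk.symm, if_pos hkind] at hf
  rw [sndOf, if_neg (by omega), if_pos hk.symm, if_pos hkind] at hs
  have hspec := hloc.spec
  rw [hk] at hspec
  have hst : (collect N (ch x)).st k = 4 := by omega
  obtain ⟨v, hv, hv4, hvo, gf, gs⟩ := (hloc.cls k).exists_single (Or.inl hst)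
  rw [hst] at hv4
  have hv' := (h.mem_ch x v).1 hv
  obtain ⟨v1, v2, -, v3⟩ := (hL v hv'.2.1 (h.child_lt hv).1).four k hv4
  rw [gf, collect_kids] at hf
  rw [gs] at hs
  have hbv := h.eq_base hv'.2.1 (k := k) (by omega) (by omega)
  have hvnil := h.cl_eq_nil hv'.2.1 (j := k) hbv.ge
  have hq : ∀ u ∈ ch x, u ≠ v → _ := fun u hu huv =>
    (hL u (h.child_lt hu).2 (h.child_lt hu).1).cl_of_quiet h (h.child_lt hu).2 (hvo u hu huv)
      (h.quiet_of hx hu (hvo u hu huv) hk.le)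
  have hfm := flatMap_siblings (x := x) (f := fun u => (N u).cl k) (j := k - 1) hp
    (h.nodup x) (fun u hu => ⟨((h.mem_ch x u).1 hu).1, ((h.mem_ch x u).1 hu).2.2⟩) fun u hu => by
      by_cases huv : u = v
      · subst huv
        simp only [hvnil]
        exact ⟨List.nodup_nil, by simp, thin_nil⟩
      · exact ⟨(hq u hu huv).2.1, fun z hz => (((hq u hu huv).2.2.1 z).1 hz).desc,
          (hq u hu huv).2.2.2.2⟩
  have hmem : ∀ a, a ∈ (ch x).flatMap (fun u => (N u).cl k) ↔
      ∃ u ∈ ch x, u ≠ v ∧ Vis n p (Mk N (k + 1)) u a := by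
    intro a
    rw [List.mem_flatMap]
    refine exists_congr fun u => and_congr_right fun hu => ?_
    by_cases huv : u = v
    · subst huv; simp [hvnil]
    · rw [(hq u hu huv).2.2.1]; simp [huv]
  generalize (ch x).flatMap (fun u => (N u).cl k) = kd at *
  have hkd : ∀ a ∈ kd, ¬ Desc p v a ∧ a ≠ x ∧ Desc p x a := by
    intro a ha
    obtain ⟨u, hu, huv, hau⟩ := (hmem a).1 ha
    have hu' := (h.mem_ch x u).1 hu
    refine ⟨fun hd => huv (hau.desc.sibling_eq hp hu'.1 hv'.1 (hu'.2.2.trans hv'.2.2.symm) hd), ?_,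
      hu'.2.2 ▸ hau.desc.of_parent hu'.1⟩
    have := hau.desc.le hp
    have := (h.child_lt hu).1
    omega
  have hvx : ¬ Desc p v x := fun hd => by
    have := hd.le hp
    have := (h.child_lt hv).1
    omega
  have hvis : ∀ z, z ∈ (N v).fst k ++ (N v).snd k → Desc p v z := fun z hz => ((v2 z).1 hz).desc
  rw [hf, hs]
  refine ⟨?_, fun z => ?_, fun H hH hHd hHx => ?_⟩
  · have h1 : (kd ++ [x]).Nodup := List.nodup_append.2 ⟨hfm.1, by simp, fun a ha b hb => by
      rw [List.mem_singleton] at hb; exact hb ▸ (hkd a ha).2.1⟩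
    have h2 : ((kd ++ [x]) ++ ((N v).fst k ++ (N v).snd k)).Nodup := by
      refine List.nodup_append.2 ⟨h1, v1, fun a ha b hb hab => ?_⟩
      subst hab
      rcases List.mem_append.1 ha with ha | ha
      · exact (hkd a ha).1 (hvis a hb)
      · rw [List.mem_singleton] at ha
        exact hvx (ha ▸ hvis a hb)
    rw [← nodup_append_append_iff] at h2
    simpa using h2
  · have : z ∈ (N v).fst k ++ kd ++ x :: (N v).snd k ↔
        z ∈ (N v).fst k ++ (N v).snd k ∨ z ∈ kd ∨ z = x := by
      simp only [List.mem_append, List.mem_cons]; tauto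
    rw [this, v2, hmem, h.vis_iff_children (x := x)]
    constructor
    · rintro (hz | ⟨u, hu, -, hz⟩ | hz)
      · exact ⟨hnm, Or.inr ⟨v, hv, hz⟩⟩
      · exact ⟨hnm, Or.inr ⟨u, hu, hz⟩⟩
      · exact ⟨hnm, Or.inl hz⟩
    · rintro ⟨-, hz | ⟨u, hu, hz⟩⟩
      · exact Or.inr (Or.inr hz)
      · by_cases huv : u = v
        · subst huv; exact Or.inl hz
        · exact Or.inr (Or.inl ⟨u, hu, huv, hz⟩)
  · have hxH : x ∉ H := fun hh => hHx x hh .refl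
    have hd1 : (kd ++ H).Nodup := List.nodup_append.2 ⟨hfm.1, hHd, fun a ha b hb hab =>
      hHx b hb (hab ▸ (hkd a ha).2.2)⟩
    have hall : ∀ a ∈ kd ++ H, ¬ Desc p v a ∧ a ≠ x := by
      intro a ha
      rcases List.mem_append.1 ha with ha | ha
      · exact ⟨(hkd a ha).1, (hkd a ha).2.1⟩
      · exact ⟨fun hd => hHx a ha (hv'.2.2 ▸ hd.of_parent hv'.1), fun he => hxH (he ▸ ha)⟩
    have := v3 hv'.1 (kd ++ H) (hfm.2.append hH fun a ha b hb hab => ?_) ?_ ?_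
    · simpa only [hv'.2.2, List.append_assoc, List.cons_append, List.nil_append] using this
    · exact (hkd a ha).2.1 (hab.leave (hkd a ha).2.2 (hHx b hb)).1
    · rw [hv'.2.2]
      refine List.nodup_append.2 ⟨hd1, by simp, fun a ha b hb => ?_⟩
      rw [List.mem_singleton] at hb
      exact hb ▸ (hall a ha).2
    · intro a ha
      refine ⟨(hall a ha).1, fun hab => (hall a ha).2 ?_⟩
      exact (hab.leave .refl (hall a ha).1).2.2.symm.trans hv'.2.2

/-- The layouts of `x` are those of the cases above, with the layout for lower levels filled in. -/
theorem IsLabelled.laid_step (h : IsLabelled n K p ch N) (hx : x < n)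
    (hL : ∀ u < n, x < u → Laid n p N u) : Laid n p N x := by
  have hp := h.parent_lt
  have hloc := h.local hx
  have hLc : ∀ u ∈ ch x, Laid n p N u := fun u hu => hL u (h.child_lt hu).2 (h.child_lt hu).1
  have hq : ∀ u ∈ ch x, ∀ k, (N x).base ≤ k → (N u).lab k = 0 →
      ∀ z, Vis n p (Mk N k) u z ↔ Vis n p (Mk N (k + 1)) u z := fun u hu k hk h0 =>
    ((hLc u hu).cl_of_quiet h (h.child_lt hu).2 h0 (h.quiet_of hx hu h0 hk)).2.2.2.1
  have hpath : ∀ k, _ := fun k => h.laid_path hx hL (k := k)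
  have hfour : ∀ k, _ := fun k => h.laid_four hx hL (k := k)
  have hfive : ∀ k, (N x).lab k = 5 → ∃ w, Vis n p (Mk N (k + 1)) x w ∧ Mk N k w ∧
      ((N x).fst k ++ (N x).snd k).Nodup ∧
      (∀ z, z ∈ (N x).fst k ++ (N x).snd k ↔ Vis n p (Mk N (k + 1)) w z) ∧
      (∀ z, Vis n p (Mk N (k + 1)) x z ↔ Vis n p (Mk N k) x z ∨ Vis n p (Mk N (k + 1)) w z) ∧
      ∀ H, Thin (Adj p) (k - 1) H → H.Nodup → (∀ h ∈ H, ¬ Desc p w h) →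
        Thin (Adj p) k ((N x).fst k ++ H ++ (N x).snd k) := by
    intro k hl
    have hnm := (h.sound hx k).not_mk (by omega)
    rcases lt_trichotomy k (N x).base with hk | hk | hk
    · rw [h.lab_below hx hk] at hl; omega
    · obtain ⟨a, b, c⟩ := h.laid_five_base hx hL hl hk.symm
      have hkind : (N x).kind = 5 := by rw [hk, h.lab_base hx] at hl; exact hl
      refine ⟨x, .refl hnm, ⟨hkind, hk.le⟩, a, b, fun z => ⟨Or.inr, ?_⟩, c⟩
      rintro (hz | hz)
      · exact hz.mono fun w hw => hw.mono (Nat.le_succ k)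
      · exact hz
    · have hst := h.lab_above hx hk
      obtain ⟨v, hv, hv5, hvo, gf, gs⟩ := (hloc.cls k).exists_single (Or.inr (by omega))
      obtain ⟨w, w1, w2, w3, w4, w5, w6⟩ := (hLc v hv).five k (by omega)
      have hv' := (h.mem_ch x v).1 hv
      have hf := h.fst_eq hx k
      have hs := h.snd_eq hx k
      rw [fstOf, if_neg (by omega), if_neg (by omega), gf] at hf
      rw [sndOf, if_neg (by omega), if_neg (by omega), gs] at hs
      have hnm' : ¬ Mk N k x := fun hm => by have := hm.2; omega
      rw [hf, hs]
      refine ⟨w, w1.of_child hv' hnm, w2, w3, w4, fun z => ?_, w6⟩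
      rw [h.vis_iff_children (x := x), h.vis_iff_children (x := x)]
      constructor
      · rintro ⟨-, hz | ⟨u, hu, hz⟩⟩
        · exact Or.inl ⟨hnm', Or.inl hz⟩
        · by_cases huv : u = v
          · subst huv
            exact ((w5 z).1 hz).imp (fun hz => ⟨hnm', Or.inr ⟨u, hu, hz⟩⟩) id
          · exact Or.inl ⟨hnm', Or.inr ⟨u, hu, (hq u hu k hk.le (hvo u hu huv) z).2 hz⟩⟩
      · rintro (⟨-, hz | ⟨u, hu, hz⟩⟩ | hz)
        · exact ⟨hnm, Or.inl hz⟩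
        · exact ⟨hnm, Or.inr ⟨u, hu, hz.mono fun w hw => hw.mono (Nat.le_succ k)⟩⟩
        · exact ⟨hnm, Or.inr ⟨v, hv, w1.trans hz⟩⟩
  refine ⟨fun j => ?_, hpath, hfour, hfive⟩
  induction j with
  | zero =>
    intro hj
    rcases hj with hj | hj
    · omega
    · rw [h.cl_zero hx]
      exact ⟨List.nodup_nil, fun z => ⟨by simp, fun hz => absurd hj hz.not_left⟩, thin_nil⟩
  | succ k ih =>
    intro hj
    by_cases hm : Mk N (k + 1) x
    · rw [h.cl_eq_nil hx hm.2]
      exact ⟨List.nodup_nil, fun z => ⟨by simp, fun hz => absurd hm hz.not_left⟩, thin_nil⟩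
    have hbk : (N x).base ≤ k := by have := hj.resolve_right hm; omega
    rw [Nat.add_sub_cancel]
    have hcl := h.cl_succ hx k
    by_cases h12 : (N x).lab k = 1 ∨ (N x).lab k = 2
    · obtain ⟨-, b, -, d, -, f⟩ := hpath k h12
      rw [hcl, if_pos h12]
      exact ⟨b, d, f.thin⟩
    rw [if_neg h12] at hcl
    by_cases h4 : (N x).lab k = 4
    · obtain ⟨a, b, c, -⟩ := hfour k h4
      have hb := h.eq_base hx (k := k) (by omega) (by omega)
      rw [h.cl_eq_nil hx hb.ge, List.append_nil] at hcl
      rw [hcl]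
      exact ⟨a, b, c⟩
    by_cases h5 : (N x).lab k = 5
    · obtain ⟨w, w1, w2, w3, w4, w5, w6⟩ := hfive k h5
      have hj' : (N x).base < k ∨ Mk N k x := by
        rcases hbk.lt_or_eq with hb | hb
        · exact Or.inl hb
        · refine Or.inr ⟨?_, hb.ge⟩
          rw [← hb, h.lab_base hx] at h5
          exact h5
      obtain ⟨i1, i2, i3⟩ := ih hj'
      have hout : ∀ a ∈ (N x).cl k, ¬ Desc p w a := fun a ha hd =>
        (((i2 a).1 ha).split hp w1.desc hd).1.not_right w2
      rw [hcl]
      refine ⟨?_, fun z => ?_, w6 _ i3 i1 hout⟩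
      · rw [nodup_append_append_iff]
        exact List.nodup_append.2 ⟨i1, w3, fun a ha b hb hab =>
          hout a ha (hab ▸ ((w4 b).1 hb).desc)⟩
      · rw [w5, ← i2, ← w4]
        simp only [List.mem_append]
        tauto
    · have h0 : (N x).lab k = 0 := by have := (h.sound hx k).lab; omega
      have hb : (N x).base < k := by
        refine lt_of_le_of_ne hbk fun hb => ?_
        rw [← hb, h.lab_base hx] at h0
        exact hloc.kind_ne h0
      rw [h.lab_above hx hb] at h0
      have hz := fun u hu => (hloc.cls k).lab_eq_zero h0 (u := u) hu
      rw [h.cl_succ_of_lab hx ((h.lab_above hx hb).trans h0)]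
      obtain ⟨i1, i2, i3⟩ := ih (Or.inl hb)
      refine ⟨i1, fun z => ?_, i3.mono (Nat.sub_le _ _)⟩
      rw [i2, h.vis_iff_children (x := x), h.vis_iff_children (x := x)]
      have hnm' : ¬ Mk N k x := fun hm => by have := hm.2; omega
      simp only [hnm', hm, not_false_eq_true, true_and]
      exact or_congr Iff.rfl (exists_congr fun u => and_congr_right fun hu => hq u hu k hb.le (hz u hu) z)

theorem IsLabelled.laid (h : IsLabelled n K p ch N) : ∀ x < n, Laid n p N x := by
  suffices H : ∀ d x, x < n → n - x = d → Laid n p N x from fun x hx => H _ x hx rfl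
  intro d
  induction d using Nat.strong_induction_on with
  | _ d ih =>
    intro x hx hd
    exact h.laid_step hx fun u hu hxu => ih (n - u) (by omega) u hu rfl

/-- The computed layout of the whole tree is optimal: for some `k`, all its cuts have induced
matchings of size at most `k` only, and there is a certificate for `k`. -/
theorem IsLabelled.optimal (h : IsLabelled n K p ch N) (hn : 0 < n) :
    ((N 0).cl K).Nodup ∧ (∀ z, z ∈ (N 0).cl K ↔ z < n) ∧
    ∃ k, Thin (Adj p) k ((N 0).cl K) ∧ Cert (Adj p) k {z | z < n} := by
  have hp := h.parent_lt
  have hloc := h.local hn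
  have hL := h.laid 0 hn
  obtain ⟨a, b, -⟩ := hL.cl K (Or.inl hloc.base_lt)
  have hvis : ∀ z, Vis n p (Mk N K) 0 z ↔ z < n := by
    intro z
    refine ⟨fun hz => hz.lt hn, ?_⟩
    have hm : ∀ w < n, ¬ Mk N K w := fun w hw hm => by
      have := hm.2
      have := (h.local hw).base_lt
      omega
    induction z using Nat.strong_induction_on with
    | _ z ih =>
      intro hz
      rcases Nat.eq_zero_or_pos z with rfl | h0
      · exact .refl (hm 0 hn)
      · exact .step h0 hz (hm z hz) (ih _ (hp z h0) ((hp z h0).trans hz))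
  refine ⟨a, fun z => (b z).trans (hvis z), ?_⟩
  -- the highest level with a label
  have htop : ∀ j, (N 0).base < j → ∃ k, (N 0).lab k ≠ 0 ∧ Thin (Adj p) k ((N 0).cl j) := by
    intro j
    induction j with
    | zero => omega
    | succ j ih =>
      intro hj
      by_cases h0 : (N 0).lab j = 0
      · rw [h.cl_succ_of_lab hn h0]
        refine ih (lt_of_le_of_ne (by omega) fun hb => ?_)
        rw [← hb, h.lab_base hn] at h0
        exact hloc.kind_ne h0
      · exact ⟨j, h0, (hL.cl (j + 1) (Or.inl hj)).2.2⟩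
  obtain ⟨k, hk, hT⟩ := htop K hloc.base_lt
  exact ⟨k, hT, ((h.sound hn k).cert hk).mono fun z hz => Vis.lt hz hn⟩

end

/-! ### Layouts of graphs -/

/-- The pairs of `M` form an induced matching of a cut of the layout `σ`, directed from the first
vertices to the remaining ones. -/
def CutIM {V : Type*} {n : ℕ} (G : SimpleGraph V) (σ : Fin n ≃ V) (i : ℕ)
    (M : Finset (V × V)) : Prop :=
  (∀ e ∈ M, G.Adj e.1 e.2 ∧ (σ.symm e.1 : ℕ) < i ∧ i ≤ (σ.symm e.2 : ℕ)) ∧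
    ∀ e ∈ M, ∀ f ∈ M, e ≠ f → ¬ G.Adj e.1 f.2

theorem layoutMim_le {V : Type*} {n : ℕ} (G : SimpleGraph V) (σ : Fin n ≃ V) {k : ℕ}
    (h : ∀ i M, CutIM G σ i M → M.card ≤ k) : layoutMim G σ ≤ k := by
  classical
  have : Finite V := Finite.of_equiv _ σ
  refine Finset.sup_le fun i _ => ?_
  refine csSup_le ⟨_, ⊥, by simp [SimpleGraph.Subgraph.IsMatching],
    by simp [SimpleGraph.Subgraph.IsInduced], rfl⟩ ?_
  rintro _ ⟨M, hM, hI, rfl⟩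
  let S : Set (V × V) := {e | M.Adj e.1 e.2 ∧ (σ.symm e.1 : ℕ) < i}
  have hS : S.Finite := Set.toFinite S
  have h1 : M.edgeSet ⊆ (fun e : V × V => s(e.1, e.2)) '' S := by
    intro e he
    induction e with
    | _ a b =>
      rw [SimpleGraph.Subgraph.mem_edgeSet] at he
      rcases (M.adj_sub he).2 with hab | hab
      · exact ⟨(a, b), ⟨he, hab.1⟩, rfl⟩
      · exact ⟨(b, a), ⟨he.symm, hab.1⟩, Sym2.eq_swap⟩
  have hright : ∀ e ∈ S, i ≤ (σ.symm e.2 : ℕ) := by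
    rintro e ⟨he, hi⟩
    rcases (M.adj_sub he).2 with hab | hab <;> omega
  refine ((Set.ncard_le_ncard h1 (hS.image _)).trans (Set.ncard_image_le hS)).trans ?_
  rw [Set.ncard_eq_toFinset_card S hS]
  refine h i _ ⟨fun e he => ?_, fun e he f hf hne hadj => ?_⟩
  · rw [Set.Finite.mem_toFinset] at he
    exact ⟨(M.adj_sub he.1).1, he.2, hright e he⟩
  · rw [Set.Finite.mem_toFinset] at he hf
    have hc : (cutGraph G σ i).Adj e.1 f.2 := ⟨hadj, Or.inl ⟨he.2, hright f hf⟩⟩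
    have h2 : M.Adj e.1 f.2 := hI (M.edge_vert he.1) (M.edge_vert hf.1.symm) hc
    have h3 : f.2 = e.2 := (hM (M.edge_vert he.1)).unique h2 he.1
    have h4 : e.1 = f.1 := (hM (M.edge_vert hf.1.symm)).unique h2.symm hf.1.symm
    exact hne (Prod.ext h4 h3.symm)

theorem CutIM.card_le {V : Type*} {n : ℕ} {G : SimpleGraph V} {σ : Fin n ≃ V} {i : ℕ}
    {M : Finset (V × V)} (h : CutIM G σ i M) : M.card ≤ layoutMim G σ := by
  classical
  have : Finite V := Finite.of_equiv _ σ
  rcases M.eq_empty_or_nonempty with rfl | ⟨e₀, he₀⟩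
  · simp
  obtain ⟨-, hl, hr⟩ := h.1 e₀ he₀
  have hi : i ∈ Finset.Ico 1 n := by
    rw [Finset.mem_Ico]
    have := (σ.symm e₀.2).2
    omega
  refine le_trans ?_ (Finset.le_sup (f := fun i => maxInducedMatching (cutGraph G σ i)) hi)
  set H := cutGraph G σ i
  let S : Set V := {v | ∃ e ∈ M, v = e.1 ∨ v = e.2}
  have hadj : ∀ e ∈ M, H.Adj e.1 e.2 := fun e he => ⟨(h.1 e he).1, Or.inl (h.1 e he).2⟩
  let A : H.Subgraph := (⊤ : H.Subgraph).induce S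
  have hA : ∀ u v, A.Adj u v ↔ u ∈ S ∧ v ∈ S ∧ H.Adj u v := by
    intro u v; simp [A]
  have hm : A.IsMatching := by
    rintro v ⟨e, he, rfl | rfl⟩
    · refine ⟨e.2, (hA _ _).2 ⟨⟨e, he, Or.inl rfl⟩, ⟨e, he, Or.inr rfl⟩, hadj e he⟩, ?_⟩
      intro w hw
      obtain ⟨-, ⟨f, hf, rfl | rfl⟩, hw⟩ := (hA _ _).1 hw
      · have h1 := (h.1 e he).2
        have h2 := (h.1 f hf).2
        rcases hw.2 with h3 | h3 <;> omega
      · by_contra hne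
        exact h.2 e he f hf (fun hef => hne (by rw [hef])) hw.1
    · refine ⟨e.1, (hA _ _).2 ⟨⟨e, he, Or.inr rfl⟩, ⟨e, he, Or.inl rfl⟩, (hadj e he).symm⟩, ?_⟩
      intro w hw
      obtain ⟨-, ⟨f, hf, rfl | rfl⟩, hw⟩ := (hA _ _).1 hw
      · by_contra hne
        exact h.2 f hf e he (fun hef => hne (by rw [hef])) hw.1.symm
      · have h1 := (h.1 e he).2
        have h2 := (h.1 f hf).2
        rcases hw.2 with h3 | h3 <;> omega
  have hI : A.IsInduced := by
    intro u hu v hv huv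
    exact (hA _ _).2 ⟨hu, hv, huv⟩
  have hcard : M.card ≤ A.edgeSet.ncard := by
    rw [← Set.ncard_coe_finset]
    refine Set.ncard_le_ncard_of_injOn (fun e : V × V => s(e.1, e.2)) ?_ ?_ (Set.toFinite _)
    · intro e he
      exact (hA _ _).2 ⟨⟨e, he, Or.inl rfl⟩, ⟨e, he, Or.inr rfl⟩, hadj e he⟩
    · intro e he f hf hef
      rcases Sym2.eq_iff.1 hef with h1 | h1
      · exact Prod.ext h1.1 h1.2
      · have h2 := (h.1 e he).2
        have h3 := (h.1 f hf).2
        rw [h1.1] at h2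
        omega
  refine hcard.trans (le_csSup ⟨(Set.univ : Set (Sym2 V)).ncard, ?_⟩ ⟨A, hm, hI, rfl⟩)
  rintro _ ⟨B, -, -, rfl⟩
  exact Set.ncard_le_ncard (Set.subset_univ _) (Set.toFinite _)

/-- Optimality of a layout, transferred to a graph whose vertices have been renumbered by `e`. -/
theorem layoutMim_eq_lmw {n : ℕ} (T : SimpleGraph (Fin n)) {p : ℕ → ℕ}
    (hp : ∀ u, 0 < u → p u < u) (e : Fin n ≃ Fin n)
    (he : ∀ i j : Fin n, T.Adj (e i) (e j) ↔ Adj p i j) {l : List ℕ} {k : ℕ}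
    (hT : Thin (Adj p) k l) (hC : Cert (Adj p) k {z | z < n})
    (σ : Fin n ≃ Fin n) (hσ : ∀ i : Fin n, l[(i : ℕ)]? = some ((e.symm (σ i) : Fin n) : ℕ)) :
    layoutMim T σ = lmw T := by
  have hlow : ∀ (m : ℕ) (τ : Fin m ≃ Fin n), k ≤ layoutMim T τ := by
    intro m τ
    let pos : ℕ → ℕ := fun z => if hz : z < n then (τ.symm (e ⟨z, hz⟩) : ℕ) else 0
    have hpos : Set.InjOn pos {z | z < n} := by
      intro a ha b hb hab
      simp only [Set.mem_ofPred_eq] at ha hb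
      simp only [pos, ha, hb, dif_pos] at hab
      have := e.injective (τ.symm.injective (Fin.ext hab))
      exact congrArg Fin.val this
    obtain ⟨i, M, hM, rfl⟩ := hC.exists_crossIM (fun a b h => h.symm) (adj_irrefl hp) pos hpos
    -- the matching in terms of vertices
    have hn : ∀ f ∈ M, f.1 < n ∧ f.2 < n := fun f hf => ⟨(hM.1 f hf).1, (hM.1 f hf).2.1⟩
    let g : {f // f ∈ M} → Fin n × Fin n :=
      fun f => (e ⟨f.1.1, (hn f.1 f.2).1⟩, e ⟨f.1.2, (hn f.1 f.2).2⟩)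
    have hg : Function.Injective g := by
      rintro ⟨f, hf⟩ ⟨f', hf'⟩ h
      simp only [g, Prod.mk.injEq, EmbeddingLike.apply_eq_iff_eq, Fin.mk.injEq] at h
      exact Subtype.ext (Prod.ext h.1 h.2)
    have hcard : (M.attach.map ⟨g, hg⟩).card = M.card := by simp
    rw [← hcard]
    refine CutIM.card_le (i := i) ⟨fun f hf => ?_, fun f hf f' hf' hne => ?_⟩
    · obtain ⟨⟨f, hfM⟩, -, rfl⟩ := Finset.mem_map.1 hf
      obtain ⟨h1, h2, h3, h4, h5⟩ := hM.1 f hfM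
      simp only [Set.mem_ofPred_eq] at h1 h2
      simp only [pos, h1, h2, dif_pos] at h3 h4
      exact ⟨(he _ _).2 h5, h3, h4⟩
    · obtain ⟨⟨f, hfM⟩, -, rfl⟩ := Finset.mem_map.1 hf
      obtain ⟨⟨f', hfM'⟩, -, rfl⟩ := Finset.mem_map.1 hf'
      intro hadj
      refine hM.2 f hfM f' hfM' (fun hff => hne ?_) ((he _ _).1 hadj)
      subst hff
      rfl
  have hup : layoutMim T σ ≤ k := by
    refine layoutMim_le T σ fun i M hM => ?_
    let g : Fin n × Fin n → ℕ × ℕ := fun f => (e.symm f.1, e.symm f.2)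
    have hg : Function.Injective g := by
      intro f f' h
      simp only [g, Prod.mk.injEq, Fin.val_inj, EmbeddingLike.apply_eq_iff_eq] at h
      exact Prod.ext h.1 h.2
    have hcard : (M.map ⟨g, hg⟩).card = M.card := by simp
    rw [← hcard]
    have hget : ∀ v : Fin n, l[(σ.symm v : ℕ)]? = some ((e.symm v : Fin n) : ℕ) := by
      intro v
      have := hσ (σ.symm v)
      simpa using this
    refine hT (l.take i) (l.drop i) (List.take_append_drop i l).symm _ ⟨?_, ?_⟩
    · intro f hf
      obtain ⟨f, hfM, rfl⟩ := Finset.mem_map.1 hf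
      obtain ⟨h1, h2, h3⟩ := hM.1 f hfM
      refine ⟨?_, ?_, ?_⟩
      · refine List.mem_of_getElem? (i := (σ.symm f.1 : ℕ)) ?_
        rw [List.getElem?_take, if_pos h2]
        exact hget f.1
      · refine List.mem_of_getElem? (i := (σ.symm f.2 : ℕ) - i) ?_
        rw [List.getElem?_drop, Nat.add_sub_cancel' h3]
        exact hget f.2
      · refine (he _ _).1 ?_
        simpa using h1
    · intro f hf f' hf' hne hadj
      obtain ⟨f, hfM, rfl⟩ := Finset.mem_map.1 hf
      obtain ⟨f', hfM', rfl⟩ := Finset.mem_map.1 hf'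
      refine hM.2 f hfM f' hfM' (fun hff => hne (by rw [hff])) ?_
      have := (he (e.symm f.1) (e.symm f'.2)).2 hadj
      simpa using this
  refine le_antisymm ?_ (Nat.sInf_le ⟨n, σ, rfl⟩)
  refine hup.trans (le_csInf ⟨_, n, σ, rfl⟩ ?_)
  rintro _ ⟨m, τ, rfl⟩
  exact hlow m τ

/-! ### Reasoning about programs -/

open WordRAM

/-- The program halts within `T` steps, and then the memory satisfies `Q`. -/
def Runs (w : ℕ) (P : Prog) (s : Store) (T : ℕ) (Q : Store → Prop) : Prop :=
  ∃ k s', Exec w P s k s' ∧ k ≤ T ∧ Q s'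

/-- A bound on the number of steps of a program without loops; both branches of a test are counted.
The value for a loop is immaterial. -/
def size : Prog → ℕ
  | .skip => 1
  | .assign _ e => e.cost + 1
  | .write _ i e => i.cost + e.cost + 1
  | .seq p q => size p + size q
  | .ite b p q => b.cost + 1 + (size p + size q)
  | .loop _ _ => 0

/-- A run of a program without loops. -/
abbrev Does (w : ℕ) (P : Prog) (s : Store) (Q : Store → Prop) : Prop := Runs w P s (size P) Q

section
variable {w : ℕ} {P P' : Prog} {s : Store} {T T' : ℕ} {Q Q' : Store → Prop}

theorem Runs.mono (h : Runs w P s T Q) (hT : T ≤ T') (hQ : ∀ s, Q s → Q' s) : Runs w P s T' Q' := by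
  obtain ⟨k, s', h1, h2, h3⟩ := h
  exact ⟨k, s', h1, h2.trans hT, hQ _ h3⟩

theorem Runs.imp (h : Runs w P s T Q) (hQ : ∀ s, Q s → Q' s) : Runs w P s T Q' := h.mono le_rfl hQ

theorem Runs.seq (h : Runs w P s T fun s' => Runs w P' s' T' Q) :
    Runs w (.seq P P') s (T + T') Q := by
  obtain ⟨k, s', h1, h2, l, s'', h3, h4, h5⟩ := h
  exact ⟨k + l, s'', .seq h1 h3, Nat.add_le_add h2 h4, h5⟩

theorem Does.seq (h : Does w P s fun s' => Does w P' s' Q) : Does w (.seq P P') s Q := Runs.seq h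

theorem Does.skip (h : Q s) : Does w .skip s Q := ⟨1, s, .skip s, le_rfl, h⟩

theorem Does.assign {x : ℕ} {e : Expr} (he : e.eval s < 2 ^ w) (h : Q (s.setReg x (e.eval s))) :
    Does w (.assign x e) s Q := ⟨_, _, .assign s x e he, le_rfl, h⟩

theorem Does.write {a : ℕ} {i e : Expr} (hi : i.eval s < 2 ^ w) (he : e.eval s < 2 ^ w)
    (h : Q (s.setArr a (i.eval s) (e.eval s))) : Does w (.write a i e) s Q :=
  ⟨_, _, .write s a i e hi he, le_rfl, h⟩

theorem Does.ite {b : Test} (h1 : b.holds s → Does w P s Q) (h2 : ¬ b.holds s → Does w P' s Q) :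
    Does w (.ite b P P') s Q := by
  by_cases hb : b.holds s
  · obtain ⟨k, s', h3, h4, h5⟩ := h1 hb
    exact ⟨_, s', .ite_true hb h3, by simp only [size]; omega, h5⟩
  · obtain ⟨k, s', h3, h4, h5⟩ := h2 hb
    exact ⟨_, s', .ite_false hb h3, by simp only [size]; omega, h5⟩

/-- A loop whose steps are paid for by the decrease of the potential `a`. -/
theorem runs_while {b : Test} (I : ℕ → Store → Prop) (C : ℕ)
    (h : ∀ a s, I a s → b.holds s → ∃ k s' a', Exec w P s k s' ∧ I a' s' ∧ a' < a ∧ k ≤ C * (a - a'))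
    (a : ℕ) (s : Store) (hI : I a s) :
    Runs w (.loop b P) s ((C + b.cost + 1) * a + b.cost + 1) fun s' =>
      (∃ a', I a' s') ∧ ¬ b.holds s' := by
  induction a using Nat.strong_induction_on generalizing s with
  | _ a ih =>
    by_cases hb : b.holds s
    · obtain ⟨k, s', a', h1, h2, h3, h4⟩ := h a s hI hb
      obtain ⟨l, s'', h5, h6, h7⟩ := ih a' h3 s' h2
      refine ⟨_, s'', .loop_step hb h1 h5, ?_, h7⟩
      obtain ⟨d, rfl⟩ : ∃ d, a = a' + d := ⟨a - a', by omega⟩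
      rw [Nat.add_sub_cancel_left] at h4
      have hd : 1 ≤ d := by omega
      have : b.cost + 1 ≤ (b.cost + 1) * d := Nat.le_mul_of_pos_right _ hd
      calc b.cost + 1 + k + l ≤ (b.cost + 1) * d + C * d + ((C + b.cost + 1) * a' + b.cost + 1) := by omega
        _ = _ := by ring
    · exact ⟨_, s, .loop_done hb, by omega, ⟨a, hI⟩, hb⟩

theorem runs_for {b : Test} (I : ℕ → Store → Prop) (m C : ℕ)
    (h : ∀ j s, j < m → I j s → Runs w P s C (I (j + 1)))
    (hb : ∀ j s, j ≤ m → I j s → (b.holds s ↔ j < m)) (hI : I 0 s) :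
    Runs w (.loop b P) s ((C + b.cost + 1) * m + b.cost + 1) (I m) := by
  have := runs_while (w := w) (P := P) (b := b) (fun a s => a ≤ m ∧ I (m - a) s) C ?_ m s
    ⟨le_rfl, by simpa using hI⟩
  · refine this.imp ?_
    rintro s' ⟨⟨a, ha, hI'⟩, hn⟩
    rw [hb _ _ (Nat.sub_le _ _) hI'] at hn
    have h0 : m - a = m := by omega
    rwa [h0] at hI'
  · rintro a s ⟨ha, hI⟩ hbs
    rw [hb _ _ (Nat.sub_le _ _) hI] at hbs
    obtain ⟨k, s', h1, h2, h3⟩ := h _ s hbs hI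
    refine ⟨k, s', a - 1, h1, ⟨by omega, ?_⟩, by omega, ?_⟩
    · rwa [show m - (a - 1) = m - a + 1 by omega]
    · rwa [show a - (a - 1) = 1 by omega, Nat.mul_one]

end

section
variable (s : Store) (x y v a b i j : ℕ)

@[simp] theorem setReg_reg : (s.setReg x v).reg y = if y = x then v else s.reg y := rfl
@[simp] theorem setReg_arr : (s.setReg x v).arr = s.arr := rfl
@[simp] theorem setArr_reg : (s.setArr a i v).reg = s.reg := rfl
@[simp] theorem setArr_arr :
    (s.setArr a i v).arr b j = if b = a ∧ j = i then v else s.arr b j := rfl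

theorem setArr_arr_of_ne (h : b ≠ a) : (s.setArr a i v).arr b = s.arr b := by
  funext j; simp [h]

end

/-! ### Lists in memory -/

/-- In the memory with the arrays `L` and `R`, filled below `h`, the value `i` represents a list of
numbers below `n`: `0` is the empty list, `x + 1` with `x < n` is the list `[x]`, and a larger
value is the concatenation of the nonempty lists represented by `L i` and `R i`.  As cells are
never changed, any number of lists may share their parts. -/
inductive Rep (n : ℕ) (L R : ℕ → ℕ) (h : ℕ) : ℕ → List ℕ → Prop
  | nil : Rep n L R h 0 []
  | leaf {x : ℕ} : x < n → Rep n L R h (x + 1) [x]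
  | node {i : ℕ} {l l' : List ℕ} : n < i → i < h → Rep n L R h (L i) l → Rep n L R h (R i) l' →
      l ≠ [] → l' ≠ [] → Rep n L R h i (l ++ l')

section
variable {n h h' i : ℕ} {L R L' R' : ℕ → ℕ} {l l' : List ℕ}

theorem Rep.lt (hr : Rep n L R h i l) (hn : n < h) : i < h := by
  cases hr <;> omega

theorem Rep.eq_nil_iff (hr : Rep n L R h i l) : l = [] ↔ i = 0 := by
  cases hr with
  | nil => simp
  | leaf => simp
  | node h1 _ _ _ h2 => simp [h2]; omega

theorem Rep.mono (hr : Rep n L R h i l) (hh : h ≤ h') (hL : ∀ i < h, L' i = L i)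
    (hR : ∀ i < h, R' i = R i) : Rep n L' R' h' i l := by
  induction hr with
  | nil => exact .nil
  | leaf hx => exact .leaf hx
  | node h1 h2 _ _ h3 h4 ih1 ih2 =>
    refine .node h1 (h2.trans_le hh) ?_ ?_ h3 h4
    · rw [hL _ h2]; exact ih1
    · rw [hR _ h2]; exact ih2

end

/-- In the memory `s`, the value `i` represents the list `l`. -/
def Holds (n : ℕ) (s : Store) (i : ℕ) (l : List ℕ) : Prop :=
  Rep n (s.arr 10) (s.arr 11) (s.reg 3) i l

/-- Lists represented in the memory `s` are still represented in `s'`, and at most `d` cells have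
been allocated. -/
structure Grows (d : ℕ) (s s' : Store) : Prop where
  le : s.reg 3 ≤ s'.reg 3
  le_add : s'.reg 3 ≤ s.reg 3 + d
  fst : ∀ i < s.reg 3, s'.arr 10 i = s.arr 10 i
  snd : ∀ i < s.reg 3, s'.arr 11 i = s.arr 11 i

theorem Grows.refl (s : Store) : Grows 0 s s := ⟨le_rfl, le_rfl, fun _ _ => rfl, fun _ _ => rfl⟩

theorem Grows.trans {d d' : ℕ} {s s' s'' : Store} (h : Grows d s s') (h' : Grows d' s' s'') :
    Grows (d + d') s s'' where
  le := h.le.trans h'.le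
  le_add := by have := h.le_add; have := h'.le_add; omega
  fst i hi := (h'.fst i (hi.trans_le h.le)).trans (h.fst i hi)
  snd i hi := (h'.snd i (hi.trans_le h.le)).trans (h.snd i hi)

theorem Holds.grows {n d i : ℕ} {s s' : Store} {l : List ℕ} (h : Holds n s i l)
    (hg : Grows d s s') : Holds n s' i l := Rep.mono h hg.le hg.fst hg.snd

theorem Holds.lt {n i : ℕ} {s : Store} {l : List ℕ} (h : Holds n s i l) (hn : n < s.reg 3) :
    i < s.reg 3 := Rep.lt h hn

/-- Concatenation of two lists; nothing is allocated if one of them is empty. -/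
def cat (d : ℕ) (e f : Expr) : Prog :=
  .seq (.assign 20 e) <| .seq (.assign 21 f) <|
  .ite (.eq (.reg 20) (.const 0)) (.assign d (.reg 21)) <|
  .ite (.eq (.reg 21) (.const 0)) (.assign d (.reg 20)) <|
  .seq (.write 10 (.reg 3) (.reg 20)) <| .seq (.write 11 (.reg 3) (.reg 21)) <|
  .seq (.assign d (.reg 3)) (.assign 3 (.add (.reg 3) (.const 1)))

/-- The memory `s'` arises from `s` by assignment of a representation of `l` to the
register `d`. -/
structure Catted (n d : ℕ) (l : List ℕ) (s s' : Store) : Prop where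
  holds : Holds n s' (s'.reg d) l
  grows : Grows 1 s s'
  reg : ∀ x, x ≠ d → x ≠ 20 → x ≠ 21 → x ≠ 3 → s'.reg x = s.reg x
  arr : ∀ a, a ≠ 10 → a ≠ 11 → s'.arr a = s.arr a

theorem cat_spec {w n d : ℕ} {e f : Expr} {s : Store} {l l' : List ℕ} (hd : d ≠ 3)
    (he : Holds n s (e.eval s) l) (hf : ∀ v, f.eval (s.setReg 20 v) = f.eval s)
    (hf' : Holds n s (f.eval s) l') (hn : n < s.reg 3) (hw : s.reg 3 + 1 < 2 ^ w) :
    Does w (cat d e f) s (Catted n d (l ++ l') s) := by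
  have h1 := he.lt hn
  have h2 := hf'.lt hn
  refine Does.seq (Does.assign (by omega) ?_)
  refine Does.seq (Does.assign (by rw [hf]; omega) ?_)
  rw [hf]
  refine Does.ite (fun hb => ?_) (fun hb => Does.ite (fun hb' => ?_) (fun hb' => ?_))
  · simp [Test.holds, Expr.eval] at hb
    refine Does.assign (by simp [Expr.eval]; omega) ?_
    rw [(Rep.eq_nil_iff he).2 hb]
    refine ⟨?_, ⟨?_, ?_, ?_, ?_⟩, ?_, ?_⟩
    · simpa [Expr.eval, Holds, hd.symm] using hf'
    · simp [hd.symm]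
    · simp [hd.symm]
    · simp
    · simp
    · intro x h1 h2 h3 h4; simp [h1, h2, h3]
    · simp
  · simp [Test.holds, Expr.eval] at hb'
    refine Does.assign (by simp [Expr.eval]; omega) ?_
    rw [(Rep.eq_nil_iff hf').2 hb', List.append_nil]
    refine ⟨?_, ⟨?_, ?_, ?_, ?_⟩, ?_, ?_⟩
    · simpa [Expr.eval, Holds, hd.symm] using he
    · simp [hd.symm]
    · simp [hd.symm]
    · simp
    · simp
    · intro x h1 h2 h3 h4; simp [h1, h2, h3]
    · simp
  · simp [Test.holds, Expr.eval] at hb hb'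
    refine Does.seq (Does.write (by simp [Expr.eval]; omega) (by simp [Expr.eval]; omega) ?_)
    refine Does.seq (Does.write (by simp [Expr.eval]; omega) (by simp [Expr.eval]; omega) ?_)
    refine Does.seq (Does.assign (by simp [Expr.eval]; omega) ?_)
    refine Does.assign (by simp [Expr.eval, hd.symm]; omega) ?_
    have key : ∀ i < s.reg 3, i ≠ s.reg 3 := fun i hi => hi.ne
    refine ⟨?_, ⟨?_, ?_, ?_, ?_⟩, ?_, ?_⟩
    · simp only [Holds, Expr.eval, setReg_reg, setReg_arr, setArr_reg]
      simp only [hd, hd.symm, if_false, if_true]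
      norm_num
      refine .node hn (Nat.lt_succ_self _) ?_ ?_ (fun h => hb ((Rep.eq_nil_iff he).1 h))
        (fun h => hb' ((Rep.eq_nil_iff hf').1 h))
      · simp
        refine Rep.mono he (Nat.le_succ _) (fun i hi => ?_) (fun i hi => ?_) <;> simp [hi.ne]
      · simp
        refine Rep.mono hf' (Nat.le_succ _) (fun i hi => ?_) (fun i hi => ?_) <;> simp [hi.ne]
    · simp [Expr.eval, hd.symm]
    · simp [Expr.eval, hd.symm]
    · intro i hi; simp [Expr.eval, hi.ne]
    · intro i hi; simp [Expr.eval, hi.ne]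
    · intro x h1 h2 h3 h4; simp [h1, h2, h3, h4]
    · intro a h1 h2
      funext j
      simp [h1, h2]

/-! ### Processing one vertex -/

/-- The memory `s'` arises from `s` by assignments to registers in `X`, writes to arrays in `Y`,
and allocation of at most `d` cells for lists. -/
structure Changes (X Y : List ℕ) (d : ℕ) (s s' : Store) : Prop where
  grows : Grows d s s'
  reg : ∀ x, x ∉ X → s'.reg x = s.reg x
  arr : ∀ a, a ∉ Y → s'.arr a = s.arr a

section
variable {X X' Y Y' : List ℕ} {d d' w n : ℕ} {s s' s'' : Store}

theorem Changes.refl (X Y : List ℕ) (s : Store) : Changes X Y 0 s s :=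
  ⟨.refl s, fun _ _ => rfl, fun _ _ => rfl⟩

theorem Changes.trans (h : Changes X Y d s s') (h' : Changes X Y d' s' s'') :
    Changes X Y (d + d') s s'' :=
  ⟨h.grows.trans h'.grows, fun x hx => (h'.reg x hx).trans (h.reg x hx),
    fun a ha => (h'.arr a ha).trans (h.arr a ha)⟩

theorem Changes.mono (h : Changes X Y d s s') (hX : X ⊆ X') (hY : Y ⊆ Y') (hd : d ≤ d') :
    Changes X' Y' d' s s' :=
  ⟨⟨h.grows.le, h.grows.le_add.trans (by omega), h.grows.fst, h.grows.snd⟩,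
    fun x hx => h.reg x fun h' => hx (hX h'), fun a ha => h.arr a fun h' => ha (hY h')⟩

theorem changes_setReg {x v : ℕ} (hx : x ≠ 3) : Changes [x] [] 0 s (s.setReg x v) := by
  refine ⟨⟨?_, ?_, ?_, ?_⟩, fun y hy => ?_, fun a _ => rfl⟩
  · simp [hx.symm]
  · simp [hx.symm]
  · simp
  · simp
  · simp at hy; simp [hy]

theorem changes_setArr {a i v : ℕ} (h1 : a ≠ 10) (h2 : a ≠ 11) :
    Changes [] [a] 0 s (s.setArr a i v) := by
  refine ⟨⟨le_rfl, le_rfl, ?_, ?_⟩, fun y hy => rfl, fun b hb => ?_⟩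
  · simp [h1.symm]
  · simp [h2.symm]
  · exact setArr_arr_of_ne s v a b i (by simpa using hb)

theorem Catted.changes {l : List ℕ} (h : Catted n d l s s') :
    Changes [d, 20, 21, 3] [10, 11] 1 s s' :=
  ⟨h.grows, fun x hx => by simp at hx; exact h.reg x hx.1 hx.2.1 hx.2.2.1 hx.2.2.2,
    fun a ha => by simp at ha; exact h.arr a ha.1 ha.2⟩

theorem Changes.setReg {x v : ℕ} (h : Changes X Y d s s') (hx : x ≠ 3) (hX : x ∈ X) :
    Changes X Y d s (s'.setReg x v) :=
  h.trans ((changes_setReg hx).mono (by simpa using hX) (by simp) le_rfl)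

theorem Changes.setArr {a i v : ℕ} (h : Changes X Y d s s') (h1 : a ≠ 10) (h2 : a ≠ 11)
    (hY : a ∈ Y) : Changes X Y d s (s'.setArr a i v) :=
  h.trans ((changes_setArr h1 h2).mono (by simp) (by simpa using hY) le_rfl)

theorem Changes.cat {x : ℕ} {l : List ℕ} (h : Changes X Y d s s') (hc : Catted n x l s' s'')
    (hX : [x, 20, 21, 3] ⊆ X) (hY : [10, 11] ⊆ Y) : Changes X Y (d + 1) s s'' :=
  h.trans (hc.changes.mono hX hY le_rfl)

end

/-- One step of `scan`, at the level in register `5`. -/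
def scanStep : Prog :=
  .seq (.assign 16 (.read 5 (.add (.mul (.reg 5) (.reg 1)) (.reg 4)))) <|
  .seq
    (.ite (.eq (.reg 16) (.const 0)) .skip <|
      .ite (.neg (.conj (.neg (.eq (.reg 5) (.const 0)))
          (.conj (.neg (.eq (.reg 16) (.const 6)))
            (.neg (.conj (.eq (.reg 16) (.const 5)) (.eq (.reg 6) (.reg 5)))))))
        (.seq (.assign 6 (.add (.reg 5) (.const 1))) (.assign 7 (.const 1))) <|
      .ite (.eq (.reg 16) (.const 5)) .skip <|
      .seq (.assign 6 (.reg 5)) <|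
      .ite (.eq (.reg 16) (.const 2)) (.assign 7 (.const 2))
        (.assign 7 (.add (.reg 16) (.const 1))))
    (.assign 5 (.add (.reg 5) (.const 1)))

/-- The scan of the levels of the vertex in register `4`, with the result in registers `6`, `7`. -/
def scanProg : Prog :=
  .seq (.assign 6 (.const 0)) <| .seq (.assign 7 (.const 1)) <| .seq (.assign 5 (.const 0)) <|
  .loop (.lt (.reg 5) (.reg 2)) scanStep

theorem scanStep_spec {w j : ℕ} {s : Store} {st : ℕ → ℕ}
    (h16 : s.arr 5 (s.reg 5 * s.reg 1 + s.reg 4) = st j) (hj : s.reg 5 = j)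
    (hst : st j ≤ 6) (h : (s.reg 6, s.reg 7) = scan st j) (hw : j + 8 < 2 ^ w) :
    Does w scanStep s fun s' => (s'.reg 6, s'.reg 7) = scan st (j + 1) ∧ s'.reg 5 = j + 1 ∧
      Changes [5, 6, 7, 16] [] 0 s s' := by
  subst hj
  have h6 : s.reg 6 = (scan st (s.reg 5)).1 := by rw [← h]
  refine Does.seq (Does.assign (by simp [Expr.eval, h16]; omega) ?_)
  refine Does.seq ?_
  have c0 : Changes [5, 6, 7, 16] [] 0 s
      (s.setReg 16 ((Expr.read 5 ((Expr.reg 5).mul (.reg 1) |>.add (.reg 4))).eval s)) :=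
    (changes_setReg (by decide)).mono (by simp) (by simp) le_rfl
  simp only [Expr.eval, h16] at c0 ⊢
  -- the final increment
  have fin : ∀ s' : Store, (s'.reg 6, s'.reg 7) = scan st (s.reg 5 + 1) →
      Changes [6, 7] [] 0 (s.setReg 16 (st (s.reg 5))) s' →
      Does w (.assign 5 (.add (.reg 5) (.const 1))) s' fun s' =>
        (s'.reg 6, s'.reg 7) = scan st (s.reg 5 + 1) ∧ s'.reg 5 = s.reg 5 + 1 ∧
        Changes [5, 6, 7, 16] [] 0 s s' := by
    intro s' h1 h2
    have h5 : s'.reg 5 = s.reg 5 := by rw [h2.reg 5 (by decide)]; simp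
    refine Does.assign (by simp [Expr.eval, h5]; omega) ⟨by simpa using h1, by simp [Expr.eval, h5], ?_⟩
    exact (c0.trans (h2.mono (by simp) (by simp) le_rfl)).trans
      ((changes_setReg (by decide)).mono (by simp) (by simp) le_rfl)
  have step6 : ∀ a, Changes [6, 7] [] 0 (s.setReg 16 (st (s.reg 5)))
      ((s.setReg 16 (st (s.reg 5))).setReg 6 a) :=
    fun a => (changes_setReg (by decide)).mono (by simp) (by simp) le_rfl
  have step7 : ∀ a b, Changes [6, 7] [] 0 (s.setReg 16 (st (s.reg 5)))
      (((s.setReg 16 (st (s.reg 5))).setReg 6 a).setReg 7 b) :=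
    fun a b => (step6 a).trans ((changes_setReg (by decide)).mono (by simp) (by simp) le_rfl)
  refine Does.ite (fun h0 => Does.skip (fin _ ?_ (.refl _ _ _))) fun h0 => ?_
  · simp [Test.holds, Expr.eval] at h0
    rw [scan, if_pos h0, ← h]; simp
  simp [Test.holds, Expr.eval] at h0
  refine Does.ite (fun h1 => ?_) fun h1 => ?_
  · simp only [Test.holds, Expr.eval, setReg_reg] at h1
    norm_num at h1
    refine Does.seq (Does.assign (by simp [Expr.eval]; omega) ?_)
    refine Does.assign (by simp only [Expr.eval]; omega) (fin _ ?_ (step7 _ _))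
    rw [scan, if_neg h0, if_pos]
    · simp [Expr.eval]
    · rw [← h6]
      by_contra hcon
      push Not at hcon
      exact hcon.2.2 (h1 hcon.1 hcon.2.1).1 (h1 hcon.1 hcon.2.1).2
  simp only [Test.holds, Expr.eval, setReg_reg] at h1
  norm_num at h1
  have hno : ¬ (s.reg 5 = 0 ∨ st (s.reg 5) = 6 ∨ (st (s.reg 5) = 5 ∧ (scan st (s.reg 5)).1 = s.reg 5)) := by
    rw [← h6]
    rintro (h2 | h2 | h2)
    · exact h1.1 h2
    · exact h1.2.1 h2
    · exact h1.2.2 h2.1 h2.2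
  refine Does.ite (fun h2 => Does.skip (fin _ ?_ (.refl _ _ _))) fun h2 => ?_
  · simp [Test.holds, Expr.eval] at h2
    rw [scan, if_neg h0, if_neg hno, if_pos h2, ← h]; simp
  simp [Test.holds, Expr.eval] at h2
  refine Does.seq (Does.assign (by simp [Expr.eval]; omega) ?_)
  refine Does.ite (fun h3 => ?_) fun h3 => ?_
  · simp [Test.holds, Expr.eval] at h3
    refine Does.assign (by simp [Expr.eval]; omega) (fin _ ?_ (step7 _ _))
    rw [scan, if_neg h0, if_neg hno, if_neg h2, if_pos h3]
    simp [Expr.eval]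
  · simp [Test.holds, Expr.eval] at h3
    refine Does.assign (by simp [Expr.eval]; omega) (fin _ ?_ (step7 _ _))
    rw [scan, if_neg h0, if_neg hno, if_neg h2, if_neg h3]
    simp [Expr.eval]

/-- The cost of a scan of `K` levels. -/
def scanTime (K : ℕ) : ℕ :=
  2 + (2 + (2 + ((size scanStep + (Test.lt (.reg 5) (.reg 2)).cost + 1) * K +
    (Test.lt (.reg 5) (.reg 2)).cost + 1)))

theorem scanProg_spec {w K : ℕ} {s : Store} {st : ℕ → ℕ} (hK : s.reg 2 = K)
    (hst : ∀ k < K, s.arr 5 (k * s.reg 1 + s.reg 4) = st k) (hst6 : ∀ k, st k ≤ 6)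
    (hw : K + 8 < 2 ^ w) :
    Runs w scanProg s (scanTime K) fun s' => (s'.reg 6, s'.reg 7) = scan st K ∧
      Changes [5, 6, 7, 16] [] 0 s s' := by
  refine Runs.seq (Does.assign (by simp [Expr.eval]) ?_)
  refine Runs.seq (Does.assign (by simp only [Expr.eval]; omega) ?_)
  refine Runs.seq (Does.assign (by simp [Expr.eval]) ?_)
  have h0 : Changes [5, 6, 7, 16] [] 0 s (((s.setReg 6 0).setReg 7 1).setReg 5 0) :=
    (((changes_setReg (by decide)).mono (by simp) (by simp) le_rfl).trans
      ((changes_setReg (by decide)).mono (by simp) (by simp) le_rfl)).trans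
      ((changes_setReg (by decide)).mono (by simp) (by simp) le_rfl)
  refine (runs_for (fun j s' => (s'.reg 6, s'.reg 7) = scan st j ∧ s'.reg 5 = j ∧
    Changes [5, 6, 7, 16] [] 0 s s') K (size scanStep) ?_ ?_ ⟨?_, ?_, h0⟩).imp ?_
  · rintro j s' hj ⟨h1, h2, h3⟩
    refine (scanStep_spec (w := w) (st := st) ?_ h2 (hst6 j) h1 (by omega)).imp ?_
    · rw [h2, h3.reg 1 (by decide), h3.reg 4 (by decide), h3.arr 5 (by simp)]
      exact hst j hj
    · rintro s'' ⟨g1, g2, g3⟩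
      exact ⟨g1, g2, h3.trans g3⟩
  · rintro j s' hj ⟨h1, h2, h3⟩
    simp [Test.holds, Expr.eval, h2, h3.reg 2 (by decide), hK]
  · simp [scan]
  · simp
  · rintro s' ⟨h1, -, h3⟩
    exact ⟨h1, h3⟩

/-- Label and lists of the vertex in register `4` at the level in register `5`, whose cells have
the index in register `12`; the results go to registers `9`, `10` and `11`. -/
def labelProg : Prog :=
  .ite (.lt (.reg 5) (.reg 6))
    (.seq (.assign 9 (.const 0)) <| .seq (.assign 10 (.const 0)) (.assign 11 (.const 0))) <|
  .ite (.eq (.reg 5) (.reg 6))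
    (.seq (.assign 9 (.reg 7)) <|
      .ite (.eq (.reg 7) (.const 5))
        (.seq (cat 10 (.read 8 (.reg 12)) (.read 6 (.reg 12)))
          (cat 11 (.add (.reg 4) (.const 1)) (.read 9 (.reg 12)))) <|
      .seq (cat 15 (.add (.reg 4) (.const 1)) (.read 7 (.reg 12))) <|
      .seq (cat 10 (.read 8 (.reg 12)) (.reg 15)) <|
      .ite (.eq (.reg 7) (.const 4)) (.assign 11 (.read 9 (.reg 12)))
        (cat 11 (.reg 15) (.read 9 (.reg 12)))) <|
  .seq (.assign 9 (.read 5 (.reg 12))) <| .seq (.assign 10 (.read 8 (.reg 12)))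
    (.assign 11 (.read 9 (.reg 12)))

theorem holds_nil {n : ℕ} (s : Store) : Holds n s 0 [] := .nil

theorem holds_leaf {n x : ℕ} (s : Store) (hx : x < n) : Holds n s (x + 1) [x] := .leaf hx

theorem Holds.setReg {n i x v : ℕ} {s : Store} {l : List ℕ} (h : Holds n s i l) (hx : x ≠ 3) :
    Holds n (s.setReg x v) i l := h.grows (changes_setReg hx).grows

theorem Holds.changes {n i d : ℕ} {X Y : List ℕ} {s s' : Store} {l : List ℕ} (h : Holds n s i l)
    (hc : Changes X Y d s s') : Holds n s' i l := h.grows hc.grows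

theorem labelProg_spec {w n k x : ℕ} {s : Store} {a : Acc} (h4 : s.reg 4 = x) (h5 : s.reg 5 = k)
    (hx : x < n) (hst : s.arr 5 (s.reg 12) = a.st k) (hkids : Holds n s (s.arr 6 (s.reg 12)) (a.kids k))
    (hsides : Holds n s (s.arr 7 (s.reg 12)) (a.sides k))
    (hfst : Holds n s (s.arr 8 (s.reg 12)) (a.fst k))
    (hsnd : Holds n s (s.arr 9 (s.reg 12)) (a.snd k))
    (hst6 : a.st k ≤ 6) (h7 : s.reg 7 ≤ 6) (hn : n < s.reg 3) (hw : s.reg 3 + 8 < 2 ^ w) :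
    Does w labelProg s fun s' => s'.reg 9 = labOf (s.reg 6) (s.reg 7) a.st k ∧
      Holds n s' (s'.reg 10) (fstOf (s.reg 6) (s.reg 7) x a k) ∧
      Holds n s' (s'.reg 11) (sndOf (s.reg 6) (s.reg 7) x a k) ∧
      Changes [9, 10, 11, 15, 20, 21, 3] [10, 11] 3 s s' := by
  have hlf := hfst.lt hn
  have hls := hsnd.lt hn
  have cr : ∀ (s : Store) (x v : ℕ), x ∈ [9, 10, 11] →
      Changes [9, 10, 11, 15, 20, 21, 3] [10, 11] 0 s (s.setReg x v) := by
    intro s x v hx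
    refine (changes_setReg (by rintro rfl; simp at hx)).mono ?_ (by simp) le_rfl
    intro y hy
    rw [List.mem_singleton] at hy
    subst hy
    simp at hx ⊢
    tauto
  have cc : ∀ {s s' : Store} {l : List ℕ} (x : ℕ), x ∈ [10, 11, 15] → Catted n x l s s' →
      Changes [9, 10, 11, 15, 20, 21, 3] [10, 11] 1 s s' := by
    intro s s' l x hx h
    refine h.changes.mono ?_ (by simp) le_rfl
    intro y hy
    simp at hx hy ⊢
    omega
  refine Does.ite (fun hb => ?_) fun hb => Does.ite (fun hb' => ?_) fun hb' => ?_
  · simp only [Test.holds, Expr.eval, h5] at hb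
    refine Does.seq (Does.assign (by simp [Expr.eval]) ?_)
    refine Does.seq (Does.assign (by simp [Expr.eval]) ?_)
    refine Does.assign (by simp [Expr.eval]) ?_
    simp only [labOf, fstOf, sndOf, if_pos hb]
    refine ⟨by simp [Expr.eval], holds_nil _, holds_nil _, ?_⟩
    exact (((cr _ _ _ (by simp)).trans (cr _ _ _ (by simp))).trans (cr _ _ _ (by simp))).mono
      (by simp) (by simp) (by omega)
  · simp only [Test.holds, Expr.eval, h5] at hb hb'
    have hlab : labOf (s.reg 6) (s.reg 7) a.st k = s.reg 7 := by
      rw [labOf, if_neg hb, if_pos hb']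
    have hF : fstOf (s.reg 6) (s.reg 7) x a k = if s.reg 7 = 5 then a.fst k ++ a.kids k
        else a.fst k ++ (x :: a.sides k) := by rw [fstOf, if_neg hb, if_pos hb']
    have hS : sndOf (s.reg 6) (s.reg 7) x a k = if s.reg 7 = 5 then x :: a.snd k
        else if s.reg 7 = 4 then a.snd k else (x :: a.sides k) ++ a.snd k := by
      rw [sndOf, if_neg hb, if_pos hb']
    rw [hlab, hF, hS]
    refine Does.seq (Does.assign (by simp [Expr.eval]; omega) ?_)
    have c1 := cr s 9 ((Expr.reg 7).eval s) (by simp)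
    have r1 : ∀ y, y ≠ 9 → (s.setReg 9 ((Expr.reg 7).eval s)).reg y = s.reg y := by
      intro y hy; simp [hy]
    have r9 : (s.setReg 9 ((Expr.reg 7).eval s)).reg 9 = s.reg 7 := by simp [Expr.eval]
    have a1 : (s.setReg 9 ((Expr.reg 7).eval s)).arr = s.arr := rfl
    generalize s.setReg 9 ((Expr.reg 7).eval s) = s₁ at *
    refine Does.ite (fun h => ?_) fun h => ?_
    · simp only [Test.holds, Expr.eval, r1 7 (by decide)] at h
      rw [if_pos h, if_pos h]
      refine Does.seq ((cat_spec (n := n) (l := a.fst k) (l' := a.kids k) (by decide) ?_ ?_ ?_ ?_ ?_).imp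
        fun s₂ q₂ => ?_)
      · simpa [Expr.eval, a1, r1] using hfst.changes c1
      · intro v; simp [Expr.eval]
      · simpa [Expr.eval, a1, r1] using hkids.changes c1
      · rw [r1 3 (by decide)]; exact hn
      · rw [r1 3 (by decide)]; omega
      · have c2 := c1.trans (cc 10 (by simp) q₂)
        have e3 := c2.grows.le
        have e3' := c2.grows.le_add
        have e9 := q₂.arr 9 (by decide) (by decide)
        have e12 := (q₂.reg 12 (by decide) (by decide) (by decide) (by decide)).trans (r1 12 (by decide))
        have e4 := (q₂.reg 4 (by decide) (by decide) (by decide) (by decide)).trans (r1 4 (by decide))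
        refine (cat_spec (n := n) (l := [x]) (l' := a.snd k) (by decide) ?_ ?_ ?_ ?_ ?_).imp
          fun s₃ q₃ => ?_
        · simpa [Expr.eval, e4, h4] using holds_leaf s₂ hx
        · intro v; simp [Expr.eval]
        · simpa [Expr.eval, e12, e9, a1] using hsnd.changes c2
        · omega
        · omega
        · refine ⟨?_, ?_, q₃.holds, (c2.trans (cc 11 (by simp) q₃)).mono (by simp) (by simp) (by omega)⟩
          · rw [q₃.reg 9 (by decide) (by decide) (by decide) (by decide),
              q₂.reg 9 (by decide) (by decide) (by decide) (by decide), r9]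
          · rw [q₃.reg 10 (by decide) (by decide) (by decide) (by decide)]
            exact q₂.holds.grows q₃.grows
    · simp only [Test.holds, Expr.eval, r1 7 (by decide)] at h
      rw [if_neg h, if_neg h]
      refine Does.seq ((cat_spec (n := n) (l := [x]) (l' := a.sides k) (by decide) ?_ ?_ ?_ ?_ ?_).imp
        fun s₂ q₂ => ?_)
      · simpa [Expr.eval, r1, h4] using holds_leaf s₁ hx
      · intro v; simp [Expr.eval]
      · simpa [Expr.eval, a1, r1] using hsides.changes c1
      · rw [r1 3 (by decide)]; exact hn
      · rw [r1 3 (by decide)]; omega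
      have c2 := c1.trans (cc 15 (by simp) q₂)
      have e3 := c2.grows.le
      have e3' := c2.grows.le_add
      have e8 := q₂.arr 8 (by decide) (by decide)
      have e9 := q₂.arr 9 (by decide) (by decide)
      have e12 := (q₂.reg 12 (by decide) (by decide) (by decide) (by decide)).trans (r1 12 (by decide))
      refine Does.seq ((cat_spec (n := n) (l := a.fst k) (l' := x :: a.sides k) (by decide) ?_ ?_ ?_ ?_ ?_).imp
        fun s₃ q₃ => ?_)
      · simpa [Expr.eval, e12, e8, a1] using hfst.changes c2
      · intro v; simp [Expr.eval]
      · simpa [Expr.eval] using q₂.holds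
      · omega
      · omega
      have c3 := c2.trans (cc 10 (by simp) q₃)
      have f3 := c3.grows.le
      have f3' := c3.grows.le_add
      have f9 := (q₃.arr 9 (by decide) (by decide)).trans e9
      have f12 := (q₃.reg 12 (by decide) (by decide) (by decide) (by decide)).trans e12
      have f15 := q₃.reg 15 (by decide) (by decide) (by decide) (by decide)
      have f7 : s₃.reg 7 = s.reg 7 := c3.reg 7 (by decide)
      have fr9 : s₃.reg 9 = s.reg 7 := by
        rw [q₃.reg 9 (by decide) (by decide) (by decide) (by decide),
              q₂.reg 9 (by decide) (by decide) (by decide) (by decide), r9]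
      refine Does.ite (fun h' => ?_) fun h' => ?_
      · simp only [Test.holds, Expr.eval, f7] at h'
        rw [if_pos h']
        refine Does.assign (by simp [Expr.eval, f9, f12, a1]; omega) ⟨by simpa using fr9, ?_, ?_, ?_⟩
        · simpa using q₃.holds.setReg (by decide)
        · simpa [Expr.eval, f9, f12, a1] using (hsnd.changes c3).setReg (by decide)
        · exact (c3.trans (cr _ _ _ (by simp))).mono (by simp) (by simp) (by omega)
      · simp only [Test.holds, Expr.eval, f7] at h'
        rw [if_neg h']
        refine (cat_spec (n := n) (l := x :: a.sides k) (l' := a.snd k) (by decide) ?_ ?_ ?_ ?_ ?_).imp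
          fun s₄ q₄ => ?_
        · simpa [Expr.eval, f15] using q₂.holds.grows q₃.grows
        · intro v; simp [Expr.eval]
        · simpa [Expr.eval, f9, f12, a1] using hsnd.changes c3
        · omega
        · omega
        · refine ⟨?_, ?_, q₄.holds, (c3.trans (cc 11 (by simp) q₄)).mono (by simp) (by simp) (by omega)⟩
          · rw [q₄.reg 9 (by decide) (by decide) (by decide) (by decide), fr9]
          · rw [q₄.reg 10 (by decide) (by decide) (by decide) (by decide)]
            exact q₃.holds.grows q₄.grows
  · simp only [Test.holds, Expr.eval, h5] at hb hb'
    simp only [labOf, fstOf, sndOf, if_neg hb, if_neg hb']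
    refine Does.seq (Does.assign (by simp [Expr.eval, hst]; omega) ?_)
    refine Does.seq (Does.assign (by simp [Expr.eval]; omega) ?_)
    refine Does.assign (by simp [Expr.eval]; omega) ?_
    refine ⟨by simp [Expr.eval, hst], ?_, ?_, ?_⟩
    · simpa [Expr.eval] using ((hfst.setReg (by decide)).setReg (by decide)).setReg (by decide)
    · simpa [Expr.eval] using ((hsnd.setReg (by decide)).setReg (by decide)).setReg (by decide)
    · exact (((cr _ _ _ (by simp)).trans (cr _ _ _ (by simp))).trans (cr _ _ _ (by simp))).mono
        (by simp) (by simp) (by omega)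

/-! ### Tables with a cell for each vertex and level -/

/-- The cell `k * (n + 1) + v` of the array `a`, for `v ≤ n` and `k < L`, represents `F v k`. -/
def Tab (n L a : ℕ) (F : ℕ → ℕ → List ℕ) (s : Store) : Prop :=
  ∀ v ≤ n, ∀ k < L, Holds n s (s.arr a (k * (n + 1) + v)) (F v k)

/-- The table `F` with `l` in the place of `F y j`. -/
def upd (F : ℕ → ℕ → List ℕ) (y j : ℕ) (l : List ℕ) : ℕ → ℕ → List ℕ :=
  fun v k => if v = y ∧ k = j then l else F v k

section
variable {w n L K a d i j k v y x : ℕ} {X Y : List ℕ} {s s' : Store} {F : ℕ → ℕ → List ℕ}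
  {l : List ℕ}

theorem cell_inj (hv : v ≤ n) (hy : y ≤ n) : k * (n + 1) + v = j * (n + 1) + y ↔ v = y ∧ k = j := by
  constructor
  · intro h
    have h1 := congrArg (· % (n + 1)) h
    have h2 := congrArg (· / (n + 1)) h
    simp only [Nat.mul_add_mod_self_right, Nat.mod_eq_of_lt (Nat.lt_succ_of_le hv),
      Nat.mod_eq_of_lt (Nat.lt_succ_of_le hy)] at h1
    simp only [Nat.add_comm (_ * _), Nat.add_mul_div_right _ _ (Nat.succ_pos n),
      Nat.div_eq_of_lt (Nat.lt_succ_of_le hv), Nat.div_eq_of_lt (Nat.lt_succ_of_le hy),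
      Nat.zero_add] at h2
    exact ⟨h1, h2⟩
  · rintro ⟨rfl, rfl⟩
    rfl

theorem cell_lt (hv : v ≤ n) (hk : k < L) : k * (n + 1) + v < L * (n + 1) := by
  have : (k + 1) * (n + 1) ≤ L * (n + 1) := Nat.mul_le_mul_right _ hk
  rw [Nat.add_mul] at this
  omega

theorem Tab.changes (h : Tab n L a F s) (hc : Changes X Y d s s') (ha : a ∉ Y) : Tab n L a F s' :=
  fun v hv k hk => by rw [hc.arr a ha]; exact (h v hv k hk).changes hc

theorem Tab.setArr (h : Tab n L a F s) (h1 : a ≠ 10) (h2 : a ≠ 11) (hy : y ≤ n)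
    (hl : Holds n s i l) : Tab n L a (upd F y j l) (s.setArr a (j * (n + 1) + y) i) := by
  intro v hv k hk
  have hc := changes_setArr (s := s) (i := j * (n + 1) + y) (v := i) h1 h2
  simp only [setArr_arr, true_and, cell_inj hv hy, upd]
  split_ifs
  · exact hl.changes hc
  · exact (h v hv k hk).changes hc

/-- Concatenation of a list to a cell of the array `a`. -/
def append (a : ℕ) (i e : Expr) : Prog :=
  .seq (cat 16 (.read a i) e) (.write a i (.reg 16))

theorem append_spec {e f : Expr} {l : List ℕ} (h1 : a ≠ 10) (h2 : a ≠ 11) (hT : Tab n L a F s)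
    (he : ∀ s', s'.reg 1 = s.reg 1 → s'.reg 13 = s.reg 13 → e.eval s' = j * (n + 1) + y)
    (hy : y ≤ n) (hj : j < L) (hf : ∀ v, f.eval (s.setReg 20 v) = f.eval s)
    (hl : Holds n s (f.eval s) l) (hn : n < s.reg 3) (hw : s.reg 3 + 1 < 2 ^ w)
    (hw' : L * (n + 1) ≤ 2 ^ w) :
    Does w (append a e f) s fun s' => Tab n L a (upd F y j (F y j ++ l)) s' ∧
      Changes [16, 20, 21, 3] [a, 10, 11] 1 s s' := by
  have hi := he s rfl rfl
  refine Does.seq ((cat_spec (n := n) (l := F y j) (l' := l) (by decide) ?_ hf hl hn hw).imp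
    fun s₁ q => ?_)
  · simpa [Expr.eval, hi] using hT y hy j hj
  · have c := (Changes.refl [16, 20, 21, 3] [a, 10, 11] s).cat q (by simp) (by simp)
    have hi' := he s₁ (c.reg 1 (by decide)) (c.reg 13 (by decide))
    have hlt := q.holds.lt (hn.trans_le c.grows.le)
    have hle := c.grows.le_add
    have := cell_lt hy hj
    refine Does.write (by omega) (by simp only [Expr.eval]; omega) ⟨?_, c.setArr h1 h2 (by simp)⟩
    rw [hi']
    have hT' : Tab n L a F s₁ := hT.changes q.changes (by simp [h1, h2])
    exact hT'.setArr h1 h2 hy q.holds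

end

/-- In the memory `s`, the tables represent the values passed on to the vertices `v ≤ n`. -/
structure Table (n K : ℕ) (A : ℕ → Acc) (s : Store) : Prop where
  st : ∀ v ≤ n, ∀ k < K, s.arr 5 (k * (n + 1) + v) = (A v).st k
  kids : Tab n (K + 1) 6 (fun v => (A v).kids) s
  sides : Tab n K 7 (fun v => (A v).sides) s
  fst : Tab n K 8 (fun v => (A v).fst) s
  snd : Tab n K 9 (fun v => (A v).snd) s

theorem Table.changes {n K d : ℕ} {X Y : List ℕ} {A : ℕ → Acc} {s s' : Store} (h : Table n K A s)
    (hc : Changes X Y d s s') (h5 : 5 ∉ Y) (h6 : 6 ∉ Y) (h7 : 7 ∉ Y) (h8 : 8 ∉ Y) (h9 : 9 ∉ Y) :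
    Table n K A s' where
  st v hv k hk := by rw [hc.arr 5 h5]; exact h.st v hv k hk
  kids := h.kids.changes hc h6
  sides := h.sides.changes hc h7
  fst := h.fst.changes hc h8
  snd := h.snd.changes hc h9

theorem Table.congr {n K : ℕ} {A B : ℕ → Acc} {s : Store} (h : Table n K A s)
    (hst : ∀ v ≤ n, ∀ k < K, (B v).st k = (A v).st k)
    (hk : ∀ v ≤ n, ∀ k ≤ K, (B v).kids k = (A v).kids k)
    (hs : ∀ v ≤ n, ∀ k < K, (B v).sides k = (A v).sides k)
    (hf : ∀ v ≤ n, ∀ k < K, (B v).fst k = (A v).fst k)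
    (hl : ∀ v ≤ n, ∀ k < K, (B v).snd k = (A v).snd k) : Table n K B s where
  st v hv k hk := by rw [hst v hv k hk]; exact h.st v hv k hk
  kids v hv k hk' := by beta_reduce; rw [hk v hv k (by omega)]; exact h.kids v hv k hk'
  sides v hv k hk := by beta_reduce; rw [hs v hv k hk]; exact h.sides v hv k hk
  fst v hv k hk := by beta_reduce; rw [hf v hv k hk]; exact h.fst v hv k hk
  snd v hv k hk := by beta_reduce; rw [hl v hv k hk]; exact h.snd v hv k hk

/-- The part of `Acc.push` that concerns the level `j`, with the lists of children shifted by one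
level. -/
def Acc.pushAt (a : Acc) (d : Node) (j : ℕ) : Acc where
  st k := if k = j then (a.push d).st k else a.st k
  kids k := if k = j + 1 then (a.push d).kids k else a.kids k
  sides k := if k = j then (a.push d).sides k else a.sides k
  fst k := if k = j then (a.push d).fst k else a.fst k
  snd k := if k = j then (a.push d).snd k else a.snd k

/-- The part of `Acc.push` that concerns the levels below `j`. -/
def Acc.pushBelow (a : Acc) (d : Node) (j : ℕ) : Acc where
  st k := if k < j then (a.push d).st k else a.st k
  kids k := if k ≤ j then (a.push d).kids k else a.kids k
  sides k := if k < j then (a.push d).sides k else a.sides k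
  fst k := if k < j then (a.push d).fst k else a.fst k
  snd k := if k < j then (a.push d).snd k else a.snd k

theorem Acc.pushBelow_zero (a : Acc) (d : Node) (hd : d.cl 0 = []) : a.pushBelow d 0 = a := by
  simp only [Acc.pushBelow, Nat.not_lt_zero, if_false, Nat.le_zero]
  congr
  funext k
  split_ifs with h
  · subst h; simp [Acc.push, hd]
  · rfl

theorem Acc.pushBelow_succ (a : Acc) (d : Node) (j : ℕ) :
    (a.pushBelow d j).pushAt d j = a.pushBelow d (j + 1) := by
  simp only [Acc.pushBelow, Acc.pushAt, Acc.push]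
  congr <;> funext k <;> grind

/-- The state of the cell with the index in register `13` after one more child with the label in
register `9`. -/
def joinProg : Prog :=
  .seq (.assign 16 (.read 5 (.reg 13))) <|
  .ite (.eq (.reg 9) (.const 0)) .skip <|
  .ite (.eq (.reg 16) (.const 0)) (.write 5 (.reg 13) (.reg 9)) <|
  .ite (.conj (.eq (.reg 9) (.const 1)) (.lt (.reg 16) (.const 4))) .skip <|
  .ite (.conj (.eq (.reg 9) (.const 2)) (.lt (.reg 16) (.const 3)))
    (.write 5 (.reg 13) (.add (.reg 16) (.const 1)))
    (.write 5 (.reg 13) (.const 6))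

theorem joinProg_spec {w : ℕ} {s : Store} (h9 : s.reg 9 ≤ 6) (h5 : s.arr 5 (s.reg 13) ≤ 6)
    (h13 : s.reg 13 < 2 ^ w) (hw : 8 < 2 ^ w) :
    Does w joinProg s fun s' => Changes [16] [5] 0 s s' ∧ ∀ i, s'.arr 5 i =
      if i = s.reg 13 then join (s.arr 5 (s.reg 13)) (s.reg 9) else s.arr 5 i := by
  have c0 : Changes [16] [5] 0 s (s.setReg 16 (s.arr 5 (s.reg 13))) :=
    (Changes.refl _ _ s).setReg (by decide) (by simp)
  refine Does.seq (Does.assign (by simp only [Expr.eval]; omega) ?_)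
  simp only [Expr.eval]
  have c1 : ∀ v, Changes [16] [5] 0 s
      ((s.setReg 16 (s.arr 5 (s.reg 13))).setArr 5 (s.reg 13) v) :=
    fun v => c0.setArr (by decide) (by decide) (by simp)
  refine Does.ite (fun h => Does.skip ⟨c0, fun i => ?_⟩) fun h =>
    Does.ite (fun h' => Does.write ?_ ?_ ⟨by simpa [Expr.eval] using c1 _, fun i => ?_⟩) fun h' =>
    Does.ite (fun g => Does.skip ⟨c0, fun i => ?_⟩) fun g =>
    Does.ite (fun g' => Does.write ?_ ?_ ⟨by simpa [Expr.eval] using c1 _, fun i => ?_⟩) fun g' =>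
    Does.write ?_ ?_ ⟨by simpa [Expr.eval] using c1 _, fun i => ?_⟩
  all_goals simp [Test.holds, Expr.eval] at *
  all_goals (try omega)
  all_goals unfold join; grind

/-- The lists of the cell with the index in register `13` after one more child with the label and
the lists in the registers `9`, `10` and `11`. -/
def selectProg : Prog :=
  .ite (.lt (.reg 9) (.const 2)) .skip <|
  .seq (.ite (.eq (.read 8 (.reg 13)) (.const 0)) (.write 8 (.reg 13) (.reg 10)) .skip)
    (.write 9 (.reg 13) (.reg 11))

section
variable {w n K j y : ℕ} {s : Store} {F G : ℕ → ℕ → List ℕ} {l l' : List ℕ}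

theorem upd_self : upd F y j (F y j) = F := by
  funext v k
  simp only [upd]
  split_ifs with h
  · rw [h.1, h.2]
  · rfl

theorem selectProg_spec (h8 : Tab n K 8 F s) (h9 : Tab n K 9 G s) (hy : y ≤ n) (hj : j < K)
    (h13 : s.reg 13 = j * (n + 1) + y) (hl : Holds n s (s.reg 10) l) (hl' : Holds n s (s.reg 11) l')
    (hn : n < s.reg 3) (hw : s.reg 3 < 2 ^ w) (hw' : K * (n + 1) ≤ 2 ^ w) :
    Does w selectProg s fun s' => Changes [] [8, 9] 0 s s' ∧
      Tab n K 8 (upd F y j (if 2 ≤ s.reg 9 ∧ F y j = [] then l else F y j)) s' ∧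
      Tab n K 9 (upd G y j (if 2 ≤ s.reg 9 then l' else G y j)) s' := by
  have hlt := hl.lt hn
  have hlt' := hl'.lt hn
  have hcell := cell_lt hy hj
  have hnil := (h8 y hy j hj).eq_nil_iff
  rw [← h13] at hnil
  refine Does.ite (fun h => Does.skip ⟨.refl _ _ _, ?_⟩) fun h => ?_
  · simp only [Test.holds, Expr.eval] at h
    rw [if_neg (by omega), if_neg (by omega), upd_self, upd_self]
    exact ⟨h8, h9⟩
  simp only [Test.holds, Expr.eval, not_lt] at h
  simp only [h, true_and, if_true]
  refine Does.seq (Does.ite (fun h' => Does.write ?_ ?_ (Does.write ?_ ?_ ⟨?_, ?_, ?_⟩))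
    fun h' => Does.skip (Does.write ?_ ?_ ⟨?_, ?_, ?_⟩))
  all_goals simp only [Test.holds, Expr.eval, setArr_reg] at *
  any_goals omega
  · exact ((Changes.refl _ _ s).setArr (by decide) (by decide) (by simp)).setArr (by decide)
      (by decide) (by simp)
  · rw [if_pos (hnil.2 h'), h13]
    exact (h8.setArr (by decide) (by decide) hy hl).changes (changes_setArr (by decide) (by decide))
      (by decide)
  · rw [h13]
    exact (h9.changes (changes_setArr (a := 8) (by decide) (by decide)) (by decide)).setArr
      (by decide) (by decide) hy (hl'.changes (changes_setArr (by decide) (by decide)))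
  · exact (Changes.refl _ _ s).setArr (by decide) (by decide) (by simp)
  · rw [if_neg (fun h0 => h' (hnil.1 h0)), upd_self]
    exact h8.changes (changes_setArr (by decide) (by decide)) (by decide)
  · rw [h13]
    exact h9.setArr (by decide) (by decide) hy hl'

end

/-- Passing the level in register `5` of a vertex on to its parent. -/
def pushProg : Prog :=
  .seq (append 6 (.add (.reg 13) (.reg 1)) (.reg 8)) <|
  .seq (.ite (.eq (.reg 9) (.const 2)) .skip (append 7 (.reg 13) (.reg 15))) <|
  .seq selectProg joinProg

theorem pushProg_spec {w n K j y : ℕ} {s : Store} {A : ℕ → Acc} {d : Node} (hT : Table n K A s)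
    (hy : y ≤ n) (hj : j < K) (h1 : s.reg 1 = n + 1) (h13 : s.reg 13 = j * (n + 1) + y)
    (h9 : s.reg 9 = d.lab j) (h8 : Holds n s (s.reg 8) (d.cl (j + 1)))
    (h15 : Holds n s (s.reg 15) (d.side j)) (h10 : Holds n s (s.reg 10) (d.fst j))
    (h11 : Holds n s (s.reg 11) (d.snd j)) (hst : (A y).st j ≤ 6) (hlab : d.lab j ≤ 6)
    (hn : n < s.reg 3) (hw : s.reg 3 + 8 < 2 ^ w) (hw' : (K + 1) * (n + 1) ≤ 2 ^ w) :
    Does w pushProg s fun s' => Table n K (Function.update A y ((A y).pushAt d j)) s' ∧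
      Changes [16, 20, 21, 3] [5, 6, 7, 8, 9, 10, 11] 2 s s' := by
  have hcell := cell_lt hy (Nat.lt_succ_of_lt hj)
  have hwK : K * (n + 1) ≤ 2 ^ w := (Nat.mul_le_mul_right _ (Nat.le_succ K)).trans hw'
  refine Does.seq ((append_spec (y := y) (j := j + 1) (f := .reg 8) (by decide) (by decide) hT.kids ?_ hy
    (by omega) ?_ h8 hn (by omega) hw').imp fun s₁ ⟨t6, c₁⟩ => ?_)
  · intro s' e1 e13
    simp only [Expr.eval, e1, e13, h1, h13]
    ring
  · intro v; simp [Expr.eval]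
  have l1 := c₁.grows.le
  have l1' := c₁.grows.le_add
  refine Does.seq (Runs.imp (Q := fun s₂ => Tab n K 7 (upd (fun v => (A v).sides) y j
      (((A y).push d).sides j)) s₂ ∧ Changes [16, 20, 21, 3] [7, 10, 11] 1 s₁ s₂) ?_
      fun s₂ ⟨t7, c₂⟩ => ?_)
  · have t7 : Tab n K 7 (fun v => (A v).sides) s₁ := hT.sides.changes c₁ (by decide)
    refine Does.ite (fun h => Does.skip ⟨?_, (Changes.refl _ _ s₁).mono
        (List.Subset.refl _) (List.Subset.refl _) (Nat.zero_le _)⟩)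
      fun h => ?_
    · simp only [Test.holds, Expr.eval, c₁.reg 9 (by decide), h9] at h
      have : ((A y).push d).sides j = (A y).sides j := by simp [Acc.push, h]
      rw [this, upd_self (F := fun v => (A v).sides)]
      exact t7
    · simp only [Test.holds, Expr.eval, c₁.reg 9 (by decide), h9] at h
      have : ((A y).push d).sides j = (A y).sides j ++ d.side j := by simp [Acc.push, h]
      rw [this]
      refine append_spec (by decide) (by decide) t7 ?_ hy hj ?_ ?_ (by omega) (by omega) hwK
      · intro s' _ e13
        simp only [Expr.eval, e13, c₁.reg 13 (by decide), h13]
      · intro v; simp [Expr.eval]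
      · simp only [Expr.eval, c₁.reg 15 (by decide)]
        exact h15.changes c₁
  have l2 := c₂.grows.le
  have l2' := c₂.grows.le_add
  have e : ∀ x ∉ [16, 20, 21, 3], s₂.reg x = s.reg x :=
    fun x hx => (c₂.reg x hx).trans (c₁.reg x hx)
  refine Does.seq ((selectProg_spec (l := d.fst j) (l' := d.snd j)
    ((hT.fst.changes c₁ (by decide)).changes c₂ (by decide))
    ((hT.snd.changes c₁ (by decide)).changes c₂ (by decide)) hy hj ?_ ?_ ?_ (by omega) (by omega)
    hwK).imp fun s₃ ⟨c₃, t8, t9⟩ => ?_)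
  · rw [e 13 (by decide), h13]
  · rw [e 10 (by decide)]; exact (h10.changes c₁).changes c₂
  · rw [e 11 (by decide)]; exact (h11.changes c₁).changes c₂
  have e13 : s₃.reg 13 = j * (n + 1) + y := by rw [c₃.reg 13 (by decide), e 13 (by decide), h13]
  have e9 : s₃.reg 9 = d.lab j := by rw [c₃.reg 9 (by decide), e 9 (by decide), h9]
  have e5 : s₃.arr 5 = s.arr 5 := by
    rw [c₃.arr 5 (by decide), c₂.arr 5 (by decide), c₁.arr 5 (by decide)]
  rw [e 9 (by decide), h9] at t8 t9
  rw [Nat.add_mul, Nat.one_mul] at hw'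
  have hcell' := cell_lt hy hj
  have h5 : s₃.arr 5 (s₃.reg 13) = (A y).st j := by rw [e5, e13]; exact hT.st y hy j hj
  refine (joinProg_spec (w := w) (s := s₃) (by omega) (by omega) (by omega) (by omega)).imp
    fun s₄ ⟨c₄, t5⟩ => ⟨⟨?_, ?_, ?_, ?_, ?_⟩, ?_⟩
  · intro v hv k hk
    simp only [t5, e13, e9, e5, cell_inj hv hy]
    by_cases hvy : v = y
    · subst hvy
      by_cases hkj : k = j
      · simp [hkj, Acc.pushAt, Acc.push, hT.st v hv j hj]
      · simp [hkj, Acc.pushAt, hT.st v hv k hk]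
    · simp [hvy, hT.st v hv k hk]
  · have := ((t6.changes c₂ (by decide)).changes c₃ (by decide)).changes c₄ (by decide)
    convert this using 1
    funext v k
    by_cases hvy : v = y
    · subst hvy
      by_cases hkj : k = j + 1
      · simp [hkj, Acc.pushAt, Acc.push, upd]
      · simp [hkj, Acc.pushAt, upd]
    · simp [hvy, upd]
  · have := (t7.changes c₃ (by decide)).changes c₄ (by decide)
    convert this using 1
    funext v k
    by_cases hvy : v = y
    · subst hvy
      by_cases hkj : k = j
      · simp [hkj, Acc.pushAt, upd]
      · simp [hkj, Acc.pushAt, upd]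
    · simp [hvy, upd]
  · have := t8.changes c₄ (by decide)
    convert this using 1
    funext v k
    by_cases hvy : v = y
    · subst hvy
      by_cases hkj : k = j
      · simp [hkj, Acc.pushAt, Acc.push, upd]
      · simp [hkj, Acc.pushAt, upd]
    · simp [hvy, upd]
  · have := t9.changes c₄ (by decide)
    convert this using 1
    funext v k
    by_cases hvy : v = y
    · subst hvy
      by_cases hkj : k = j
      · simp [hkj, Acc.pushAt, Acc.push, upd]
      · simp [hkj, Acc.pushAt, upd]
    · simp [hvy, upd]
  · exact (((c₁.mono (by simp) (by simp) le_rfl).trans (c₂.mono (by simp) (by simp) le_rfl)).trans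
      (c₃.mono (by simp) (by simp) le_rfl)).trans (c₄.mono (by simp) (by simp) le_rfl)

/-! ### Processing all vertices -/

theorem join_le {s t : ℕ} (hs : s ≤ 6) (ht : t ≤ 6) : join s t ≤ 6 := by
  unfold join
  split_ifs <;> omega

theorem scan_le {st : ℕ → ℕ} (h : ∀ k, st k ≤ 6) (K : ℕ) : (scan st K).2 ≤ 6 := by
  induction K with
  | zero => simp [scan]
  | succ k ih =>
    have := h k
    rw [scan]
    split_ifs <;> grind

theorem Node.of_lab_le {a : Acc} (h : ∀ k, a.st k ≤ 6) (x K k : ℕ) : (Node.of x K a).lab k ≤ 6 := by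
  simp only [Node.of, labOf]
  split_ifs
  · omega
  · exact scan_le h K
  · exact h k

/-- The layout of the vertex in register `4` as a side vertex. -/
def sideProg : Prog :=
  .ite (.conj (.eq (.reg 7) (.const 5)) (.lt (.reg 5) (.reg 6))) (.assign 15 (.const 0))
    (cat 15 (.read 6 (.add (.reg 12) (.reg 1))) (.add (.reg 4) (.const 1)))

/-- The layout for the levels up to the one in register `5`. -/
def layoutProg : Prog :=
  .ite (.eq (.reg 9) (.const 1)) (.assign 8 (.reg 11)) <|
  .ite (.eq (.reg 9) (.const 2)) (.assign 8 (.reg 11)) <|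
  .seq (cat 8 (.reg 10) (.reg 8)) (cat 8 (.reg 8) (.reg 11))

section
variable {w n K k x : ℕ} {s : Store} {a : Acc}

theorem sideProg_spec (h4 : s.reg 4 = x) (h5 : s.reg 5 = k) (hx : x < n)
    (hkids : Holds n s (s.arr 6 (s.reg 12 + s.reg 1)) (a.kids (k + 1)))
    (hn : n < s.reg 3) (hw : s.reg 3 + 1 < 2 ^ w) :
    Does w sideProg s fun s' => Holds n s' (s'.reg 15) (sideOf (s.reg 6) (s.reg 7) x a k) ∧
      Changes [15, 20, 21, 3] [10, 11] 1 s s' := by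
  refine Does.ite (fun h => Does.assign (by simp [Expr.eval]) ⟨?_, ?_⟩) fun h => ?_
  · simp only [Test.holds, Expr.eval, h5] at h
    rw [sideOf, if_pos h]
    exact holds_nil _
  · exact ((Changes.refl [15, 20, 21, 3] [10, 11] s).setReg (by decide) (by simp)).mono
      (List.Subset.refl _) (List.Subset.refl _) (by omega)
  · simp only [Test.holds, Expr.eval, h5] at h
    rw [sideOf, if_neg h]
    refine (cat_spec (n := n) (l := a.kids (k + 1)) (l' := [x]) (by decide) ?_ ?_ ?_ hn hw).imp
      fun s' q => ⟨q.holds, q.changes⟩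
    · simpa [Expr.eval] using hkids
    · intro v; simp [Expr.eval]
    · simpa [Expr.eval, h4] using holds_leaf s hx

theorem layoutProg_spec {d : Node} (h9 : s.reg 9 = d.lab k) (h8 : Holds n s (s.reg 8) (d.cl k))
    (h10 : Holds n s (s.reg 10) (d.fst k)) (h11 : Holds n s (s.reg 11) (d.snd k))
    (hcl : d.cl (k + 1) = if d.lab k = 1 ∨ d.lab k = 2 then d.snd k
      else d.fst k ++ d.cl k ++ d.snd k)
    (hn : n < s.reg 3) (hw : s.reg 3 + 2 < 2 ^ w) :
    Does w layoutProg s fun s' => Holds n s' (s'.reg 8) (d.cl (k + 1)) ∧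
      Changes [8, 20, 21, 3] [10, 11] 2 s s' := by
  have hlt := h11.lt hn
  have c : Changes [8, 20, 21, 3] [10, 11] 2 s (s.setReg 8 (s.reg 11)) :=
    ((Changes.refl [8, 20, 21, 3] [10, 11] s).setReg (by decide) (by simp)).mono
      (List.Subset.refl _) (List.Subset.refl _) (by omega)
  refine Does.ite (fun h => Does.assign (by simp only [Expr.eval]; omega) ⟨?_, c⟩) fun h =>
    Does.ite (fun h' => Does.assign (by simp only [Expr.eval]; omega) ⟨?_, c⟩) fun h' => ?_
  · simp only [Test.holds, Expr.eval, h9] at h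
    rw [hcl, if_pos (Or.inl h)]
    exact h11.changes c
  · simp only [Test.holds, Expr.eval, h9] at h'
    rw [hcl, if_pos (Or.inr h')]
    exact h11.changes c
  · simp only [Test.holds, Expr.eval, h9] at h h'
    rw [hcl, if_neg (by tauto)]
    refine Does.seq ((cat_spec (n := n) (l := d.fst k) (l' := d.cl k) (by decide) h10 ?_ h8 hn
      (by omega)).imp fun s₁ q => ?_)
    · intro v; simp [Expr.eval]
    have c₁ := q.changes
    have l1 := q.grows.le
    have l1' := q.grows.le_add
    refine (cat_spec (n := n) (l := d.fst k ++ d.cl k) (l' := d.snd k) (by decide) q.holds ?_ ?_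
      (by omega) (by omega)).imp fun s₂ q' => ⟨q'.holds, c₁.trans q'.changes⟩
    · intro v; simp [Expr.eval]
    · simp only [Expr.eval, c₁.reg 11 (by decide)]
      exact h11.changes c₁

end

/-- Processing the level in register `5` of the vertex in register `4` with the parent in
register `14`. -/
def levelProg : Prog :=
  .seq (.assign 12 (.add (.mul (.reg 5) (.reg 1)) (.reg 4))) <|
  .seq (.assign 13 (.add (.mul (.reg 5) (.reg 1)) (.reg 14))) <|
  .seq labelProg <| .seq sideProg <| .seq layoutProg <| .seq pushProg <|
  .assign 5 (.add (.reg 5) (.const 1))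

theorem levelProg_spec {w n K j x y : ℕ} {s : Store} {A : ℕ → Acc} {d : Node}
    (hd : d = Node.of x K (A x)) (hT : Table n K A s) (hx : x < n) (hy : y ≤ n) (hj : j < K)
    (h1 : s.reg 1 = n + 1) (h4 : s.reg 4 = x) (h5 : s.reg 5 = j) (h6 : s.reg 6 = d.base)
    (h7 : s.reg 7 = d.kind) (h14 : s.reg 14 = y) (h8 : Holds n s (s.reg 8) (d.cl j))
    (hstx : ∀ k, (A x).st k ≤ 6) (hsty : (A y).st j ≤ 6) (hn : n < s.reg 3)
    (hw : s.reg 3 + 16 < 2 ^ w) (hw' : (K + 1) * (n + 1) ≤ 2 ^ w) (hKn : K ≤ n) :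
    Does w levelProg s fun s' => Table n K (Function.update A y ((A y).pushAt d j)) s' ∧
      Holds n s' (s'.reg 8) (d.cl (j + 1)) ∧ s'.reg 5 = j + 1 ∧
      Changes [5, 8, 9, 10, 11, 12, 13, 15, 16, 20, 21, 3] [5, 6, 7, 8, 9, 10, 11] 8 s s' := by
  have hcx : j * (n + 1) + x < (K + 1) * (n + 1) := cell_lt hx.le (by omega)
  have hcy : j * (n + 1) + y < (K + 1) * (n + 1) := cell_lt hy (by omega)
  refine Does.seq (Does.assign (by simp only [Expr.eval, h1, h4, h5]; omega) ?_)
  refine Does.seq (Does.assign (by simp [Expr.eval, h1, h5, h14]; omega) ?_)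
  simp only [Expr.eval, h1, h4, h5, setReg_reg, h14]
  norm_num
  set X := [5, 8, 9, 10, 11, 12, 13, 15, 16, 20, 21, 3] with hX
  set Y := [5, 6, 7, 8, 9, 10, 11] with hY
  have c : Changes X Y 0 s ((s.setReg 12 (j * (n + 1) + x)).setReg 13 (j * (n + 1) + y)) :=
    ((Changes.refl X Y s).setReg (by decide) (by simp [hX])).setReg (by decide) (by simp [hX])
  have r12 : ((s.setReg 12 (j * (n + 1) + x)).setReg 13 (j * (n + 1) + y)).reg 12 =
    j * (n + 1) + x := by simp
  have r13 : ((s.setReg 12 (j * (n + 1) + x)).setReg 13 (j * (n + 1) + y)).reg 13 =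
    j * (n + 1) + y := by simp
  have r : ∀ z, z ≠ 12 → z ≠ 13 →
      ((s.setReg 12 (j * (n + 1) + x)).setReg 13 (j * (n + 1) + y)).reg z = s.reg z := by
    intro z h h'; simp [h, h']
  have ra : ((s.setReg 12 (j * (n + 1) + x)).setReg 13 (j * (n + 1) + y)).arr = s.arr := rfl
  generalize (s.setReg 12 (j * (n + 1) + x)).setReg 13 (j * (n + 1) + y) = s₁ at *
  have hT₁ : Table n K A s₁ :=
    ⟨by rw [ra]; exact hT.st, fun v hv k hk => by rw [ra]; exact (hT.kids v hv k hk).changes c,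
      fun v hv k hk => by rw [ra]; exact (hT.sides v hv k hk).changes c,
      fun v hv k hk => by rw [ra]; exact (hT.fst v hv k hk).changes c,
      fun v hv k hk => by rw [ra]; exact (hT.snd v hv k hk).changes c⟩
  have e3 := r 3 (by decide) (by decide)
  have e6 := (r 6 (by decide) (by decide)).trans h6
  have e7 := (r 7 (by decide) (by decide)).trans h7
  have hkind : d.kind ≤ 6 := by rw [hd]; exact scan_le hstx K
  refine Does.seq ((labelProg_spec (w := w) (n := n) (k := j) (x := x) (a := A x) (s := s₁)
    ?_ ?_ hx ?_ ?_ ?_ ?_ ?_ (hstx j) ?_ (by omega) (by omega)).imp fun s₂ ⟨g9, g10, g11, c₂⟩ => ?_)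
  · rw [r 4 (by decide) (by decide), h4]
  · rw [r 5 (by decide) (by decide), h5]
  · rw [r12]; exact hT₁.st x hx.le j hj
  · rw [r12]; exact hT₁.kids x hx.le j (by omega)
  · rw [r12]; exact hT₁.sides x hx.le j hj
  · rw [r12]; exact hT₁.fst x hx.le j hj
  · rw [r12]; exact hT₁.snd x hx.le j hj
  · omega
  rw [e6, e7] at g9 g10 g11
  have hlab : labOf d.base d.kind (A x).st j = d.lab j := by rw [hd]; rfl
  have hfst : fstOf d.base d.kind x (A x) j = d.fst j := by rw [hd]; rfl
  have hsnd : sndOf d.base d.kind x (A x) j = d.snd j := by rw [hd]; rfl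
  have hside : sideOf d.base d.kind x (A x) j = d.side j := by rw [hd]; rfl
  rw [hlab] at g9
  rw [hfst] at g10
  rw [hsnd] at g11
  have l2 := c₂.grows.le
  have l2' := c₂.grows.le_add
  have hT₂ := hT₁.changes c₂ (by decide) (by decide) (by decide) (by decide) (by decide)
  refine Does.seq ((sideProg_spec (w := w) (n := n) (k := j) (x := x) (a := A x) (s := s₂)
    ?_ ?_ hx ?_ (by omega) (by omega)).imp fun s₃ ⟨g15, c₃⟩ => ?_)
  · rw [c₂.reg 4 (by decide), r 4 (by decide) (by decide), h4]
  · rw [c₂.reg 5 (by decide), r 5 (by decide) (by decide), h5]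
  · rw [c₂.reg 12 (by decide), r12, c₂.reg 1 (by decide), r 1 (by decide) (by decide), h1]
    have := hT₂.kids x hx.le (j + 1) (by omega)
    rwa [show (j + 1) * (n + 1) + x = j * (n + 1) + x + (n + 1) by ring] at this
  rw [c₂.reg 6 (by decide), c₂.reg 7 (by decide), e6, e7, hside] at g15
  have l3 := c₃.grows.le
  have l3' := c₃.grows.le_add
  refine Does.seq ((layoutProg_spec (w := w) (n := n) (k := j) (d := d) (s := s₃)
    ?_ ?_ ?_ ?_ ?_ (by omega) (by omega)).imp fun s₄ ⟨g8, c₄⟩ => ?_)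
  · rw [c₃.reg 9 (by decide), g9]
  · rw [c₃.reg 8 (by decide), c₂.reg 8 (by decide), r 8 (by decide) (by decide)]
    exact ((h8.changes c).changes c₂).changes c₃
  · rw [c₃.reg 10 (by decide)]; exact g10.changes c₃
  · rw [c₃.reg 11 (by decide)]; exact g11.changes c₃
  · rw [hd]; rfl
  have l4 := c₄.grows.le
  have l4' := c₄.grows.le_add
  have hT₄ := (hT₂.changes c₃ (by decide) (by decide) (by decide) (by decide) (by decide)).changes
    c₄ (by decide) (by decide) (by decide) (by decide) (by decide)
  refine Does.seq ((pushProg_spec (w := w) (n := n) (j := j) (y := y) (d := d) (s := s₄)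
    hT₄ hy hj ?_ ?_ ?_ g8 ?_ ?_ ?_ hsty ?_ (by omega) (by omega) hw').imp fun s₅ ⟨hT₅, c₅⟩ => ?_)
  · rw [c₄.reg 1 (by decide), c₃.reg 1 (by decide), c₂.reg 1 (by decide),
      r 1 (by decide) (by decide), h1]
  · rw [c₄.reg 13 (by decide), c₃.reg 13 (by decide), c₂.reg 13 (by decide), r13]
  · rw [c₄.reg 9 (by decide), c₃.reg 9 (by decide), g9]
  · rw [c₄.reg 15 (by decide)]; exact g15.changes c₄
  · rw [c₄.reg 10 (by decide), c₃.reg 10 (by decide)]; exact (g10.changes c₃).changes c₄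
  · rw [c₄.reg 11 (by decide), c₃.reg 11 (by decide)]; exact (g11.changes c₃).changes c₄
  · rw [hd]; exact Node.of_lab_le hstx x K j
  have e5 : s₅.reg 5 = j := by
    rw [c₅.reg 5 (by decide), c₄.reg 5 (by decide), c₃.reg 5 (by decide), c₂.reg 5 (by decide),
      r 5 (by decide) (by decide), h5]
  have c₆ : Changes X Y 8 s s₅ :=
    (((((c.trans (c₂.mono (by simp [hX]) (by simp [hY]) le_rfl)).trans
      (c₃.mono (by simp [hX]) (by simp [hY]) le_rfl)).trans
      (c₄.mono (by simp [hX]) (by simp [hY]) le_rfl)).trans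
      (c₅.mono (by simp [hX]) (by simp [hY]) le_rfl)))
  refine Does.assign (by simp only [Expr.eval]; omega) ⟨?_, ?_, ?_, c₆.setReg (by decide) (by simp [hX])⟩
  · exact hT₅.changes (changes_setReg (by decide)) (by decide) (by decide) (by decide) (by decide)
      (by decide)
  · rw [setReg_reg, if_neg (by decide), c₅.reg 8 (by decide)]
    exact (g8.changes c₅).setReg (by decide)
  · simp [Expr.eval, e5]

/-- Processing the vertex below the one in register `4`. -/
def vertexProg : Prog :=
  .seq (.assign 4 (.sub (.reg 4) (.const 1))) <| .seq scanProg <|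
  .seq (.assign 14 (.read 4 (.reg 4))) <| .seq (.assign 8 (.const 0)) <|
  .seq (.assign 5 (.const 0)) <| .loop (.lt (.reg 5) (.reg 2)) levelProg

/-- The cost of processing a vertex with `K` levels. -/
def vertexTime (K : ℕ) : ℕ :=
  4 + (scanTime K + (3 + (2 + (2 + ((size levelProg + (Test.lt (.reg 5) (.reg 2)).cost + 1) * K +
    (Test.lt (.reg 5) (.reg 2)).cost + 1)))))

theorem vertexProg_spec {w n K x y : ℕ} {s : Store} {A : ℕ → Acc} {d : Node}
    (hd : d = Node.of x K (A x)) (hT : Table n K A s) (hx : x < n) (hy : y ≤ n) (hxy : x ≠ y)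
    (h1 : s.reg 1 = n + 1) (h2 : s.reg 2 = K) (h4 : s.reg 4 = x + 1) (hpar : s.arr 4 x = y)
    (hst : ∀ v k, (A v).st k ≤ 6) (hn : n < s.reg 3) (hw : s.reg 3 + 8 * K + 16 < 2 ^ w)
    (hw' : (K + 1) * (n + 1) ≤ 2 ^ w) (hKn : K ≤ n) :
    Runs w vertexProg s (vertexTime K) fun s' =>
      Table n K (Function.update A y ((A y).push d)) s' ∧ Holds n s' (s'.reg 8) (d.cl K) ∧
      s'.reg 4 = x ∧ Changes [4, 5, 6, 7, 8, 9, 10, 11, 12, 13, 14, 15, 16, 20, 21, 3]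
        [5, 6, 7, 8, 9, 10, 11] (8 * K) s s' := by
  set X := [4, 5, 6, 7, 8, 9, 10, 11, 12, 13, 14, 15, 16, 20, 21, 3] with hX
  set Y := [5, 6, 7, 8, 9, 10, 11] with hY
  refine Runs.seq (Does.assign (by simp only [Expr.eval]; omega) ?_)
  simp only [Expr.eval, h4, Nat.add_sub_cancel]
  have c₀ : Changes X Y 0 s (s.setReg 4 x) :=
    (Changes.refl X Y s).setReg (by decide) (by simp [hX])
  have r4 : (s.setReg 4 x).reg 4 = x := by simp
  have r : ∀ z, z ≠ 4 → (s.setReg 4 x).reg z = s.reg z := by intro z h; simp [h]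
  have hT₀ : Table n K A (s.setReg 4 x) :=
    hT.changes (changes_setReg (by decide)) (by decide) (by decide) (by decide) (by decide)
      (by decide)
  have ha : (s.setReg 4 x).arr 4 x = y := hpar
  generalize s.setReg 4 x = s₀ at *
  refine Runs.seq ((scanProg_spec (w := w) (K := K) (st := (A x).st) (s := s₀) ?_ ?_ (hst x)
    (by omega)).imp fun s₁ ⟨g, c₁⟩ => ?_)
  · rw [r 2 (by decide), h2]
  · intro k hk
    rw [r 1 (by decide), h1, r4]
    exact hT₀.st x hx.le k hk
  have l0 := c₀.grows.le_add
  have l0' := c₀.grows.le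
  have l1 := c₁.grows.le_add
  have l1' := c₁.grows.le
  have e4 : s₁.reg 4 = x := by rw [c₁.reg 4 (by decide), r4]
  have ey : s₁.arr 4 x = y := by rw [c₁.arr 4 (by decide), ha]
  refine Runs.seq (Does.assign (by simp only [Expr.eval, e4, ey]; omega) ?_)
  refine Runs.seq (Does.assign (by simp [Expr.eval]) ?_)
  refine Runs.seq (Does.assign (by simp [Expr.eval]) ?_)
  simp only [Expr.eval, e4, ey]
  have c₂ : Changes X [] 0 s₀ (((s₁.setReg 14 y).setReg 8 0).setReg 5 0) :=
    (((c₁.mono (by simp [hX]) (by simp) le_rfl).setReg (by decide)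
      (by simp [hX])).setReg (by decide) (by simp [hX])).setReg (by decide) (by simp [hX])
  have e : ∀ z, z ≠ 14 → z ≠ 8 → z ≠ 5 →
      (((s₁.setReg 14 y).setReg 8 0).setReg 5 0).reg z = s₁.reg z := by
    intro z h h' h''; simp [h, h', h'']
  have e14 : (((s₁.setReg 14 y).setReg 8 0).setReg 5 0).reg 14 = y := by simp
  have e8 : (((s₁.setReg 14 y).setReg 8 0).setReg 5 0).reg 8 = 0 := by simp
  have e5 : (((s₁.setReg 14 y).setReg 8 0).setReg 5 0).reg 5 = 0 := by simp
  generalize ((s₁.setReg 14 y).setReg 8 0).setReg 5 0 = s₂ at *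
  have hT₂ := hT₀.changes c₂ (by simp) (by simp) (by simp) (by simp) (by simp)
  have l2 := c₂.grows.le_add
  have l2' := c₂.grows.le
  have f1 : s₂.reg 1 = n + 1 := by
    rw [e 1 (by decide) (by decide) (by decide), c₁.reg 1 (by decide), r 1 (by decide), h1]
  have f2 : s₂.reg 2 = K := by
    rw [e 2 (by decide) (by decide) (by decide), c₁.reg 2 (by decide), r 2 (by decide), h2]
  have f4 : s₂.reg 4 = x := by rw [e 4 (by decide) (by decide) (by decide), e4]
  have f6 : s₂.reg 6 = d.base := by
    rw [e 6 (by decide) (by decide) (by decide), hd]; exact congrArg Prod.fst g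
  have f7 : s₂.reg 7 = d.kind := by
    rw [e 7 (by decide) (by decide) (by decide), hd]; exact congrArg Prod.snd g
  set X' := [5, 8, 9, 10, 11, 12, 13, 15, 16, 20, 21, 3] with hX'
  have hcl : d.cl 0 = [] := by rw [hd]; rfl
  refine (runs_for (fun j s' => Table n K (Function.update A y ((A y).pushBelow d j)) s' ∧
    Holds n s' (s'.reg 8) (d.cl j) ∧ s'.reg 5 = j ∧ Changes X' Y (8 * j) s₂ s') K (size levelProg)
    ?_ ?_ ⟨?_, ?_, e5, ?_⟩).imp ?_
  · rintro j s' hj ⟨t, t8, t5, c⟩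
    have l := c.grows.le
    have l' := c.grows.le_add
    refine (levelProg_spec (w := w) (d := d) (A := Function.update A y ((A y).pushBelow d j)) ?_ t hx
      hy hj ?_ ?_ t5 ?_ ?_ ?_ t8 ?_ ?_ (by omega) (by omega) hw' hKn).imp ?_
    · rw [Function.update_of_ne hxy, hd]
    · rw [c.reg 1 (by decide), f1]
    · rw [c.reg 4 (by decide), f4]
    · rw [c.reg 6 (by decide), f6]
    · rw [c.reg 7 (by decide), f7]
    · rw [c.reg 14 (by decide), e14]
    · rw [Function.update_of_ne hxy]; exact hst x
    · simp only [Function.update_self, Acc.pushBelow, lt_irrefl, if_false]; exact hst y j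
    · rintro s'' ⟨u, u8, u5, c'⟩
      refine ⟨?_, u8, u5, (c.trans c').mono (List.Subset.refl _) (List.Subset.refl _) (by omega)⟩
      simpa [Acc.pushBelow_succ] using u
  · rintro j s' hj ⟨t, t8, t5, c⟩
    simp [Test.holds, Expr.eval, t5, c.reg 2 (by decide), f2]
  · rw [Acc.pushBelow_zero _ _ hcl, Function.update_eq_self]; exact hT₂
  · rw [e8, hcl]; exact holds_nil _
  · exact Changes.refl _ _ _
  · rintro s' ⟨t, t8, t5, c⟩
    refine ⟨?_, t8, ?_, ((c₀.trans (c₂.mono (List.Subset.refl _) (by simp) le_rfl)).trans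
      (c.mono (by simp [hX, hX']) (List.Subset.refl _) le_rfl)).mono (List.Subset.refl _)
      (List.Subset.refl _) (by omega)⟩
    · refine t.congr ?_ ?_ ?_ ?_ ?_ <;> intro v hv k hk <;> by_cases hvy : v = y
      all_goals simp [hvy, Acc.pushBelow, hk]
    · rw [c.reg 4 (by decide), f4]

/-! ### The bottom-up pass -/

/-- The last `m` of the vertices below `n`, in decreasing order. -/
def lastVertices (n m : ℕ) : List ℕ := (List.range m).map fun i => n - 1 - i

/-- Those of the last `m` vertices below `n` with the parent `v`. -/
def childrenAmong (pp : ℕ → ℕ) (n m v : ℕ) : List ℕ := (lastVertices n m).filter (pp · = v)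

/-- Parents precede their children.  The root `0` is given the parent `n`, which is not a vertex but
has cells in the tables, so that the root needs no special treatment. -/
structure IsParent (n : ℕ) (pp : ℕ → ℕ) : Prop where
  zero : pp 0 = n
  lt : ∀ x, 0 < x → x < n → pp x < x

section
variable {n m v u x K : ℕ} {pp : ℕ → ℕ}

theorem mem_lastVertices (hm : m ≤ n) : u ∈ lastVertices n m ↔ u < n ∧ n - m ≤ u := by
  simp only [lastVertices, List.mem_map, List.mem_range]
  constructor
  · rintro ⟨i, hi, rfl⟩
    omega
  · rintro ⟨h1, h2⟩
    exact ⟨n - 1 - u, by omega, by omega⟩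

theorem nodup_lastVertices (hm : m ≤ n) : (lastVertices n m).Nodup := by
  refine List.Nodup.map_on ?_ List.nodup_range
  intro i hi j hj h
  rw [List.mem_range] at hi hj
  omega

theorem mem_childrenAmong (hm : m ≤ n) :
    u ∈ childrenAmong pp n m v ↔ u < n ∧ n - m ≤ u ∧ pp u = v := by
  simp [childrenAmong, mem_lastVertices hm, and_assoc]

theorem nodup_childrenAmong (hm : m ≤ n) : (childrenAmong pp n m v).Nodup :=
  (nodup_lastVertices hm).filter _

theorem childrenAmong_succ : childrenAmong pp n (m + 1) v =
    childrenAmong pp n m v ++ if pp (n - 1 - m) = v then [n - 1 - m] else [] := by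
  simp only [childrenAmong, lastVertices, List.range_succ, List.map_append, List.filter_append]
  congr 1
  by_cases h : pp (n - 1 - m) = v <;> simp [h]

theorem IsParent.ne (h : IsParent n pp) (hu : u < n) (hx : u ≤ x) (hx' : x < n) : pp u ≠ x := by
  rcases Nat.eq_zero_or_pos u with rfl | h0
  · rw [h.zero]; omega
  · have := h.lt u h0 hu; omega

theorem IsParent.childrenAmong_eq (h : IsParent n pp) (hm : m ≤ n) (hx : n - 1 - m ≤ x)
    (hx' : x < n) : childrenAmong pp n m x = childrenAmong pp n n x := by
  induction hm using Nat.decreasingInduction with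
  | self => rfl
  | of_succ k hk ih =>
    rw [← ih (by omega), childrenAmong_succ, if_neg (h.ne (by omega) hx hx'), List.append_nil]

theorem collect_congr {N N' : ℕ → Node} {c : List ℕ} (h : ∀ u ∈ c, N u = N' u) :
    collect N c = collect N' c := by
  induction c using List.reverseRecOn with
  | nil => rfl
  | append_singleton c u ih =>
    rw [collect_append, collect_append, ih fun v hv => h v (by simp [hv]), h u (by simp)]

theorem IsParent.exists_nodes (h : IsParent n pp) (K : ℕ) :
    ∃ N : ℕ → Node, ∀ x < n, N x = Node.of x K (collect N (childrenAmong pp n n x)) := by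
  suffices H : ∀ m ≤ n, ∃ N : ℕ → Node, ∀ x < n, n - m ≤ x →
      N x = Node.of x K (collect N (childrenAmong pp n n x)) by
    obtain ⟨N, hN⟩ := H n le_rfl
    exact ⟨N, fun x hx => hN x hx (by omega)⟩
  intro m
  induction m with
  | zero => intro _; exact ⟨fun _ => Node.of 0 0 .empty, fun x hx hx' => by omega⟩
  | succ m ih =>
    intro hm
    obtain ⟨N, hN⟩ := ih (by omega)
    set y := n - 1 - m with hy
    refine ⟨Function.update N y (Node.of y K (collect N (childrenAmong pp n n y))), fun x hx hx' => ?_⟩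
    -- the children of `x` come after `x ≥ y`, so that the change at `y` does not concern them
    have hcongr : collect (Function.update N y (Node.of y K (collect N (childrenAmong pp n n y))))
        (childrenAmong pp n n x) = collect N (childrenAmong pp n n x) := by
      refine collect_congr fun u hu => Function.update_of_ne ?_ _ _
      rintro rfl
      rw [mem_childrenAmong le_rfl] at hu
      exact h.ne hu.1 (by omega) hx hu.2.2
    rw [hcongr]
    by_cases hxy : x = y
    · rw [hxy, Function.update_self]
    · rw [Function.update_of_ne hxy]
      exact hN x hx (by omega)

theorem IsParent.isLabelled (h : IsParent n pp) {N : ℕ → Node} (hK : n < 2 ^ K)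
    (hN : ∀ x < n, N x = Node.of x K (collect N (childrenAmong pp n n x))) :
    IsLabelled n K (fun u => if u < n then if u = 0 then 0 else pp u else 0)
      (fun x => if x < n then childrenAmong pp n n x else []) N where
  parent_lt u hu := by
    split_ifs
    · omega
    · exact h.lt u hu (by assumption)
    · exact hu
  mem_ch x u := by
    constructor
    · intro hu
      split_ifs at hu with hx
      · rw [mem_childrenAmong le_rfl] at hu
        have : u ≠ 0 := by
          rintro rfl
          rw [h.zero] at hu
          omega
        rw [if_pos hu.1, if_neg this]
        exact ⟨Nat.pos_of_ne_zero this, hu.1, hu.2.2⟩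
      · simp at hu
    · rintro ⟨h0, hu, hp⟩
      rw [if_pos hu, if_neg h0.ne'] at hp
      have := h.lt u h0 hu
      rw [if_pos (by omega), mem_childrenAmong le_rfl]
      exact ⟨hu, by omega, hp⟩
  nodup x := by
    split_ifs
    · exact nodup_childrenAmong le_rfl
    · exact List.nodup_nil
  eq x hx := by rw [if_pos hx]; exact hN x hx
  lt_pow := hK

end

/-- Processing the vertices below the number in register `4`, in decreasing order. -/
def passProg : Prog := .loop (.lt (.const 0) (.reg 4)) vertexProg

/-- The cost of the bottom-up pass. -/
def passTime (n K : ℕ) : ℕ :=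
  (vertexTime K + (Test.lt (.const 0) (.reg 4)).cost + 1) * n + (Test.lt (.const 0) (.reg 4)).cost + 1

theorem passProg_spec {w n K : ℕ} {s : Store} {pp : ℕ → ℕ} {N : ℕ → Node} (hp : IsParent n pp)
    (hN : ∀ x < n, N x = Node.of x K (collect N (childrenAmong pp n n x))) (h0 : 0 < n)
    (hT : Table n K (fun _ => .empty) s) (h1 : s.reg 1 = n + 1) (h2 : s.reg 2 = K)
    (h4 : s.reg 4 = n) (hpar : ∀ x < n, s.arr 4 x = pp x) (hn : n < s.reg 3)
    (hw : s.reg 3 + 8 * K * n + 16 < 2 ^ w) (hw' : (K + 1) * (n + 1) ≤ 2 ^ w) (hKn : K ≤ n) :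
    Runs w passProg s (passTime n K) fun s' => Holds n s' (s'.reg 8) ((N 0).cl K) ∧
      Changes [4, 5, 6, 7, 8, 9, 10, 11, 12, 13, 14, 15, 16, 20, 21, 3]
        [5, 6, 7, 8, 9, 10, 11] (8 * K * n) s s' := by
  set X := [4, 5, 6, 7, 8, 9, 10, 11, 12, 13, 14, 15, 16, 20, 21, 3] with hX
  set Y := [5, 6, 7, 8, 9, 10, 11] with hY
  refine (runs_for (fun m s' => Table n K (fun v => collect N (childrenAmong pp n m v)) s' ∧
    (∀ v k, (collect N (childrenAmong pp n m v)).st k ≤ 6) ∧ s'.reg 4 = n - m ∧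
    (0 < m → Holds n s' (s'.reg 8) ((N (n - m)).cl K)) ∧ Changes X Y (8 * K * m) s s') n
    (vertexTime K) ?_ ?_ ⟨?_, ?_, ?_, ?_, ?_⟩).imp ?_
  · rintro m s' hm ⟨t, t6, t4, t8, c⟩
    set x := n - 1 - m with hx
    have hle := c.grows.le
    have hle' := c.grows.le_add
    have hmul : 8 * K * m + 8 * K ≤ 8 * K * n := by
      calc 8 * K * m + 8 * K = 8 * K * (m + 1) := by ring
        _ ≤ _ := Nat.mul_le_mul_left _ hm
    have hpx : pp x ≤ n := by
      rcases Nat.eq_zero_or_pos x with h | h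
      · rw [h, hp.zero]
      · have := hp.lt x h (by omega); omega
    have hd : N x = Node.of x K (collect N (childrenAmong pp n m x)) := by
      rw [hp.childrenAmong_eq hm.le le_rfl (by omega)]
      exact hN x (by omega)
    have hstep : ∀ v, collect N (childrenAmong pp n (m + 1) v) = Function.update
        (fun v => collect N (childrenAmong pp n m v)) (pp x)
        ((collect N (childrenAmong pp n m (pp x))).push (N x)) v := by
      intro v
      rw [childrenAmong_succ]
      by_cases hv : v = pp x
      · subst hv
        rw [if_pos rfl, collect_append, Function.update_self]
      · rw [if_neg (fun h => hv h.symm), List.append_nil, Function.update_of_ne hv]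
    refine (vertexProg_spec (w := w) (x := x) (y := pp x) (d := N x) hd t (by omega) hpx
      (hp.ne (by omega) le_rfl (by omega)).symm ?_ ?_ ?_ ?_ t6 (by omega) (by omega) hw' hKn).imp ?_
    · rw [c.reg 1 (by decide), h1]
    · rw [c.reg 2 (by decide), h2]
    · omega
    · rw [c.arr 4 (by decide)]; exact hpar x (by omega)
    · rintro s'' ⟨u, u8, u4, c'⟩
      refine ⟨?_, ?_, by omega, fun _ => ?_, (c.trans c').mono (List.Subset.refl _)
        (List.Subset.refl _) (by rw [Nat.mul_succ])⟩
      · convert u using 1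
        funext v
        exact hstep v
      · intro v k
        rw [hstep v]
        by_cases hv : v = pp x
        · subst hv
          rw [Function.update_self]
          exact join_le (t6 _ _) (by rw [hd]; exact Node.of_lab_le (t6 x) x K k)
        · rw [Function.update_of_ne hv]; exact t6 v k
      · rw [show n - (m + 1) = x by omega]; exact u8
  · rintro m s' hm ⟨-, -, t4, -, -⟩
    simp only [Test.holds, Expr.eval, t4]
    omega
  · exact hT
  · intro v k; exact Nat.zero_le _
  · simpa using h4
  · intro h; omega
  · exact .refl _ _ _
  · rintro s' ⟨-, -, -, t8, c⟩
    have := t8 h0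
    rw [Nat.sub_self] at this
    exact ⟨this, c⟩

/-! ### Writing the output -/

/-- The cells of `f` below `m` represent the nonempty lists `ls`, the first one on top. -/
def Stack (n : ℕ) (L R : ℕ → ℕ) (h : ℕ) (f : ℕ → ℕ) : ℕ → List (List ℕ) → Prop
  | m, [] => m = 0
  | m, l :: ls => ∃ m', m = m' + 1 ∧ l ≠ [] ∧ Rep n L R h (f m') l ∧ Stack n L R h f m' ls

section
variable {n h m : ℕ} {L R f f' : ℕ → ℕ} {l : List ℕ} {ls : List (List ℕ)}

theorem Stack.congr (hs : Stack n L R h f m ls) (hf : ∀ i < m, f' i = f i) :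
    Stack n L R h f' m ls := by
  induction ls generalizing m with
  | nil => exact hs
  | cons l ls ih =>
    obtain ⟨m', rfl, h1, h2, h3⟩ := hs
    exact ⟨m', rfl, h1, by rwa [hf m' (by omega)], ih h3 fun i hi => hf i (by omega)⟩

theorem Stack.le (hs : Stack n L R h f m ls) : m ≤ ls.flatten.length := by
  induction ls generalizing m with
  | nil => exact Nat.le_of_eq hs
  | cons l ls ih =>
    obtain ⟨m', rfl, h1, h2, h3⟩ := hs
    have := List.length_pos_of_ne_nil h1
    have := ih h3
    simp only [List.flatten_cons, List.length_append]
    omega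

end

/-- One step of the traversal of the lists on the stack in array `12`, the height of which is in
register `17`; the next element goes to the position in register `19` of array `2`. -/
def popProg : Prog :=
  .seq (.assign 17 (.sub (.reg 17) (.const 1))) <|
  .seq (.assign 18 (.read 12 (.reg 17))) <|
  .ite (.lt (.reg 0) (.reg 18))
    (.seq (.write 12 (.reg 17) (.read 11 (.reg 18))) <|
      .seq (.write 12 (.add (.reg 17) (.const 1)) (.read 10 (.reg 18))) <|
      .assign 17 (.add (.reg 17) (.const 2)))
    (.seq (.write 2 (.reg 19) (.read 3 (.sub (.reg 18) (.const 1)))) <|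
      .assign 19 (.add (.reg 19) (.const 1)))

/-- Writing the list represented by register `8` to array `2`, with array `3` applied to the
elements. -/
def outputProg : Prog :=
  .seq (.write 12 (.const 0) (.reg 8)) <| .seq (.assign 17 (.const 1)) <|
  .seq (.assign 19 (.const 0)) <| .loop (.lt (.const 0) (.reg 17)) popProg

/-- The state of the traversal of the list `l`: the part `d` has been written, and the rest is
the concatenation of the lists `ls` on the stack. -/
structure Popping (n : ℕ) (l d : List ℕ) (ls : List (List ℕ)) (s₀ s : Store) : Prop where
  eq : d ++ ls.flatten = l
  stack : Stack n (s₀.arr 10) (s₀.arr 11) (s₀.reg 3) (s.arr 12) (s.reg 17) ls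
  reg : s.reg 19 = d.length
  out : ∀ i x, d[i]? = some x → s.arr 2 i = s₀.arr 3 x
  arr3 : s.arr 3 = s₀.arr 3
  arr10 : s.arr 10 = s₀.arr 10
  arr11 : s.arr 11 = s₀.arr 11
  reg0 : s.reg 0 = n

/-- The number of steps of the traversal of the lists on the stack: one for each element, and one for
each of the concatenations. -/
def popCount (ls : List (List ℕ)) : ℕ := (ls.map fun l => 2 * l.length - 1).sum

theorem popProg_spec {w n : ℕ} {l d : List ℕ} {ls : List (List ℕ)} {s₀ s : Store}
    (h : Popping n l d ls s₀ s) (h17 : 0 < s.reg 17) (hl : l.length ≤ n) (hn : n < s₀.reg 3)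
    (hq : ∀ x < n, s₀.arr 3 x < 2 ^ w) (hw : s₀.reg 3 + 2 < 2 ^ w) :
    Does w popProg s fun s' => ∃ d' ls', Popping n l d' ls' s₀ s' ∧
      popCount ls = popCount ls' + 1 := by
  have hstack := h.stack
  rcases ls with _ | ⟨l₁, ls⟩
  · have : s.reg 17 = 0 := hstack
    omega
  obtain ⟨m, hm, h1, h2, h3⟩ := hstack
  have hmle := h.stack.le
  have hlen := congrArg List.length h.eq
  rw [List.length_append] at hlen
  have hid := h2.lt hn
  refine Does.seq (Does.assign (by simp only [Expr.eval]; omega) ?_)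
  refine Does.seq (Does.assign (by simp [Expr.eval, hm]; omega) ?_)
  simp only [Expr.eval, hm, Nat.add_sub_cancel, setReg_reg, setReg_arr, if_true]
  generalize hi : s.arr 12 m = i at *
  cases h2 with
  | nil => exact absurd rfl h1
  | leaf hx =>
    rename_i x
    refine Does.ite (fun hb => ?_) fun hb => ?_
    · simp [Test.holds, Expr.eval, h.reg0] at hb
      omega
    simp only [List.flatten_cons, List.length_append, List.length_singleton] at hlen
    have hqx := hq x hx
    refine Does.seq (Does.write (by simp [Expr.eval, h.reg]; omega)
      (by simpa [Expr.eval, h.arr3] using hqx) ?_)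
    refine Does.assign (by simp [Expr.eval, h.reg]; omega) ?_
    refine ⟨d ++ [x], ls, ⟨?_, ?_, ?_, ?_, ?_, ?_, ?_, ?_⟩, ?_⟩
    · rw [← h.eq]; simp
    · simpa [Expr.eval] using h3.congr fun j _ => by simp
    · simp [Expr.eval, h.reg]
    · intro j y hj
      simp [Expr.eval, h.reg, h.arr3]
      split_ifs with hjd
      · rw [hjd] at hj
        simp at hj
        rw [hj]
      · refine h.out j y ?_
        have := (List.getElem?_eq_some_iff.1 hj).1
        simp at this
        rwa [List.getElem?_append_left (by omega)] at hj
    · funext j; simp [h.arr3]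
    · funext j; simp [h.arr10]
    · funext j; simp [h.arr11]
    · simp [h.reg0]
    · simp [popCount]; omega
  | node g1 g2 g3 g4 g5 g6 =>
    rename_i l₂ l₃
    have hL := g3.lt hn
    have hR := g4.lt hn
    refine Does.ite (fun hb => ?_) fun hb => ?_
    swap
    · simp [Test.holds, Expr.eval, h.reg0] at hb
      omega
    simp only [List.flatten_cons, List.length_append] at hlen hmle
    have e10 : ∀ j, s.arr 10 j = s₀.arr 10 j := fun j => by rw [h.arr10]
    have e11 : ∀ j, s.arr 11 j = s₀.arr 11 j := fun j => by rw [h.arr11]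
    refine Does.seq (Does.write (by simp [Expr.eval]; omega) (by simp [Expr.eval, e11]; omega) ?_)
    refine Does.seq (Does.write (by simp [Expr.eval]; omega) (by simp [Expr.eval, e10]; omega) ?_)
    refine Does.assign (by simp [Expr.eval]; omega) ?_
    refine ⟨d, l₂ :: l₃ :: ls, ⟨?_, ?_, ?_, ?_, ?_, ?_, ?_, ?_⟩, ?_⟩
    · rw [← h.eq]; simp
    · refine ⟨m + 1, by simp [Expr.eval], g5, ?_, m, rfl, g6, ?_, h3.congr fun j hj => ?_⟩
      · simpa [Expr.eval, e10] using g3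
      · simpa [Expr.eval, e11] using g4
      · simp [Expr.eval, show j ≠ m + 1 by omega, hj.ne]
    · simp [h.reg]
    · intro j y hj; simpa using h.out j y hj
    · funext j; simp [h.arr3]
    · funext j; simp [h.arr10]
    · funext j; simp [h.arr11]
    · simp [h.reg0]
    · have := List.length_pos_of_ne_nil g5
      have := List.length_pos_of_ne_nil g6
      simp [popCount]; omega

/-- The cost of writing a list of `n` elements. -/
def outputTime (n : ℕ) : ℕ :=
  3 + (2 + (2 + ((size popProg + (Test.lt (.const 0) (.reg 17)).cost + 1) * (2 * n) +
    (Test.lt (.const 0) (.reg 17)).cost + 1)))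

theorem outputProg_spec {w n : ℕ} {l : List ℕ} {s : Store} (h8 : Holds n s (s.reg 8) l)
    (hne : l ≠ []) (hl : l.length ≤ n) (h0 : s.reg 0 = n) (hn : n < s.reg 3)
    (hq : ∀ x < n, s.arr 3 x < 2 ^ w) (hw : s.reg 3 + 2 < 2 ^ w) :
    Runs w outputProg s (outputTime n) fun s' =>
      ∀ i x, l[i]? = some x → s'.arr 2 i = s.arr 3 x := by
  have hlt := h8.lt hn
  refine Runs.seq (Does.write (by simp only [Expr.eval]; omega) (by simp only [Expr.eval]; omega) ?_)
  refine Runs.seq (Does.assign (by simp only [Expr.eval]; omega) ?_)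
  refine Runs.seq (Does.assign (by simp only [Expr.eval]; omega) ?_)
  simp only [Expr.eval]
  refine (runs_while (fun a s' => ∃ d ls, Popping n l d ls s s' ∧ popCount ls = a) (size popProg) ?_
    (2 * l.length - 1) _ ⟨[], [l], ⟨?_, ?_, ?_, ?_, ?_, ?_, ?_, ?_⟩, ?_⟩).mono ?_ ?_
  · rintro a s' ⟨d, ls, hp, rfl⟩ hb
    simp only [Test.holds, Expr.eval] at hb
    obtain ⟨k, s'', e1, e2, d', ls', e3, e4⟩ := popProg_spec (w := w) hp hb hl hn hq hw
    exact ⟨k, s'', _, e1, ⟨d', ls', e3, rfl⟩, by omega, by rw [e4]; simpa using e2⟩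
  · simp
  · exact ⟨0, by simp, hne, by simpa [Holds] using h8, rfl⟩
  · simp
  · simp
  · funext j; simp
  · funext j; simp
  · funext j; simp
  · simpa using h0
  · simp [popCount]
  · have : (size popProg + (Test.lt (.const 0) (.reg 17)).cost + 1) * (2 * l.length - 1) ≤
      (size popProg + (Test.lt (.const 0) (.reg 17)).cost + 1) * (2 * n) :=
      Nat.mul_le_mul_left _ (by omega)
    omega
  · rintro s' ⟨⟨a, d, ls, hp, ha⟩, hb⟩ i x hx
    simp only [Test.holds, Expr.eval, not_lt, Nat.le_zero] at hb
    refine hp.out i x ?_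
    have hst := hp.stack
    rcases ls with _ | ⟨l', ls⟩
    · have := hp.eq
      simp at this
      rwa [this]
    · obtain ⟨m', hm', -⟩ := hst
      omega

/-! ### Breadth-first search in a tree -/

/-- In an acyclic graph, a tree with the parent function `p` that is contained in the graph contains
all edges between its vertices, as each edge is a bridge. -/
theorem parent_of_adj {V : Type*} {G : SimpleGraph V} (hG : G.IsAcyclic) {q : ℕ → V} {p : ℕ → ℕ}
    {m : ℕ} (hinj : ∀ i < m, ∀ j < m, q i = q j → i = j)
    (hp : ∀ j, 0 < j → j < m → p j < j ∧ G.Adj (q j) (q (p j))) {i j : ℕ} (hi : i < m) (hj : j < m)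
    (h : G.Adj (q i) (q j)) : Adj p i j := by
  by_contra hno
  have hb := SimpleGraph.isAcyclic_iff_forall_adj_isBridge.1 hG h
  rw [SimpleGraph.isBridge_iff] at hb
  have key : ∀ k < m, (G.deleteEdges {s(q i, q j)}).Reachable (q 0) (q k) := by
    intro k
    induction k using Nat.strong_induction_on with
    | _ k ih =>
      intro hk
      rcases Nat.eq_zero_or_pos k with rfl | h0
      · exact .refl _
      obtain ⟨h1, h2⟩ := hp k h0 hk
      refine (ih _ h1 (h1.trans hk)).trans (SimpleGraph.Adj.reachable ?_)
      rw [SimpleGraph.deleteEdges_adj]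
      refine ⟨h2.symm, fun hs => hno ?_⟩
      rw [Set.mem_singleton_iff, Sym2.eq_iff] at hs
      rcases hs with ⟨g1, g2⟩ | ⟨g1, g2⟩
      · have e1 := hinj _ (h1.trans hk) _ hi g1
        have e2 := hinj _ hk _ hj g2
        subst e2
        exact Or.inr ⟨h0, e1⟩
      · have e1 := hinj _ (h1.trans hk) _ hj g1
        have e2 := hinj _ hk _ hi g2
        subst e2
        exact Or.inl ⟨h0, e1⟩
  exact hb ((key i hi).symm.trans (key j hj))

/-- The state of a breadth-first search: `q 0, …, q (m - 1)` is the queue, in which `p j` is the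
position of the vertex from which `q j` was found.  The vertices before position `i` have been
processed, and of the neighbours of `q i` those in `c`. -/
structure Queue {V : Type*} (G : SimpleGraph V) (n : ℕ) (q : ℕ → V) (p : ℕ → ℕ) (m i : ℕ)
    (c : List V) : Prop where
  pos : 0 < m
  zero : p 0 = n
  inj : ∀ a < m, ∀ b < m, q a = q b → a = b
  rest : ∀ a, m ≤ a → q a = q 0
  lt : ∀ a, 0 < a → a < m → p a < a
  adj : ∀ a, 0 < a → a < m → G.Adj (q a) (q (p a))
  parent : ∀ a, 0 < a → a < m → p a < i ∨ p a = i ∧ q a ∈ c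
  done : ∀ a < i, ∀ u, G.Adj (q a) u → ∃ b < m, q b = u
  seen : ∀ u ∈ c, ∃ b < m, q b = u

section
variable {V : Type*} {G : SimpleGraph V} {n m i : ℕ} {q : ℕ → V} {p : ℕ → ℕ} {c : List V} {u : V}

theorem Queue.le_card [Fintype V] (h : Queue G n q p m i c) : m ≤ Fintype.card V := by
  have := Fintype.card_le_of_injective (fun a : Fin m => q a) fun a b hab =>
    Fin.ext (h.inj a a.2 b b.2 hab)
  simpa using this

theorem Queue.fresh (h : Queue G n q p m i c) (hG : G.IsAcyclic) (hi : i < m) (hu : u ∉ c)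
    (hadj : G.Adj (q i) u) (hne : u ≠ q (p i)) {b : ℕ} (hb : b < m) : q b ≠ u := by
  rintro rfl
  rcases parent_of_adj hG h.inj (fun j h0 hj => ⟨h.lt j h0 hj, h.adj j h0 hj⟩) hi hb hadj with
    ⟨h0, h1⟩ | ⟨h0, h1⟩
  · exact hne (by rw [h1])
  · rcases h.parent b h0 hb with h2 | ⟨-, h2⟩
    · omega
    · exact hu h2

theorem Queue.skip (h : Queue G n q p m i c) (hmn : m ≤ n) (hi : i < m) (hadj : G.Adj (q i) u)
    (he : u = q (p i)) : Queue G n q p m i (c ++ [u]) where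
  pos := h.pos
  zero := h.zero
  inj := h.inj
  rest := h.rest
  lt := h.lt
  adj := h.adj
  parent a h0 ha := by
    rcases h.parent a h0 ha with h1 | ⟨h1, h2⟩
    · exact Or.inl h1
    · exact Or.inr ⟨h1, by simp [h2]⟩
  done := h.done
  seen v hv := by
    rcases List.mem_append.1 hv with hv | hv
    · exact h.seen v hv
    rw [List.mem_singleton] at hv
    subst hv
    rcases Nat.eq_zero_or_pos i with rfl | h0
    -- `p 0 = n` is beyond the end of the queue, where `q` repeats `q 0`
    · rw [h.zero, h.rest n hmn] at he
      exact absurd he hadj.ne'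
    · exact ⟨p i, (h.lt i h0 hi).trans hi, he.symm⟩

theorem Queue.push (h : Queue G n q p m i c) (hG : G.IsAcyclic) (hi : i < m) (hu : u ∉ c)
    (hadj : G.Adj (q i) u) (hne : u ≠ q (p i)) :
    Queue G n (Function.update q m u) (Function.update p m i) (m + 1) i (c ++ [u]) := by
  have hf : ∀ b < m, q b ≠ u := fun b hb => h.fresh hG hi hu hadj hne hb
  have hq : ∀ a, a < m → Function.update q m u a = q a := fun a ha => Function.update_of_ne ha.ne _ _
  have hp : ∀ a, a < m → Function.update p m i a = p a := fun a ha => Function.update_of_ne ha.ne _ _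
  have hqm : Function.update q m u m = u := Function.update_self ..
  have hpm : Function.update p m i m = i := Function.update_self ..
  refine ⟨by omega, ?_, ?_, ?_, ?_, ?_, ?_, ?_, ?_⟩
  · rw [hp 0 h.pos, h.zero]
  · intro a ha b hb hab
    rcases Nat.lt_succ_iff_lt_or_eq.1 ha with ha | rfl <;>
      rcases Nat.lt_succ_iff_lt_or_eq.1 hb with hb | rfl
    · rw [hq a ha, hq b hb] at hab
      exact h.inj a ha b hb hab
    · rw [hq a ha, hqm] at hab
      exact absurd hab (hf a ha)
    · rw [hq b hb, hqm] at hab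
      exact absurd hab.symm (hf b hb)
    · rfl
  · intro a ha
    rw [hq 0 h.pos, Function.update_of_ne (by omega), h.rest a (by omega)]
  · intro a h0 ha
    rcases Nat.lt_succ_iff_lt_or_eq.1 ha with ha | rfl
    · rw [hp a ha]; exact h.lt a h0 ha
    · rw [hpm]; exact hi
  · intro a h0 ha
    rcases Nat.lt_succ_iff_lt_or_eq.1 ha with ha | rfl
    · rw [hp a ha, hq a ha, hq _ ((h.lt a h0 ha).trans ha)]; exact h.adj a h0 ha
    · rw [hpm, hqm, hq i hi]; exact hadj.symm
  · intro a h0 ha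
    rcases Nat.lt_succ_iff_lt_or_eq.1 ha with ha | rfl
    · rw [hp a ha, hq a ha]
      rcases h.parent a h0 ha with h1 | ⟨h1, h2⟩
      · exact Or.inl h1
      · exact Or.inr ⟨h1, by simp [h2]⟩
    · rw [hpm, hqm]; exact Or.inr ⟨rfl, by simp⟩
  · intro a ha v hv
    rw [hq a (by omega)] at hv
    obtain ⟨b, hb, rfl⟩ := h.done a ha v hv
    exact ⟨b, by omega, hq b hb⟩
  · intro v hv
    rcases List.mem_append.1 hv with hv | hv
    · obtain ⟨b, hb, rfl⟩ := h.seen v hv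
      exact ⟨b, by omega, hq b hb⟩
    · rw [List.mem_singleton] at hv
      exact ⟨m, by omega, by rw [hqm, hv]⟩

theorem Queue.next (h : Queue G n q p m i c) (hc : ∀ u, G.Adj (q i) u → u ∈ c) :
    Queue G n q p m (i + 1) [] where
  pos := h.pos
  zero := h.zero
  inj := h.inj
  rest := h.rest
  lt := h.lt
  adj := h.adj
  parent a h0 ha := by
    rcases h.parent a h0 ha with h1 | ⟨h1, -⟩ <;> exact Or.inl (by omega)
  done a ha u hu := by
    rcases Nat.lt_succ_iff_lt_or_eq.1 ha with ha | rfl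
    · exact h.done a ha u hu
    · exact h.seen u (hc u hu)
  seen u hu := by simp at hu

theorem Queue.exists_eq (h : Queue G n q p m m []) (hG : G.Connected) (u : V) :
    ∃ b < m, q b = u := by
  obtain ⟨w⟩ := hG.preconnected (q 0) u
  have key : ∀ {v v' : V} (w : G.Walk v v'), (∃ b < m, q b = v) → ∃ b < m, q b = v' := by
    intro v v' w
    induction w with
    | nil => exact id
    | cons hadj w ih =>
      rintro ⟨b, hb, rfl⟩
      exact ih (h.done b hb _ hadj)
  exact key w ⟨0, h.pos, rfl⟩

/-- The result of a completed search: an enumeration of the vertices by which the graph is the tree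
with the parent function `p`. -/
theorem Queue.exists_equiv {n : ℕ} {T : SimpleGraph (Fin n)} {q : ℕ → Fin n}
    (h : Queue T n q p m m []) (hT : T.IsTree) : m = n ∧ IsParent n p ∧
      ∃ e : Fin n ≃ Fin n, (∀ i : Fin n, e i = q i) ∧ ∀ i j : Fin n, T.Adj (e i) (e j) ↔ Adj p i j := by
  have hle := h.le_card
  rw [Fintype.card_fin] at hle
  have hsurj : Function.Surjective fun a : Fin m => q a := fun u => by
    obtain ⟨b, hb, rfl⟩ := h.exists_eq hT.connected u
    exact ⟨⟨b, hb⟩, rfl⟩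
  have hge := Fintype.card_le_of_surjective _ hsurj
  simp only [Fintype.card_fin] at hge
  obtain rfl : m = n := le_antisymm hle hge
  have hinj : Function.Injective fun a : Fin m => q a := fun a b hab =>
    Fin.ext (h.inj a a.2 b b.2 hab)
  refine ⟨rfl, ⟨h.zero, h.lt⟩, Equiv.ofBijective _ ⟨hinj, hsurj⟩, fun i => rfl, fun i j => ?_⟩
  constructor
  · exact parent_of_adj hT.isAcyclic h.inj (fun j h0 hj => ⟨h.lt j h0 hj, h.adj j h0 hj⟩) i.2 j.2
  · rintro (⟨h0, h1⟩ | ⟨h0, h1⟩)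
    · have := h.adj i h0 i.2
      rw [h1] at this
      exact this
    · have := h.adj j h0 j.2
      rw [h1] at this
      exact this.symm

end

/-! ### The search program -/

/-- In the memory `s`, the arrays `0` and `1` hold the adjacency lists. -/
def HasLists {n : ℕ} (adj : Fin n → List (Fin n)) (s : Store) : Prop :=
  ∀ v : Fin n, s.arr 0 (v + 1) = s.arr 0 v + (adj v).length ∧
    s.arr 0 v + (adj v).length ≤ n * n ∧
    ∀ (t : ℕ) (u : Fin n), (adj v)[t]? = some u → s.arr 1 (s.arr 0 v + t) = (u : ℕ)

theorem hasLists_inputStore {n : ℕ} {adj : Fin n → List (Fin n)} (h : ∀ v, (adj v).Nodup) :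
    HasLists adj (inputStore adj) := by
  intro v
  set f := List.ofFn adj with hf
  have hlen : f.length = n := List.length_ofFn
  have h0 : ∀ i ≤ n, (inputStore adj).arr 0 i = (f.take i).flatten.length := by
    intro i hi
    simp [inputStore, hi, hf]
  have hv : (v : ℕ) < f.length := by rw [hlen]; exact v.2
  have hget : f[(v : ℕ)] = adj v := by simp [hf]
  have hsucc : (f.take (v + 1)).flatten.length = (f.take v).flatten.length + (adj v).length := by
    rw [List.take_succ_eq_append_getElem hv, List.flatten_append, List.length_append, hget]
    simp
  have hsplit : f.flatten = (f.take v).flatten ++ (adj v ++ (f.drop (v + 1)).flatten) := by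
    conv_lhs => rw [← List.take_append_drop v f, List.flatten_append, List.drop_eq_getElem_cons hv,
      List.flatten_cons, hget]
  have hbound : ∀ g : List (List (Fin n)), (∀ l ∈ g, l.Nodup) → g.flatten.length ≤ g.length * n := by
    intro g hg
    induction g with
    | nil => simp
    | cons l g ih =>
      have h1 := (hg l (by simp)).length_le_card
      have h2 := ih fun l hl => hg l (by simp [hl])
      rw [Fintype.card_fin] at h1
      simp only [List.flatten_cons, List.length_append, List.length_cons, Nat.add_mul, Nat.one_mul]
      omega
  rw [h0 v v.2.le, h0 (v + 1) v.2, hsucc]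
  refine ⟨rfl, ?_, ?_⟩
  · have h1 := hbound f (by simpa [hf] using h)
    rw [hlen, hsplit] at h1
    simp only [List.length_append] at h1
    omega
  · intro t u hu
    have : f.flatten[(f.take v).flatten.length + t]? = some u := by
      rw [hsplit, List.getElem?_append_right (by omega), Nat.add_sub_cancel_left,
        List.getElem?_append_left (List.getElem?_eq_some_iff.1 hu).1, hu]
    change (f.flatten.map Fin.val).getD _ 0 = _
    rw [List.getD_eq_getElem?_getD, List.getElem?_map, this]
    rfl

/-- Inspection of the neighbour at the position in register `23`; the vertex found before is in
register `25`. -/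
def neighbourProg : Prog :=
  .seq (.assign 26 (.read 1 (.reg 23))) <|
  .seq (.ite (.eq (.reg 26) (.reg 25)) .skip
    (.seq (.write 3 (.reg 17) (.reg 26)) <| .seq (.write 4 (.reg 17) (.reg 18)) <|
      .assign 17 (.add (.reg 17) (.const 1))))
    (.assign 23 (.add (.reg 23) (.const 1)))

/-- Processing the vertex at the position in register `18` of the queue in array `3`, of which the
length is in register `17`; array `4` holds the parent function. -/
def visitProg : Prog :=
  .seq (.assign 22 (.read 3 (.reg 18))) <| .seq (.assign 23 (.read 0 (.reg 22))) <|
  .seq (.assign 24 (.read 0 (.add (.reg 22) (.const 1)))) <|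
  .seq (.assign 25 (.read 3 (.read 4 (.reg 18)))) <|
  .seq (.loop (.lt (.reg 23) (.reg 24)) neighbourProg)
    (.assign 18 (.add (.reg 18) (.const 1)))

/-- Breadth-first search from the vertex `0`.  The cells of the queue that have not been written hold
`0`, so that the vertex `0` appears as its own parent. -/
def searchProg : Prog :=
  .seq (.write 4 (.const 0) (.reg 0)) <| .seq (.assign 17 (.const 1)) <|
  .seq (.assign 18 (.const 0)) <| .loop (.lt (.reg 18) (.reg 17)) visitProg

/-- The memory `s` holds a state of the search. -/
structure Searching {n : ℕ} (T : SimpleGraph (Fin n)) (q : ℕ → Fin n) (p : ℕ → ℕ) (m i : ℕ)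
    (c : List (Fin n)) (s₀ s : Store) : Prop where
  queue : Queue T n q p m i c
  arr3 : ∀ a, s.arr 3 a = (q a : ℕ)
  arr4 : ∀ a, s.arr 4 a = p a
  reg17 : s.reg 17 = m
  reg18 : s.reg 18 = i
  changes : Changes [17, 18, 22, 23, 24, 25, 26] [3, 4] 0 s₀ s

section
variable {w n : ℕ} {T : SimpleGraph (Fin n)} {adj : Fin n → List (Fin n)} {q : ℕ → Fin n} {p : ℕ → ℕ}
  {m i : ℕ} {c : List (Fin n)} {s₀ s : Store}

theorem neighbourProg_spec {u : Fin n} (hT : T.IsAcyclic) (h : Searching T q p m i c s₀ s) (hi : i < m)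
    (hu : u ∉ c) (hadj : T.Adj (q i) u) (h1 : s.arr 1 (s.reg 23) = u)
    (h25 : s.reg 25 = q (p i)) (h23 : s.reg 23 < n * n) (hw : n * n + n < 2 ^ w) :
    Does w neighbourProg s fun s' => ∃ q' p' m', Searching T q' p' m' i (c ++ [u]) s₀ s' ∧
      s'.reg 23 = s.reg 23 + 1 ∧ s'.reg 24 = s.reg 24 ∧ s'.reg 25 = s.reg 25 ∧ q' i = q i ∧
      q' (p' i) = q (p i) ∧ m ≤ m' ∧ (u ≠ q (p i) → m' = m + 1) := by
  have hun := u.2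
  have hmn := h.queue.le_card
  rw [Fintype.card_fin] at hmn
  have c0 : Changes [17, 18, 22, 23, 24, 25, 26] [3, 4] 0 s₀ (s.setReg 26 u) :=
    h.changes.setReg (by decide) (by simp)
  refine Does.seq (Does.assign (by simp only [Expr.eval, h1]; omega) ?_)
  simp only [Expr.eval, h1]
  refine Does.seq (Does.ite (fun hb => Does.skip (Does.assign ?_ ?_)) fun hb => ?_)
  · simp [Expr.eval]; omega
  · have he : u = q (p i) := by
      simp [Test.holds, Expr.eval, h25] at hb
      exact Fin.ext hb
    refine ⟨q, p, m, ⟨h.queue.skip hmn hi hadj he, ?_, ?_, ?_, ?_, ?_⟩, ?_, ?_, ?_, rfl, rfl, le_rfl,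
      fun hne => absurd he hne⟩
    · simpa using h.arr3
    · simpa using h.arr4
    · simpa using h.reg17
    · simpa using h.reg18
    · exact c0.setReg (by decide) (by simp)
    · simp [Expr.eval]
    · simp
    · simp
  · have hne : u ≠ q (p i) := by
      rintro rfl
      simp [Test.holds, Expr.eval, h25] at hb
    have hnew := h.queue.push hT hi hu hadj hne
    have hmn' := hnew.le_card
    rw [Fintype.card_fin] at hmn'
    have hpi : p i ≠ m := by
      rcases Nat.eq_zero_or_pos i with rfl | h0
      · rw [h.queue.zero]; omega
      · have := h.queue.lt i h0 hi; omega
    have e17 := h.reg17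
    have e18 := h.reg18
    refine Does.seq (Does.write (by simp [Expr.eval]; omega) (by simp [Expr.eval]; omega) ?_)
    refine Does.seq (Does.write (by simp [Expr.eval]; omega) (by simp [Expr.eval]; omega) ?_)
    refine Does.assign (by simp [Expr.eval]; omega) ?_
    refine Does.assign (by simp [Expr.eval]; omega) ?_
    refine ⟨_, _, _, ⟨hnew, ?_, ?_, ?_, ?_, ?_⟩, ?_, ?_, ?_, ?_, ?_, by omega, fun _ => rfl⟩
    · intro a
      by_cases ha : a = m
      · subst ha; simp [Expr.eval, e17]
      · simp [Expr.eval, e17, ha, h.arr3]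
    · intro a
      by_cases ha : a = m
      · subst ha; simp [Expr.eval, e17, e18]
      · simp [Expr.eval, e17, ha, h.arr4]
    · simp [Expr.eval, e17]
    · simp [e18]
    · exact (((c0.setArr (by decide) (by decide) (by simp)).setArr (by decide) (by decide)
        (by simp)).setReg (by decide) (by simp)).setReg (by decide) (by simp)
    · simp [Expr.eval]
    · simp
    · simp
    · exact Function.update_of_ne hi.ne _ _
    · rw [Function.update_of_ne (a := i) hi.ne, Function.update_of_ne hpi]

/-- The cost of the search per unit of potential: visiting a vertex with `d` new neighbours has at most
`d + 1` neighbours to inspect, and decreases the potential by `d + 1`. -/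
def visitTime : ℕ :=
  25 + 2 * (size neighbourProg + (Test.lt (.reg 23) (.reg 24)).cost + 1) +
    (Test.lt (.reg 23) (.reg 24)).cost + 1

theorem visitProg_spec (hT : T.IsAcyclic) (hA : IsAdjLists T adj) (hs₀ : HasLists adj s₀)
    (h : Searching T q p m i [] s₀ s) (hi : i < m) (hw : n * n + n < 2 ^ w) :
    ∃ k s' q' p' m', Exec w visitProg s k s' ∧ Searching T q' p' m' (i + 1) [] s₀ s' ∧ m ≤ m' ∧
      k ≤ visitTime * (m' - m + 1) := by
  set v := q i with hv
  set L := (adj v).length with hL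
  obtain ⟨g0, gL, g1⟩ := hs₀ v
  have a0 : s.arr 0 = s₀.arr 0 := h.changes.arr 0 (by decide)
  have hvn := v.2
  have hqp := (q (p i)).2
  have e3 : s.arr 3 i = (v : ℕ) := h.arr3 i
  have e4 : s.arr 4 i = p i := h.arr4 i
  have e3' : s.arr 3 (p i) = (q (p i) : ℕ) := h.arr3 _
  have hrun : Runs w visitProg s
      (3 + (3 + (5 + (4 + (((size neighbourProg + (Test.lt (.reg 23) (.reg 24)).cost + 1) * L +
        (Test.lt (.reg 23) (.reg 24)).cost + 1) + 4)))))
      fun s' => ∃ q' p' m', Searching T q' p' m' (i + 1) [] s₀ s' ∧ m ≤ m' ∧ L ≤ m' - m + 1 := by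
    refine Runs.seq (Does.assign (by simp only [Expr.eval, h.reg18, e3]; omega) ?_)
    simp only [Expr.eval, h.reg18, e3]
    refine Runs.seq (Does.assign (by simp [Expr.eval, a0]; omega) ?_)
    simp only [Expr.eval, setReg_reg, setReg_arr, if_true, a0]
    refine Runs.seq (Does.assign (by simp [Expr.eval, a0, g0]; omega) ?_)
    simp [Expr.eval, a0, g0]
    refine Runs.seq (Does.assign (by simp [Expr.eval, h.reg18, e4, e3']; omega) ?_)
    simp [Expr.eval, h.reg18, e4, e3']
    have hst : Searching T q p m i [] s₀ ((((s.setReg 22 v).setReg 23 (s₀.arr 0 v)).setReg 24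
        (s₀.arr 0 v + L)).setReg 25 (q (p i))) :=
      ⟨h.queue, h.arr3, h.arr4, h.reg17, h.reg18, (((h.changes.setReg (by decide)
        (by simp)).setReg (by decide) (by simp)).setReg (by decide) (by simp)).setReg (by decide)
        (by simp)⟩
    have r23 : ((((s.setReg 22 v).setReg 23 (s₀.arr 0 v)).setReg 24
        (s₀.arr 0 v + L)).setReg 25 (q (p i))).reg 23 = s₀.arr 0 v := by simp
    have r24 : ((((s.setReg 22 v).setReg 23 (s₀.arr 0 v)).setReg 24
        (s₀.arr 0 v + L)).setReg 25 (q (p i))).reg 24 = s₀.arr 0 v + L := by simp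
    have r25 : ((((s.setReg 22 v).setReg 23 (s₀.arr 0 v)).setReg 24
        (s₀.arr 0 v + L)).setReg 25 (q (p i))).reg 25 = q (p i) := by simp
    generalize (((s.setReg 22 v).setReg 23 (s₀.arr 0 v)).setReg 24
        (s₀.arr 0 v + L)).setReg 25 (q (p i)) = s₁ at *
    refine Runs.seq ((runs_for (fun t s' => ∃ q' p' m', Searching T q' p' m' i ((adj v).take t) s₀ s' ∧
      s'.reg 23 = s₀.arr 0 v + t ∧ s'.reg 24 = s₀.arr 0 v + L ∧ s'.reg 25 = q (p i) ∧ q' i = v ∧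
      q' (p' i) = q (p i) ∧ m ≤ m' ∧ m + t ≤ m' + ((adj v).take t).count (q (p i))) L
      (size neighbourProg) ?_ ?_ ?_).imp ?_)
    · rintro t s' ht ⟨q', p', m', hs, f23, f24, f25, fi, fp, fm, fc⟩
      have htake : (adj v).take (t + 1) = (adj v).take t ++ [(adj v)[t]] :=
        List.take_succ_eq_append_getElem ht
      have hnd : ((adj v).take (t + 1)).Nodup := (hA v).1.sublist (List.take_sublist _ _)
      have hu : (adj v)[t] ∉ (adj v).take t := by
        rw [htake, List.nodup_append] at hnd
        exact fun hmem => hnd.2.2 _ hmem _ (by simp) rfl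
      refine (neighbourProg_spec (w := w) hT hs (fm.trans_lt' hi) hu ?_ ?_ ?_ ?_ hw).imp ?_
      · rw [fi]; exact ((hA v).2 _).1 (List.getElem_mem _)
      · rw [hs.changes.arr 1 (by decide), f23]
        exact g1 t _ (List.getElem?_eq_getElem ht)
      · rw [f25, fp]
      · omega
      · rintro s'' ⟨q'', p'', m'', hs', f23', f24', f25', fi', fp', fm', fne⟩
        refine ⟨q'', p'', m'', by rw [htake]; exact hs', by omega, by omega, by omega, by rw [fi', fi],
          by rw [fp', fp], by omega, ?_⟩
        rw [htake, List.count_append]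
        by_cases hup : (adj v)[t] = q (p i)
        · simp only [hup, List.count_singleton_self]; omega
        · have := fne (by rwa [fp])
          omega
    · rintro t s' ht ⟨q', p', m', hs, f23, f24, -⟩
      simp only [Test.holds, Expr.eval, f23, f24]
      omega
    · exact ⟨q, p, m, hst, r23, r24, r25, rfl, rfl, le_rfl, by simp⟩
    · rintro s' ⟨q', p', m', hs, f23, f24, f25, fi, fp, fm, fc⟩
      rw [hL, List.take_length] at hs fc
      have hcount := List.nodup_iff_count_le_one.1 (hA v).1 (q (p i))
      have hmn := hs.queue.le_card
      rw [Fintype.card_fin] at hmn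
      refine Does.assign (by simp [Expr.eval, hs.reg18]; omega) ⟨q', p', m', ⟨?_, ?_, ?_, ?_, ?_, ?_⟩,
        fm, by omega⟩
      · exact hs.queue.next fun u hu => ((hA v).2 u).2 (by rwa [fi] at hu)
      · simpa using hs.arr3
      · simpa using hs.arr4
      · simpa using hs.reg17
      · simp [Expr.eval, hs.reg18]
      · exact hs.changes.setReg (by decide) (by simp)
  obtain ⟨k, s', h1, h2, q', p', m', h3, h4, h5⟩ := hrun
  refine ⟨k, s', q', p', m', h1, h3, h4, h2.trans ?_⟩
  have hb : (size neighbourProg + (Test.lt (.reg 23) (.reg 24)).cost + 1) * L ≤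
    (size neighbourProg + (Test.lt (.reg 23) (.reg 24)).cost + 1) * (m' - m + 1) :=
    Nat.mul_le_mul_left _ h5
  have hc : visitTime * 1 ≤ visitTime * (m' - m + 1) := Nat.mul_le_mul_left _ (by omega)
  unfold visitTime at *
  nlinarith

/-- The cost of the search. -/
def searchTime (n : ℕ) : ℕ :=
  3 + (2 + (2 + ((visitTime + (Test.lt (.reg 18) (.reg 17)).cost + 1) * (2 * n) +
    (Test.lt (.reg 18) (.reg 17)).cost + 1)))

theorem searchProg_spec (hT : T.IsTree) (hA : IsAdjLists T adj) (hs : HasLists adj s)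
    (h0 : s.reg 0 = n) (hpos : 0 < n) (h3 : ∀ a, s.arr 3 a = 0) (h4 : ∀ a, s.arr 4 a = 0)
    (hw : n * n + n < 2 ^ w) :
    Runs w searchProg s (searchTime n)
      fun s' => ∃ (q : ℕ → Fin n) (p : ℕ → ℕ), Searching T q p n n [] s s' := by
  refine Runs.seq (Does.write (by simp [Expr.eval]) (by simp only [Expr.eval]; omega) ?_)
  refine Runs.seq (Does.assign (by simp only [Expr.eval]; omega) ?_)
  refine Runs.seq (Does.assign (by simp only [Expr.eval]; omega) ?_)
  simp only [Expr.eval, h0]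
  -- the potential counts the vertices to be visited and those to be found
  refine (runs_while (fun a s' => ∃ q p m i, Searching T q p m i [] s s' ∧ i ≤ m ∧ a = 2 * n - i - m)
    visitTime ?_ (2 * n - 0 - 1) _ ?_).mono ?_ ?_
  · rintro a s' ⟨q, p, m, i, h, him, rfl⟩ hb
    simp only [Test.holds, Expr.eval, h.reg17, h.reg18] at hb
    obtain ⟨k, s'', q', p', m', g1, g2, g3, g4⟩ := visitProg_spec hT.isAcyclic hA hs h hb hw
    have hmn := g2.queue.le_card
    rw [Fintype.card_fin] at hmn
    refine ⟨k, s'', _, g1, ⟨q', p', m', i + 1, g2, by omega, rfl⟩, by omega, g4.trans ?_⟩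
    exact Nat.mul_le_mul_left _ (by omega)
  · refine ⟨fun _ => ⟨0, hpos⟩, fun a => if a = 0 then n else 0, 1, 0, ⟨?_, ?_, ?_, ?_, ?_, ?_⟩,
      by omega, rfl⟩
    · exact ⟨by omega, if_pos rfl, fun a ha b hb _ => by omega, fun _ _ => rfl, fun a h h' => by omega,
        fun a h h' => by omega, fun a h h' => by omega, fun a h => by omega, fun u hu => by simp at hu⟩
    · intro a; simp [h3]
    · intro a; simp [h4]
    · simp
    · simp
    · exact (((Changes.refl _ _ s).setArr (by decide) (by decide) (by simp)).setReg (by decide)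
        (by simp)).setReg (by decide) (by simp)
  · have : (visitTime + (Test.lt (.reg 18) (.reg 17)).cost + 1) * (2 * n - 0 - 1) ≤
      (visitTime + (Test.lt (.reg 18) (.reg 17)).cost + 1) * (2 * n) :=
      Nat.mul_le_mul_left _ (by omega)
    omega
  · rintro s' ⟨⟨a, q, p, m, i, h, him, -⟩, hb⟩
    simp only [Test.holds, Expr.eval, h.reg17, h.reg18] at hb
    obtain rfl : i = m := by omega
    obtain ⟨rfl, -⟩ := h.queue.exists_equiv hT
    exact ⟨q, p, h⟩

end

/-! ### The algorithm -/

/-- One step of the computation of the number of levels; register `27` holds a power of two. -/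
def doubleProg : Prog :=
  .seq (.assign 27 (.add (.reg 27) (.reg 27))) (.assign 2 (.add (.reg 2) (.const 1)))

/-- The number of levels, that is, the number of binary digits of the number of vertices. -/
def levelsProg : Prog :=
  .seq (.assign 1 (.add (.reg 0) (.const 1))) <| .seq (.assign 27 (.const 1)) <|
  .loop (.lt (.reg 27) (.reg 1)) doubleProg

/-- The cost of computing the number `K` of levels. -/
def levelsTime (K : ℕ) : ℕ :=
  4 + (2 + ((size doubleProg + (Test.lt (.reg 27) (.reg 1)).cost + 1) * K +
    (Test.lt (.reg 27) (.reg 1)).cost + 1))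

theorem levelsProg_spec {w n : ℕ} {s : Store} (h0 : s.reg 0 = n) (h2 : s.reg 2 = 0) (hn : 0 < n)
    (hw : 2 * n + 2 < 2 ^ w) :
    Runs w levelsProg s (levelsTime (Nat.log 2 n + 1)) fun s' => s'.reg 1 = n + 1 ∧
      s'.reg 2 = Nat.log 2 n + 1 ∧ Changes [1, 2, 27] [] 0 s s' := by
  refine Runs.seq (Does.assign (by simp only [Expr.eval]; omega) ?_)
  refine Runs.seq (Does.assign (by simp only [Expr.eval]; omega) ?_)
  simp only [Expr.eval, h0]
  have hlog : ∀ j, 2 ^ j < n + 1 ↔ j < Nat.log 2 n + 1 := fun j => by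
    rw [Nat.lt_succ_iff, Nat.lt_succ_iff, Nat.le_log_iff_pow_le (by decide) hn.ne']
  refine (runs_for (fun j s' => s'.reg 1 = n + 1 ∧ s'.reg 2 = j ∧ s'.reg 27 = 2 ^ j ∧
    Changes [1, 2, 27] [] 0 s s') (Nat.log 2 n + 1) (size doubleProg) ?_ ?_ ?_).imp ?_
  · rintro j s' hj ⟨e1, e2, e27, c⟩
    have h := (hlog j).2 hj
    have hjn : j < n := by
      have := Nat.log_lt_self 2 hn.ne'
      have := (Nat.lt_two_pow_self (n := j))
      omega
    refine Does.seq (Does.assign (by simp only [Expr.eval]; omega) ?_)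
    refine Does.assign (by simp [Expr.eval, e2]; omega) ⟨by simp [e1], by simp [Expr.eval, e2], ?_,
      (c.setReg (by decide) (by simp)).setReg (by decide) (by simp)⟩
    simp [Expr.eval, e27, pow_succ]
    ring
  · rintro j s' hj ⟨e1, e2, e27, c⟩
    simp only [Test.holds, Expr.eval, e1, e27]
    exact hlog j
  · exact ⟨by simp, by simp [h2], by simp, ((Changes.refl _ _ s).setReg (by decide)
      (by simp)).setReg (by decide) (by simp)⟩
  · rintro s' ⟨e1, e2, -, c⟩
    exact ⟨e1, e2, c⟩

/-- The algorithm: the vertices are numbered by a breadth-first search, such that a bottom-up pass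
can visit them in decreasing order; the layout obtained at the root is then written. -/
def layoutAlgorithm : Prog :=
  .seq levelsProg <| .seq searchProg <| .seq (.assign 3 (.reg 1)) <| .seq (.assign 4 (.reg 0)) <|
  .seq passProg outputProg

/-- The cost of the algorithm for `n` vertices and `K` levels. -/
def algorithmTime (n K : ℕ) : ℕ :=
  levelsTime K + (searchTime n + (2 + (2 + (passTime n K + outputTime n))))

theorem algorithmTime_le : ∃ C, ∀ n K, 0 < K → algorithmTime n K ≤ C * ((n + 1) * K) := by
  have hv : ∀ K, vertexTime K = vertexTime 0 + (size scanStep + size levelProg +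
      2 * (Test.lt (.reg 5) (.reg 2)).cost + 2) * K := by
    intro K
    simp only [vertexTime, scanTime]
    ring
  have key : ∀ a b c d n K : ℕ, 0 < K →
      a + b * K + c * n + d * (K * n) ≤ (a + b + c + d) * ((n + 1) * K) := by
    intro a b c d n K hK
    have h1 : 1 ≤ (n + 1) * K := Nat.mul_pos n.succ_pos hK
    have h2 : K ≤ (n + 1) * K := Nat.le_mul_of_pos_left _ n.succ_pos
    have h3 : n ≤ (n + 1) * K := n.le_succ.trans (Nat.le_mul_of_pos_right _ hK)
    have h4 : K * n ≤ (n + 1) * K := by rw [Nat.mul_comm K]; exact Nat.mul_le_mul_right _ n.le_succ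
    have := Nat.mul_le_mul_left a h1
    have := Nat.mul_le_mul_left b h2
    have := Nat.mul_le_mul_left c h3
    have := Nat.mul_le_mul_left d h4
    simp only [Nat.add_mul]
    simp only [Nat.mul_one, Nat.add_mul, Nat.one_mul] at *
    omega
  refine ⟨_, fun n K hK => le_trans (Nat.le_of_eq ?_) (key
    (levelsTime 0 + searchTime 0 + 4 + passTime 0 0 + outputTime 0)
    (size doubleProg + (Test.lt (.reg 27) (.reg 1)).cost + 1)
    (2 * (visitTime + (Test.lt (.reg 18) (.reg 17)).cost + 1) +
      2 * (size popProg + (Test.lt (.const 0) (.reg 17)).cost + 1) +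
      (vertexTime 0 + (Test.lt (.const 0) (.reg 4)).cost + 1))
    (size scanStep + size levelProg + 2 * (Test.lt (.reg 5) (.reg 2)).cost + 2) n K hK)⟩
  simp only [algorithmTime, levelsTime, searchTime, passTime, outputTime, hv K]
  ring

theorem layoutAlgorithm_spec {w n : ℕ} {T : SimpleGraph (Fin n)} {adj : Fin n → List (Fin n)}
    (hT : T.IsTree) (hA : IsAdjLists T adj) (hn : 0 < n) (hw : 64 * (n + 1) ^ 2 ≤ 2 ^ w) :
    Runs w layoutAlgorithm (inputStore adj) (algorithmTime n (Nat.log 2 n + 1)) fun s =>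
      ∃ σ : Fin n ≃ Fin n, HoldsLayout s σ ∧ layoutMim T σ = lmw T := by
  set K := Nat.log 2 n + 1 with hK
  have hKn : K ≤ n := Nat.log_lt_self 2 hn.ne'
  have hpow : n < 2 ^ K := Nat.lt_pow_succ_log_self (by decide) n
  have hsq : (n + 1) ^ 2 = n * n + 2 * n + 1 := by ring
  have hKn' : 8 * K * n ≤ 8 * (n * n) := by
    rw [Nat.mul_assoc]
    exact Nat.mul_le_mul_left _ (Nat.mul_le_mul_right _ hKn)
  have hcells : (K + 1) * (n + 1) ≤ 2 ^ w := by
    have : (K + 1) * (n + 1) ≤ (n + 1) * (n + 1) := Nat.mul_le_mul_right _ (by omega)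
    nlinarith
  have hlists := hasLists_inputStore fun v => (hA v).1
  have hr0 : (inputStore adj).reg 0 = n := rfl
  have hr : ∀ x, x ≠ 0 → (inputStore adj).reg x = 0 := fun x hx => if_neg hx
  have ha : ∀ a, a ≠ 0 → a ≠ 1 → ∀ i, (inputStore adj).arr a i = 0 := by
    intro a h h' i
    simp [inputStore, h, h']
  generalize inputStore adj = s₀ at *
  refine Runs.seq ((levelsProg_spec (w := w) hr0 (hr 2 (by decide)) hn (by omega)).imp
    fun s₁ ⟨e1, e2, c₁⟩ => ?_)
  have a1 : ∀ a, s₁.arr a = s₀.arr a := fun a => c₁.arr a (by simp)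
  refine Runs.seq ((searchProg_spec (w := w) (s := s₁) hT hA ?_ ?_ hn ?_ ?_ (by omega)).imp
    fun s₂ ⟨q, p, h⟩ => ?_)
  · intro v; rw [a1, a1]; exact hlists v
  · rw [c₁.reg 0 (by decide), hr0]
  · intro a; rw [a1]; exact ha 3 (by decide) (by decide) a
  · intro a; rw [a1]; exact ha 4 (by decide) (by decide) a
  obtain ⟨-, hp, e, he, hadj⟩ := h.queue.exists_equiv hT
  have c₂ := h.changes
  have r0 : s₂.reg 0 = n := by rw [c₂.reg 0 (by decide), c₁.reg 0 (by decide), hr0]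
  have r1 : s₂.reg 1 = n + 1 := by rw [c₂.reg 1 (by decide), e1]
  have r2 : s₂.reg 2 = K := by rw [c₂.reg 2 (by decide), e2]
  have a2 : ∀ a, a ≠ 0 → a ≠ 1 → a ≠ 3 → a ≠ 4 → ∀ i, s₂.arr a i = 0 := by
    intro a g0 g1 g3 g4 i
    rw [c₂.arr a (by simp [g3, g4]), a1]
    exact ha a g0 g1 i
  refine Runs.seq (Does.assign (by simp only [Expr.eval]; omega) ?_)
  refine Runs.seq (Does.assign (by simp [Expr.eval]; omega) ?_)
  simp only [Expr.eval, setReg_reg, r0, r1]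
  norm_num
  have f : ∀ x, x ≠ 3 → x ≠ 4 → ((s₂.setReg 3 (n + 1)).setReg 4 n).reg x = s₂.reg x := by
    intro x h3 h4; simp [h3, h4]
  have f3 : ((s₂.setReg 3 (n + 1)).setReg 4 n).reg 3 = n + 1 := by simp
  have f4 : ((s₂.setReg 3 (n + 1)).setReg 4 n).reg 4 = n := by simp
  have fa : ((s₂.setReg 3 (n + 1)).setReg 4 n).arr = s₂.arr := rfl
  generalize (s₂.setReg 3 (n + 1)).setReg 4 n = s₃ at *
  obtain ⟨N, hN⟩ := hp.exists_nodes K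
  have hlab := hp.isLabelled hpow hN
  obtain ⟨hnd, hmem, k, hthin, hcert⟩ := hlab.optimal hn
  have hTab : Table n K (fun _ => .empty) s₃ := by
    refine ⟨fun v _ k _ => ?_, fun v _ k _ => ?_, fun v _ k _ => ?_, fun v _ k _ => ?_,
      fun v _ k _ => ?_⟩
    · rw [fa]; exact a2 5 (by decide) (by decide) (by decide) (by decide) _
    all_goals rw [fa, a2 _ (by decide) (by decide) (by decide) (by decide)]; exact holds_nil _
  refine Runs.seq ((passProg_spec (w := w) (s := s₃) hp hN hn hTab ?_ ?_ f4 ?_ (by omega) (by omega)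
    hcells hKn).imp fun s₄ ⟨h8, c₄⟩ => ?_)
  · rw [f 1 (by decide) (by decide), r1]
  · rw [f 2 (by decide) (by decide), r2]
  · intro x _; rw [fa]; exact h.arr4 x
  set l := (N 0).cl K with hl
  have hlen : l.length = n := by
    have : l.toFinset = Finset.range n := by ext z; simp [hmem]
    rw [← List.toFinset_card_of_nodup hnd, this, Finset.card_range]
  have q4 : ∀ x, s₄.arr 3 x = (q x : ℕ) := by
    intro x; rw [c₄.arr 3 (by decide), fa]; exact h.arr3 x
  have g := c₄.grows
  refine (outputProg_spec (w := w) (s := s₄) h8 ?_ hlen.le ?_ (by have := g.le; omega) ?_ ?_).imp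
    fun s₅ hout => ?_
  · intro h0
    rw [h0] at hlen
    simp at hlen
    omega
  · rw [c₄.reg 0 (by decide), f 0 (by decide) (by decide), r0]
  · intro x _
    rw [q4]
    have := (q x).2
    omega
  · have := g.le_add
    omega
  -- the layout in terms of the numbering
  let π : Fin n → Fin n := fun i => ⟨l[(i : ℕ)]'(by rw [hlen]; exact i.2),
    (hmem _).1 (List.getElem_mem _)⟩
  have hπ : Function.Injective π := fun i j hij => by
    have := congrArg Fin.val hij
    exact Fin.ext ((List.Nodup.getElem_inj_iff hnd).1 this)
  refine ⟨(Equiv.ofBijective π (Finite.injective_iff_bijective.1 hπ)).trans e, fun i => ?_, ?_⟩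
  · rw [hout i _ (List.getElem?_eq_getElem (by rw [hlen]; exact i.2)), q4]
    have := he (π i)
    simp only [Equiv.trans_apply, Equiv.ofBijective_apply, this]
    rfl
  · refine layoutMim_eq_lmw T hlab.parent_lt e (fun i j => ?_) hthin hcert _ fun i => ?_
    · rw [hadj, Adj, Adj]
      simp only [Fin.is_lt, if_true]
      constructor
      · rintro (⟨h0, h1⟩ | ⟨h0, h1⟩)
        · exact Or.inl ⟨h0, by rw [if_neg h0.ne', h1]⟩
        · exact Or.inr ⟨h0, by rw [if_neg h0.ne', h1]⟩
      · rintro (⟨h0, h1⟩ | ⟨h0, h1⟩)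
        · rw [if_neg h0.ne'] at h1; exact Or.inl ⟨h0, h1⟩
        · rw [if_neg h0.ne'] at h1; exact Or.inr ⟨h0, h1⟩
    · rw [List.getElem?_eq_getElem (by rw [hlen]; exact i.2)]
      simp [π]

theorem isBigO_mul_log (C : ℕ) :
    (fun n : ℕ => ((C * ((n + 1) * (Nat.log 2 n + 1)) : ℕ) : ℝ)) =O[atTop]
      fun n : ℕ => (n : ℝ) * Real.log n := by
  refine IsBigO.of_bound (C * (4 / Real.log 2)) ?_
  filter_upwards [eventually_ge_atTop 2] with n hn
  have hl2 : 0 < Real.log 2 := Real.log_pos (by norm_num)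
  have hn' : (2 : ℝ) ≤ n := by exact_mod_cast hn
  have hlog : Real.log 2 ≤ Real.log n := Real.log_le_log (by norm_num) hn'
  have h1 : (Nat.log 2 n : ℝ) * Real.log 2 ≤ Real.log n := by
    rw [← Real.log_pow]
    refine Real.log_le_log (by positivity) ?_
    exact_mod_cast Nat.pow_log_le_self 2 (by omega)
  have h2 : ((Nat.log 2 n : ℝ) + 1) * Real.log 2 ≤ 2 * Real.log n := by linarith
  have h3 : (Nat.log 2 n : ℝ) + 1 ≤ 2 * Real.log n / Real.log 2 := (le_div_iff₀ hl2).2 h2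
  rw [Real.norm_of_nonneg (by positivity), Real.norm_of_nonneg (by positivity)]
  push_cast
  calc (C : ℝ) * (((n : ℝ) + 1) * (Nat.log 2 n + 1))
      ≤ C * ((2 * n) * (2 * Real.log n / Real.log 2)) := by
        gcongr
        linarith
    _ = C * (4 / Real.log 2) * (n * Real.log n) := by ring

end LinMim

theorem mainTheorem3 :
    ∃ (P : WordRAM.Prog) (c : ℕ) (t : ℕ → ℕ),
      (fun n : ℕ => (t n : ℝ)) =O[atTop] (fun n : ℕ => (n : ℝ) * Real.log n) ∧
      ∀ (n : ℕ) (T : SimpleGraph (Fin n)) (adj : Fin n → List (Fin n)),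
        T.IsTree → IsAdjLists T adj →
        ∃ (k : ℕ) (s : WordRAM.Store),
          WordRAM.Exec (c * (Nat.log 2 n + 1)) P (inputStore adj) k s ∧
          k ≤ t n ∧
          ∃ σ : Fin n ≃ Fin n, HoldsLayout s σ ∧ layoutMim T σ = lmw T := by
  obtain ⟨C, hC⟩ := LinMim.algorithmTime_le
  refine ⟨LinMim.layoutAlgorithm, 8, fun n => C * ((n + 1) * (Nat.log 2 n + 1)),
    LinMim.isBigO_mul_log C, fun n T adj hT hA => ?_⟩
  have hn : 0 < n := by
    obtain ⟨v⟩ := hT.connected.nonempty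
    exact v.pos
  have hpow : n + 1 ≤ 2 ^ (Nat.log 2 n + 1) := Nat.lt_pow_succ_log_self (by decide) n
  have hw : 64 * (n + 1) ^ 2 ≤ 2 ^ (8 * (Nat.log 2 n + 1)) := by
    rw [Nat.mul_comm 8, pow_mul]
    calc 64 * (n + 1) ^ 2 = 2 ^ 6 * (n + 1) ^ 2 := by norm_num
      _ ≤ (n + 1) ^ 6 * (n + 1) ^ 2 := by gcongr; omega
      _ = (n + 1) ^ 8 := by ring
      _ ≤ _ := Nat.pow_le_pow_left hpow 8
  obtain ⟨k, s, h1, h2, h3⟩ := LinMim.layoutAlgorithm_spec hT hA hn hw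
  exact ⟨k, s, h1, h2.trans (hC n _ (Nat.succ_pos _)), h3⟩
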